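/- Let $F$ be an algebraically closed field of characteristic $0$; all vector spaces are finite dimensional over $F$. Let $V$ be an abelian Lie algebra, let $x\in\mathrm{GL}(V)$ be non-diagonalizable, and let $\mathfrak g=\langle x\rangle\ltimes V$, so that $[x,v]=x(v)$ and $[v,w]=0$ for $v,w\in V$. A representation of a Lie algebra is *uniserial* if its module is nonzero and its submodules form a chain under inclusion. Write $J_p(\alpha)$ (resp. $J^p(\alpha)$) for the lower (resp. upper) triangular Jordan block of size $p$ with eigenvalue $\alpha$. Suppose that $x$ has $e>1$ Jordan blocks: $V=V_1\oplus\cdots\oplus V_e$, where $x$ acts on $V_i$ via $J_{n_i}(\lambda_i)$ relative to some basis of $V_i$, and $n=n_1\ge n_2\ge\cdots\ge n_e\ge1$. Put $\lambda=\lambda_1$, $\mathfrak g_1=\langle x|_{V_1}\rangle\ltimes V_1$, viewed as a subalgebra of $\mathfrak g$ (with $x|_{V_1}$ identified with $x$), and let $v_0,\dots,v_{n-1}$ be a basis of $V_1$ relative to which $x|_{V_1}$ has matrix $J_n(\lambda)$. For $\alpha\in F$, $1\le k\le n$ and $X\in M_{(k-1)\times(n-k)}(F)$, let $R_{\alpha,k,X}:\mathfrak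 g_1\to\mathfrak{gl}(n+1)$ be the linear map $$x\mapsto A=J^k(\alpha)\oplus J^{n+1-k}(\alpha-\lambda),\qquad v_l\mapsto(\mathrm{ad}\,A-\lambda 1)^l E_0\quad(0\le l\le n-1),$$ where $E_0=\begin{pmatrix}0&N\\0&0\end{pmatrix}$ and $N=\begin{pmatrix}0&X\\1&0\end{pmatrix}\in M_{k\times(n+1-k)}(F)$ (for $k\in\{1,n\}$ the matrix $X$ is empty). For $\alpha\in F$ and $a=(a_1,\dots,a_n)\in F^n$ with $a_1=1$ and $a_i=0$ for all even $i$, let $R_{\alpha,a}:\mathfrak g_1\to\mathfrak{gl}(n+2)$ be the linear map $$x\mapsto B=J^1(\alpha)\oplus J^n(\alpha-\lambda)\oplus J^1(\alpha-2\lambda),\qquad v_l\mapsto(\mathrm{ad}\,B-\lambda 1)^l\begin{pmatrix}0&a&0\\0&0&e_n\\0&0&0\end{pmatrix}\quad(0\le l\le n-1),$$ where $e_n$ is the last canonical column vector of $F^n$. Let $\mathcal M_{p,q}\subseteq\mathfrak{gl}(p+q)$ be the space of all matrices $\begin{pmatrix}0&N\\0&0\end{pmatrix}$ with $N\in M_{p\times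 q}(F)$. Consider the conditions (a) $\lambda_1=\cdots=\lambda_e=\lambda$ and $n_i\le n-2(i-1)$ for $2\le i\le e$; (b) $e=2$, $n_2=1$ and $\lambda_2=2\lambda$, i.e. $x$ has Jordan decomposition $J_n(\lambda)\oplus J_1(2\lambda)$. **Theorem.** (1) Let $R:\mathfrak g\to\mathfrak{gl}(d)$ be a faithful uniserial representation. Then its restriction $R_1$ to $\mathfrak g_1$ is uniserial, and $d=n+1$ or $d=n+2$. If $d=n+1$, then (a) holds and $R_1$ is isomorphic to $R_{\alpha,k,X}$ for a unique triple $(\alpha,k,X)$ with $1\le k\le n$; moreover $1<k<n$ and $e\le\min\{k,n+1-k\}$. If $d=n+2$, then (b) holds, $n$ is odd, and $R_1$ is isomorphic to $R_{\alpha,a}$ for a unique pair $(\alpha,a)$ as above. (2) Suppose that (a) holds, $1<k<n$ and $e\le\min\{k,n+1-k\}$, and let $\alpha\in F$, $X\in M_{(k-1)\times(n-k)}(F)$. Then $R_{\alpha,k,X}$ can be extended to a faithful uniserial representation of $\mathfrak g$ on the same space. Restriction to $V$ is a bijection from the set of such extensions $\mathfrak g\to\mathfrak{gl}(n+1)$ onto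 the set of $F[t]$-monomorphisms $V\to\mathcal M_{k,n+1-k}$ with $v_0\mapsto E_0$, where $t$ acts on $V$ via $\mathrm{ad}\,x-\lambda1$ (that is, $x-\lambda 1$) and on $\mathcal M_{k,n+1-k}$ via $\mathrm{ad}\,A-\lambda 1$. Abstractly, put $s=\min\{k,n+1-k\}$: there are $F[t]$-isomorphisms $$V\cong\bigoplus_{i=1}^{e}F[t]/(t^{n_i}),\qquad \mathcal M_{k,n+1-k}\cong\bigoplus_{i=1}^{s}F[t]/(t^{n-2(i-1)}),$$ which send $v_0$ and $E_0$, respectively, to the class of $1$ in the first summand, and under which the extensions correspond bijectively to the $F[t]$-monomorphisms from the first direct sum to the second that are the identity map on the first summand $F[t]/(t^n)$. Two such extensions of $R_{\alpha,k,X}$ are isomorphic if and only if they are equal. (3) Suppose that (b) holds and $n$ is odd, and let $R_{\alpha,a}$ be as above. Then $R_{\alpha,a}$ can be extended to a faithful uniserial representation of $\mathfrak g$ on the same space. If $0\ne w_0\in V_2$, the extensions $\mathfrak g\to\mathfrak{gl}(n+2)$ are given by $w_0\mapsto\beta E^{1,n+2}$, one for each nonzero $\beta\in F$, where $E^{1,n+2}$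 is the matrix with entry $1$ in position $(1,n+2)$ and zeros elsewhere. Two such extensions of $R_{\alpha,a}$ are isomorphic if and only if they are equal. (4) $\mathfrak g$ has a faithful uniserial representation if and only if (a) holds, or (b) holds and $n$ is odd. -/

import Mathlib

open Module

attribute [local instance 100] LieRing.ofAssociativeRing

noncomputable section

namespace UniserialSolvable

variable {F : Type*} [Field F]

/-! ## Jordan blocks -/

/-- The upper triangular Jordan block `J^p(α)`. -/
def upperJordan (p : ℕ) (α : F) : Matrix (Fin p) (Fin p) F :=
  fun i j => if i = j then α else if (i : ℕ) + 1 = (j : ℕ) then 1 else 0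

/-- The lower triangular Jordan block `J_p(α)`. -/
def lowerJordan (p : ℕ) (α : F) : Matrix (Fin p) (Fin p) F :=
  fun i j => if i = j then α else if (j : ℕ) + 1 = (i : ℕ) then 1 else 0

/-- A linear operator is diagonalizable if there is a basis consisting of eigenvectors. -/
def IsDiagonalizable {V : Type*} [AddCommGroup V] [Module F V] (x : End F V) : Prop :=
  ∃ (b : Basis (Fin (finrank F V)) F V) (μ : Fin (finrank F V) → F), ∀ i, x (b i) = μ i • b i

/-- A decomposition `V = V_1 ⊕ ⋯ ⊕ V_e` into nonzero subspaces, of dimensions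
`n_1 ≥ ⋯ ≥ n_e`, together with a basis of each `V_i` relative to which `x` acts on `V_i` via the
lower triangular Jordan block `J_{n_i}(λ_i)`. The summands are indexed from `0` to `e - 1`. -/
structure JordanDecomposition {V : Type*} [AddCommGroup V] [Module F V]
    (x : End F V) (e : ℕ) where
  /-- the summands `V_i` -/
  block : Fin e → Submodule F V
  isInternal : DirectSum.IsInternal block
  /-- the sizes `n_i` -/
  size : Fin e → ℕ
  size_pos : ∀ i, 0 < size i
  size_antitone : Antitone size
  /-- the eigenvalues `λ_i` -/
  eigenvalue : Fin e → F
  /-- the basis of `V_i` -/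
  basis : ∀ i, Basis (Fin (size i)) F (block i)
  apply_basis : ∀ i j, x (basis i j : V) =
    ∑ l, lowerJordan (size i) (eigenvalue i) l j • (basis i l : V)

/-! ## The Lie algebra `⟨x⟩ ⋉ V` -/

section Algebra

variable {V : Type*} [LieRing V] [LieAlgebra F V] [IsLieAbelian V]

/-- Every linear operator on an abelian Lie algebra is a derivation. -/
def abelianDerivation (x : End F V) : LieDerivation F V V where
  toLinearMap := x
  leibniz' a b := by simp [trivial_lie_zero]

/-- The action of the one-dimensional Lie algebra `⟨x⟩` (with generator `1 : F`) on `V`. -/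
def action (x : End F V) : F →ₗ⁅F⁆ LieDerivation F V V where
  toFun c := c • abelianDerivation x
  map_add' a b := add_smul a b _
  map_smul' a b := by simp [mul_smul]
  map_lie' := by
    intro a b
    ext v
    simp [Ring.lie_def, mul_comm]

/-- The Lie algebra `𝔤 = ⟨x⟩ ⋉ V`. -/
abbrev Alg (x : End F V) : Type _ := LieAlgebra.SemiDirectSum V F (action x)

/-- The element of `⟨x⟩ ⋉ V` given by an element of `V`. -/
abbrev ofV (x : End F V) (v : V) : Alg x := ⟨v, 0⟩

/-- The generator `x` of `⟨x⟩ ⋉ V`. -/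
abbrev gen (x : End F V) : Alg x := ⟨0, 1⟩

theorem lie_gen_ofV (x : End F V) (v : V) : ⁅gen x, ofV x v⁆ = ofV x (x v) := by
  change (⟨⁅(0 : V), v⁆ + (1 : F) • x v - (0 : F) • x 0, ⁅(1 : F), (0 : F)⁆⟩ : Alg x) = ⟨x v, 0⟩
  simp

theorem lie_ofV_ofV (x : End F V) (v w : V) : ⁅ofV x v, ofV x w⁆ = 0 := by
  simp [trivial_lie_zero]

theorem JordanDecomposition.apply_mem_block {x : End F V} {e : ℕ} (D : JordanDecomposition x e)
    (i : Fin e) {v : V} (hv : v ∈ D.block i) : x v ∈ D.block i := by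
  have h : v = ∑ j, (D.basis i).repr ⟨v, hv⟩ j • (D.basis i j : V) := by
    have h' := congrArg (D.block i).subtype ((D.basis i).sum_repr ⟨v, hv⟩)
    rw [map_sum] at h'
    exact h'.symm
  rw [h, map_sum]
  refine Submodule.sum_mem _ fun j _ => ?_
  rw [map_smul, D.apply_basis]
  exact Submodule.smul_mem _ _
    (Submodule.sum_mem _ fun l _ => Submodule.smul_mem _ _ (D.basis i l).2)

/-- The subalgebra `𝔤_i = ⟨x_i⟩ ⋉ V_i` of `𝔤`. -/
def JordanDecomposition.subalgebra {x : End F V} {e : ℕ} (D : JordanDecomposition x e)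
    (i : Fin e) : LieSubalgebra F (Alg x) where
  carrier := {y | y.left ∈ D.block i}
  add_mem' {a b} ha hb := (D.block i).add_mem ha hb
  zero_mem' := (D.block i).zero_mem
  smul_mem' c y hy := (D.block i).smul_mem c hy
  lie_mem' {a b} ha hb := by
    change ⁅a.left, b.left⁆ + a.right • x b.left - b.right • x a.left ∈ D.block i
    rw [trivial_lie_zero, zero_add]
    exact (D.block i).sub_mem ((D.block i).smul_mem _ (D.apply_mem_block i hb))
      ((D.block i).smul_mem _ (D.apply_mem_block i ha))

end Algebra

/-! ## Matrix representations -/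

section Representations

variable {L : Type*} [LieRing L] [LieAlgebra F L]
variable {ι κ : Type*} [Fintype ι] [DecidableEq ι] [Fintype κ] [DecidableEq κ]

/-- A representation is faithful if it is injective. -/
def IsFaithful (R : L →ₗ⁅F⁆ Matrix ι ι F) : Prop := Function.Injective R

/-- A subspace of column space that is stable under a representation. -/
def IsSubmodule (R : L →ₗ⁅F⁆ Matrix ι ι F) (P : Submodule F (ι → F)) : Prop :=
  ∀ y : L, ∀ v ∈ P, (R y).mulVec v ∈ P

/-- A representation is uniserial if its module is nonzero and its submodules form a chain. -/
def IsUniserial (R : L →ₗ⁅F⁆ Matrix ι ι F) : Prop :=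
  Nontrivial (ι → F) ∧
    ∀ P Q : Submodule F (ι → F), IsSubmodule R P → IsSubmodule R Q → P ≤ Q ∨ Q ≤ P

/-- Isomorphism of matrix representations: a linear isomorphism intertwines the two actions. -/
def IsIsomorphic (R : L →ₗ[F] Matrix ι ι F) (S : L →ₗ[F] Matrix κ κ F) : Prop :=
  ∃ T : (ι → F) ≃ₗ[F] (κ → F), ∀ (y : L) (v : ι → F), T ((R y).mulVec v) = (S y).mulVec (T v)

end Representations

/-- The operator `ad A - λ 1` on `𝔤𝔩`. -/
def adSub {ι : Type*} [Fintype ι] [DecidableEq ι] (A : Matrix ι ι F) (lam : F) :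
    End F (Matrix ι ι F) :=
  LieAlgebra.ad F (Matrix ι ι F) A - lam • (1 : End F (Matrix ι ι F))

/-! ## The module `M_{p,q}` -/

/-- The subspace `M_{p,q}` of `𝔤𝔩(p+q)` of all matrices with an arbitrary upper right `p × q` block
and zeros elsewhere. -/
def hatMatrices (F : Type*) [Field F] (p q : ℕ) :
    Submodule F (Matrix (Fin p ⊕ Fin q) (Fin p ⊕ Fin q) F) where
  carrier := {B | ∃ N : Matrix (Fin p) (Fin q) F, B = Matrix.fromBlocks 0 N 0 0}
  add_mem' := by
    rintro _ _ ⟨N, rfl⟩ ⟨M, rfl⟩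
    exact ⟨N + M, by simp [Matrix.fromBlocks_add]⟩
  zero_mem' := ⟨0, by simp⟩
  smul_mem' := by
    rintro c _ ⟨N, rfl⟩
    exact ⟨c • N, by simp [Matrix.fromBlocks_smul]⟩

/-- The matrix `J^p(α) ⊕ J^q(α - λ)`. -/
def twoBlocks (p q : ℕ) (α lam : F) : Matrix (Fin p ⊕ Fin q) (Fin p ⊕ Fin q) F :=
  Matrix.fromBlocks (upperJordan p α) 0 0 (upperJordan q (α - lam))

theorem adSub_twoBlocks_mem (p q : ℕ) (α lam : F) :
    ∀ B ∈ hatMatrices F p q, adSub (twoBlocks p q α lam) lam B ∈ hatMatrices F p q := by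
  rintro _ ⟨N, rfl⟩
  refine ⟨upperJordan p α * N - N * upperJordan q (α - lam) - lam • N, ?_⟩
  simp [adSub, twoBlocks, LieAlgebra.ad_apply, Ring.lie_def, Matrix.fromBlocks_multiply,
    Matrix.fromBlocks_smul, sub_eq_add_neg, Matrix.fromBlocks_neg, Matrix.fromBlocks_add]

/-- The operator `ad A - λ 1`, where `A = J^p(α) ⊕ J^q(α - λ)`, restricted to `M_{p,q}`. -/
def theta (p q : ℕ) (α lam : F) : End F (hatMatrices F p q) :=
  (adSub (twoBlocks p q α lam) lam).restrict (adSub_twoBlocks_mem p q α lam)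

/-- The `p × q` matrix, `p = k`, `q = n + 1 - k`, with first column the last canonical vector, last
row the first canonical vector, and the matrix `X` in the remaining upper right corner. -/
def cornerMatrix {n k : ℕ} (X : Matrix (Fin (k - 1)) (Fin (n - k)) F) :
    Matrix (Fin k) (Fin (n + 1 - k)) F :=
  fun i j =>
    if hi : (i : ℕ) + 1 = k then (if (j : ℕ) = 0 then 1 else 0)
    else if hj : (j : ℕ) = 0 then 0
    else X ⟨i, by omega⟩ ⟨(j : ℕ) - 1, by omega⟩

/-- The image `E_0` of `v_0` under `R_{α,k,X}`, as an element of `M_{k,n+1-k}`. -/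
def cornerHat {n k : ℕ} (X : Matrix (Fin (k - 1)) (Fin (n - k)) F) :
    hatMatrices F k (n + 1 - k) :=
  ⟨Matrix.fromBlocks 0 (cornerMatrix X) 0 0, cornerMatrix X, rfl⟩

/-- The index set of the rows and columns of matrices made of blocks of sizes `1`, `n`, `1`. -/
abbrev Idx (n : ℕ) : Type := Fin 1 ⊕ (Fin n ⊕ Fin 1)

/-- The matrix `J^1(α) ⊕ J^n(α - λ) ⊕ J^1(α - 2λ)`. -/
def threeBlocks (n : ℕ) (α lam : F) : Matrix (Idx n) (Idx n) F :=
  Matrix.fromBlocks (upperJordan 1 α) 0 0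
    (Matrix.fromBlocks (upperJordan n (α - lam)) 0 0 (upperJordan 1 (α - 2 * lam)))

/-- The matrix with block rows `(0, a, 0)`, `(0, 0, e_n)`, `(0, 0, 0)`, where `e_n` is the last
canonical column vector. -/
def rowColumn {n : ℕ} (a : Fin n → F) : Matrix (Idx n) (Idx n) F :=
  Matrix.fromBlocks 0 (Matrix.fromCols (fun _ j => a j) 0) 0
    (Matrix.fromBlocks 0 (fun i _ => if (i : ℕ) + 1 = n then 1 else 0) 0 0)

/-- The sequences `a = (a_1, …, a_n)` such that `a_1 = 1` and `a_i = 0` for all even `i`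
(the entry `a_i` being `a (i - 1)` here). -/
def IsAdmissible {n : ℕ} (a : Fin n → F) : Prop :=
  (∀ i : Fin n, (i : ℕ) + 1 = 1 → a i = 1) ∧ ∀ i : Fin n, Even ((i : ℕ) + 1) → a i = 0

/-! ## The representations of `𝔤_1` and their extensions to `𝔤` -/

section Extensions

variable {V : Type*} [LieRing V] [LieAlgebra F V] [IsLieAbelian V]
variable {x : End F V} {e : ℕ} [NeZero e]
variable {ι : Type*} [Fintype ι] [DecidableEq ι]

namespace JordanDecomposition

/-- The size `n = n_1` of the first block. -/
abbrev n (D : JordanDecomposition x e) : ℕ := D.size 0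

/-- The eigenvalue `λ` of the first block. -/
abbrev lam (D : JordanDecomposition x e) : F := D.eigenvalue 0

/-- The generator `v_0` of `V_1`. -/
def v₀ (D : JordanDecomposition x e) : V := D.basis 0 ⟨0, D.size_pos 0⟩

/-- The subalgebra `𝔤_1 = ⟨x_1⟩ ⋉ V_1`. -/
abbrev g₁ (D : JordanDecomposition x e) : LieSubalgebra F (Alg x) := D.subalgebra 0

/-- The linear map `𝔤_1 → 𝔤𝔩` such that `x ↦ A` and `v_l ↦ (ad A - λ 1)^l E` for `0 ≤ l ≤ n - 1`. -/
def linearRep (D : JordanDecomposition x e) (A E : Matrix ι ι F) : D.g₁ →ₗ[F] Matrix ι ι F where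
  toFun y := y.1.right • A + ∑ l : Fin D.n, (D.basis 0).repr ⟨y.1.left, y.2⟩ l •
    (adSub A D.lam ^ (l : ℕ)) E
  map_add' y z := by
    have h : (⟨(y + z).1.left, (y + z).2⟩ : D.block 0) =
      ⟨y.1.left, y.2⟩ + ⟨z.1.left, z.2⟩ := rfl
    have h' : (y + z).1.right = y.1.right + z.1.right := rfl
    rw [h, h']
    simp only [map_add, Finsupp.add_apply, add_smul, Finset.sum_add_distrib]
    abel
  map_smul' c y := by
    have h : (⟨(c • y).1.left, (c • y).2⟩ : D.block 0) = c • ⟨y.1.left, y.2⟩ := rfl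
    have h' : (c • y).1.right = c • y.1.right := rfl
    rw [h, h']
    simp only [map_smul, Finsupp.smul_apply, smul_assoc, smul_add, Finset.smul_sum,
      RingHom.id_apply]

/-- The representation `R_{α,k,X}` of `𝔤_1`. For `k = n` and `k = 1`, where `X` is empty, these are
`R_{α,n}` and `R_{α,1}`. -/
def repX (D : JordanDecomposition x e) (α : F) (k : ℕ)
    (X : Matrix (Fin (k - 1)) (Fin (D.n - k)) F) :
    D.g₁ →ₗ[F] Matrix (Fin k ⊕ Fin (D.n + 1 - k)) (Fin k ⊕ Fin (D.n + 1 - k)) F :=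
  D.linearRep (twoBlocks k (D.n + 1 - k) α D.lam) (cornerHat X).1

/-- The representation `R_{α,a}` of `𝔤_1`. -/
def repA (D : JordanDecomposition x e) (α : F) (a : Fin D.n → F) :
    D.g₁ →ₗ[F] Matrix (Idx D.n) (Idx D.n) F :=
  D.linearRep (threeBlocks D.n α D.lam) (rowColumn a)

/-- The restriction `R_1` of a representation of `𝔤` to `𝔤_1`. -/
def restrict (D : JordanDecomposition x e) (R : Alg x →ₗ⁅F⁆ Matrix ι ι F) :
    D.g₁ →ₗ⁅F⁆ Matrix ι ι F :=
  R.comp D.g₁.incl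

/-- The faithful uniserial representations of `𝔤` that extend a given map `ρ` on `𝔤_1`. -/
def Extension (D : JordanDecomposition x e) (ρ : D.g₁ →ₗ[F] Matrix ι ι F) : Type _ :=
  {R : Alg x →ₗ⁅F⁆ Matrix ι ι F //
    IsFaithful R ∧ IsUniserial R ∧ (D.restrict R : D.g₁ →ₗ[F] Matrix ι ι F) = ρ}

/-- All Jordan blocks have the same eigenvalue `λ`, and `n_i ≤ n - 2(i-1)` for `2 ≤ i ≤ e`
(the size `n_i` being `size (i - 1)` here). -/
def IsTypeOne (D : JordanDecomposition x e) : Prop :=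
  (∀ i, D.eigenvalue i = D.lam) ∧ ∀ i : Fin e, D.size i + 2 * (i : ℕ) ≤ D.n

/-- The Jordan decomposition is `J_n(λ) ⊕ J_1(2λ)`. -/
def IsTypeTwo (D : JordanDecomposition x e) : Prop :=
  e = 2 ∧ ∀ i : Fin e, i ≠ 0 → D.size i = 1 ∧ D.eigenvalue i = 2 * D.lam

/-- `V` as an `F[t]`-module, `t` acting via `x - λ 1`, which is `ad x - λ 1` on `V`. -/
abbrev polyV (D : JordanDecomposition x e) : Type _ :=
  AEval' (x - D.lam • (1 : End F V))

/-- `M_{k,n+1-k}` as an `F[t]`-module, `t` acting via `ad A - λ 1`, where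
`A = J^k(α) ⊕ J^{n+1-k}(α - λ)`. -/
abbrev polyM (D : JordanDecomposition x e) (α : F) (k : ℕ) : Type _ :=
  AEval' (theta k (D.n + 1 - k) α D.lam)

/-- The `F[t]`-monomorphisms `V → M_{k,n+1-k}` sending `v_0` to `E_0`. -/
def Mono (D : JordanDecomposition x e) (α : F) (k : ℕ)
    (X : Matrix (Fin (k - 1)) (Fin (D.n - k)) F) : Type _ :=
  {φ : D.polyV →ₗ[Polynomial F] D.polyM α k //
    Function.Injective φ ∧
      φ (AEval'.of (x - D.lam • (1 : End F V)) D.v₀) =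
        AEval'.of (theta k (D.n + 1 - k) α D.lam) (cornerHat X)}

/-- The matrix that a monomorphism `V → M_{k,n+1-k}` assigns to `v ∈ V`. -/
def Mono.matrix {D : JordanDecomposition x e} {α : F} {k : ℕ}
    {X : Matrix (Fin (k - 1)) (Fin (D.n - k)) F} (φ : D.Mono α k X) (v : V) :
    Matrix (Fin k ⊕ Fin (D.n + 1 - k)) (Fin k ⊕ Fin (D.n + 1 - k)) F :=
  ((AEval'.of (theta k (D.n + 1 - k) α D.lam)).symm
    (φ.1 (AEval'.of (x - D.lam • (1 : End F V)) v))).1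

end JordanDecomposition

end Extensions

/-! ## Abstract torsion modules -/

/-- The `F[t]`-module `F[t]/(t^{m_1}) ⊕ ⋯ ⊕ F[t]/(t^{m_s})`. -/
abbrev Torsion (F : Type*) [Field F] {s : ℕ} (m : Fin s → ℕ) : Type _ :=
  (i : Fin s) → Polynomial F ⧸ Ideal.span {(Polynomial.X : Polynomial F) ^ m i}

/-- The element of the first summand represented by a polynomial. -/
def inFirst {s : ℕ} (m : Fin s → ℕ) (p : Polynomial F) : Torsion F m :=
  fun i => if (i : ℕ) = 0 then Ideal.Quotient.mk _ p else 0

/-- The `F[t]`-monomorphisms that are the identity map on the first summand. -/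
def AbstractMono (F : Type*) [Field F] {r s : ℕ} (m : Fin r → ℕ) (m' : Fin s → ℕ) : Type _ :=
  {f : Torsion F m →ₗ[Polynomial F] Torsion F m' //
    Function.Injective f ∧ ∀ p : Polynomial F, f (inFirst m p) = inFirst m' p}

end UniserialSolvable

end

/-!
Let `R` be a faithful uniserial representation of `𝔤 = ⟨x⟩ ⋉ V` on `U`. Since `x` is invertible,
the elements of `V` act by nilpotent operators (`Action.isNilpotent_ρ`), so the chain
`U ⊇ VU ⊇ V²U ⊇ ⋯` reaches zero. As submodules form a chain, each of its quotients has a single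
eigenvalue of `x`, and `U` is the direct sum of subspaces `G_0, G_1, …` on which `x` acts with
eigenvalues `β + iμ` and on which `V` acts by raising the index
(`Action.IsChain.nonempty_grading`). The chain condition also shows that `x` acts on
`G_i` by one Jordan block (`Action.Grading.nonempty_layer`), and that a vector of `V` of
weight `μ` links the socle of `G_i` with the top of `G_{i+1}`
(`Action.Grading.Layer.exists_π_ρ_ne_zero`).

Suppose that `G_i`, `G_{i+1}` and `G_{i+2}` are nonzero. The operators of `V` commute, and moving
a power of `A - γ 1`, where `A` is the action of `x`, across two of them costs a sign
(`Action.apply_ρ_pow_ρ_swap`). This forces `dim G_{i+1}` to be odd, and a refinement of the same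
computation forces the outer two summands to be lines (`Action.Grading.Layer.three_layers`). With
four summands, `x` would hence be semisimple on `U` and therefore on `V`. As `x` is not
diagonalizable, there are exactly two summands, or three of dimensions `1`, odd and `1`
(`Action.Grading.two_or_three`).

With two summands, all eigenvalues of `x` on `V` equal `μ`, and coordinates adapted to the top
vector `v_0` of the largest block turn `R` on `𝔤_1` into `R_{α,k,X}`
(`Action.Grading.exists_coordinates_of_two`). Then `V` acts by elements of `M_{k,n+1-k}`, and `R`
amounts to a monomorphism of `F[t]`-modules `V → M_{k,n+1-k}`
(`JordanDecomposition.extensionEquivMono`). The target is the tensor product of two irreducible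
modules of `𝔰𝔩₂` restricted to a nilpotent element, and it decomposes by Clebsch-Gordan
(`exists_hatMatrices_equiv`). The explicit generators used here come from identifying matrices
with polynomials in two variables and `ad A - λ 1` with `∂_x - ∂_y`. Comparing the two
decompositions gives the bounds on the block sizes (`JordanDecomposition.isTypeOne_of_mono`) and,
conversely, the existence of monomorphisms (`nonempty_abstractMono`).

With three summands, the vectors of weight `2μ` are determined by one matrix entry and those of
weight `μ` by their action on the line `G_0`, so that `x` has the Jordan form `J_n(μ) ⊕ J_1(2μ)`
(`Action.Grading.eigenvalue_eq_of_three`, `Action.Grading.le_two_of_three`). Suitable coordinates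
give `R_{α,a}`, where `a` has vanishing entries at even positions by the sign rule
(`Action.Grading.exists_coordinates_of_three`). Conversely, that vanishing is what makes the
matrices of the `v_l` commute (`adSub_pow_rowColumn_comm`), and the second block may act by any
nonzero multiple of `E^{1,n+2}`, since these matrices are the eigenvectors of `ad B` with
eigenvalue `2λ` (`JordanDecomposition.exists_extension_repA_equiv`).

Uniseriality of `R_{α,k,X}` and `R_{α,a}` holds because suitable operators lower the leading index
of a vector one step at a time (`chain_of_leading`). Uniqueness of the parameters, and the fact
that isomorphic extensions are equal, follow from the scarcity of intertwining matrices
(`corner_intertwiner_scalar`, `rowColumn_intertwiner_scalar`): they are scalar.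
-/

set_option linter.unusedSectionVars false

namespace UniserialSolvable

/-! ### Jordan blocks and intertwining matrices -/

section JordanMatrices

variable {F : Type*} [Field F]

theorem upperJordan_mul_apply {p : ℕ} {m : Type*} (α : F) (N : Matrix (Fin p) m F)
    (i : Fin p) (j : m) :
    (upperJordan p α * N) i j =
      α * N i j + if h : (i : ℕ) + 1 < p then N ⟨i + 1, h⟩ j else 0 := by
  rw [Matrix.mul_apply]
  have key : ∀ l : Fin p, upperJordan p α i l * N l j =
      (if l = i then α * N i j else 0) + (if (i : ℕ) + 1 = (l : ℕ) then N l j else 0) := by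
    intro l
    unfold upperJordan
    by_cases h1 : i = l
    · subst h1; simp
    · have h1' : ¬ l = i := fun h => h1 h.symm
      by_cases h2 : (i : ℕ) + 1 = (l : ℕ) <;> simp [h1, h1', h2]
  rw [Finset.sum_congr rfl fun l _ => key l, Finset.sum_add_distrib]
  congr 1
  · simp
  · split_ifs with h
    · rw [Finset.sum_eq_single ⟨i + 1, h⟩]
      · simp
      · intro b _ hb
        rw [if_neg]
        intro hh
        exact hb (Fin.ext hh.symm)
      · simp
    · refine Finset.sum_eq_zero fun b _ => if_neg ?_
      have := b.2
      omega

theorem mul_upperJordan_apply {p : ℕ} {m : Type*} (α : F) (N : Matrix m (Fin p) F)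
    (i : m) (j : Fin p) :
    (N * upperJordan p α) i j =
      α * N i j + if 0 < (j : ℕ) then N i ⟨j - 1, by omega⟩ else 0 := by
  rw [Matrix.mul_apply]
  have key : ∀ l : Fin p, N i l * upperJordan p α l j =
      (if l = j then α * N i j else 0) + (if (l : ℕ) + 1 = (j : ℕ) then N i l else 0) := by
    intro l
    unfold upperJordan
    by_cases h1 : l = j
    · subst h1; simp [mul_comm]
    · by_cases h2 : (l : ℕ) + 1 = (j : ℕ) <;> simp [h1, h2]
  rw [Finset.sum_congr rfl fun l _ => key l, Finset.sum_add_distrib]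
  congr 1
  · simp
  · split_ifs with h
    · rw [Finset.sum_eq_single ⟨j - 1, by omega⟩]
      · rw [if_pos]; simp only; omega
      · intro b _ hb
        rw [if_neg]
        intro hh
        exact hb (Fin.ext (by simp only; omega))
      · simp
    · refine Finset.sum_eq_zero fun b _ => if_neg ?_
      omega

/-- The Sylvester operator `N ↦ J N - N J'` of two Jordan blocks has the difference of their
eigenvalues as its only eigenvalue. -/
theorem eq_zero_of_upperJordan_sylvester {p q : ℕ} {α β c : F} (hc : α - β ≠ c)
    {N : Matrix (Fin p) (Fin q) F}
    (h : upperJordan p α * N - N * upperJordan q β = c • N) : N = 0 := by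
  have key : ∀ (s : ℕ) (i : Fin p) (j : Fin q), p - (i : ℕ) + j = s → N i j = 0 := by
    intro s
    induction s using Nat.strong_induction_on with
    | _ s ih =>
      intro i j hs
      have h' := congrFun (congrFun h i) j
      rw [Matrix.sub_apply, upperJordan_mul_apply, mul_upperJordan_apply, Matrix.smul_apply,
        smul_eq_mul] at h'
      have e1 : (if h : (i : ℕ) + 1 < p then N ⟨i + 1, h⟩ j else 0) = 0 := by
        split_ifs with h1
        · exact ih (p - ((i : ℕ) + 1) + j) (by omega) _ _ rfl
        · rfl
      have e2 : (if 0 < (j : ℕ) then N i ⟨j - 1, by omega⟩ else 0) = 0 := by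
        split_ifs with h1
        · exact ih (p - (i : ℕ) + (j - 1)) (by omega) _ _ rfl
        · rfl
      rw [e1, e2] at h'
      have : (α - β - c) * N i j = 0 := by linear_combination h'
      exact (mul_eq_zero.mp this).resolve_left (sub_ne_zero.mpr hc)
  ext i j
  exact key _ i j rfl

theorem eq_zero_of_upperJordan_intertwine {p q : ℕ} {α β : F} (hc : α ≠ β)
    {N : Matrix (Fin p) (Fin q) F}
    (h : upperJordan p α * N = N * upperJordan q β) : N = 0 :=
  eq_zero_of_upperJordan_sylvester (c := 0) (sub_ne_zero.mpr hc) (by rw [h]; simp)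

/-- A matrix that commutes with a Jordan block is a Toeplitz matrix. -/
theorem commute_upperJordan_succ {p : ℕ} {α : F} {M : Matrix (Fin p) (Fin p) F}
    (h : upperJordan p α * M = M * upperJordan p α) (i j : Fin p) :
    (if h : (i : ℕ) + 1 < p then M ⟨i + 1, h⟩ j else 0) =
      if 0 < (j : ℕ) then M i ⟨j - 1, by omega⟩ else 0 := by
  have h' := congrFun (congrFun h i) j
  rw [upperJordan_mul_apply, mul_upperJordan_apply] at h'
  exact add_left_cancel h'

/-- A matrix that commutes with a Jordan block is determined by its last column. -/
theorem eq_scalar_of_commute_of_last_col {p : ℕ} {α c : F} {M : Matrix (Fin p) (Fin p) F}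
    (h : upperJordan p α * M = M * upperJordan p α)
    (hc : ∀ i j : Fin p, (j : ℕ) + 1 = p → M i j = if i = j then c else 0) :
    M = c • (1 : Matrix (Fin p) (Fin p) F) := by
  have key : ∀ (s : ℕ) (i j : Fin p), (j : ℕ) + 1 + s = p → M i j = if i = j then c else 0 := by
    intro s
    induction s with
    | zero => exact fun i j hj => hc i j hj
    | succ s ih =>
      intro i j hj
      have := commute_upperJordan_succ h i ⟨j + 1, by omega⟩
      simp only [Nat.succ_pos, if_true, Nat.add_sub_cancel] at this
      rw [← this]
      by_cases hi : (i : ℕ) + 1 < p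
      · rw [dif_pos hi, ih _ _ (by simp only; omega)]
        simp [Fin.ext_iff]
      · rw [dif_neg hi, if_neg]
        rw [Fin.ext_iff]; omega
  ext i j
  rw [key (p - (j + 1)) i j (by omega)]
  simp [Matrix.one_apply]

/-- A matrix that commutes with a Jordan block is determined by its first row. -/
theorem eq_scalar_of_commute_of_first_row {p : ℕ} {α c : F} {M : Matrix (Fin p) (Fin p) F}
    (h : upperJordan p α * M = M * upperJordan p α)
    (hc : ∀ i j : Fin p, (i : ℕ) = 0 → M i j = if i = j then c else 0) :
    M = c • (1 : Matrix (Fin p) (Fin p) F) := by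
  have key : ∀ (s : ℕ) (i j : Fin p), (i : ℕ) = s → M i j = if i = j then c else 0 := by
    intro s
    induction s with
    | zero => exact fun i j hj => hc i j hj
    | succ s ih =>
      intro i j hi
      have h2 : (⟨i - 1, by omega⟩ : Fin p) + (1 : ℕ) < p := by simp only; omega
      have := commute_upperJordan_succ h ⟨i - 1, by omega⟩ j
      rw [dif_pos h2] at this
      have e : (⟨((⟨i - 1, by omega⟩ : Fin p) : ℕ) + 1, h2⟩ : Fin p) = i := by
        apply Fin.ext; simp only; omega
      rw [e] at this
      rw [this]
      by_cases hj : 0 < (j : ℕ)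
      · rw [if_pos hj, ih _ _ (by simp only; omega)]
        simp only [Fin.ext_iff]
        congr 1
        apply propext; omega
      · rw [if_neg hj, if_neg]
        rw [Fin.ext_iff]; omega
  ext i j
  rw [key i i j rfl]
  simp [Matrix.one_apply]

/-- The first basis vector spans the eigenspace of a Jordan block. -/
theorem first_col_of_commute {p : ℕ} {α : F} {M : Matrix (Fin p) (Fin p) F}
    (h : upperJordan p α * M = M * upperJordan p α) (i j : Fin p) (hj : (j : ℕ) = 0)
    (hi : i ≠ j) : M i j = 0 := by
  have hi' : 0 < (i : ℕ) := by
    rw [Ne, Fin.ext_iff] at hi; omega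
  have h2 : (⟨i - 1, by omega⟩ : Fin p) + (1 : ℕ) < p := by simp only; omega
  have := commute_upperJordan_succ h ⟨i - 1, by omega⟩ j
  rw [dif_pos h2, if_neg (by omega)] at this
  rw [← this]
  congr 1
  apply Fin.ext; simp only; omega

theorem cornerMatrix_last {n k : ℕ} (X : Matrix (Fin (k - 1)) (Fin (n - k)) F)
    (i : Fin k) (j : Fin (n + 1 - k)) (hi : (i : ℕ) + 1 = k) :
    cornerMatrix X i j = if (j : ℕ) = 0 then 1 else 0 := by
  simp [cornerMatrix, hi]

theorem cornerMatrix_first {n k : ℕ} (X : Matrix (Fin (k - 1)) (Fin (n - k)) F)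
    (i : Fin k) (j : Fin (n + 1 - k)) (hj : (j : ℕ) = 0) :
    cornerMatrix X i j = if (i : ℕ) + 1 = k then 1 else 0 := by
  simp [cornerMatrix, hj]

theorem cornerMatrix_injective {n k : ℕ} {X Y : Matrix (Fin (k - 1)) (Fin (n - k)) F}
    (h : cornerMatrix X = cornerMatrix Y) : X = Y := by
  ext i j
  have hi := i.2
  have hj := j.2
  have h' := congrFun (congrFun h ⟨i, by omega⟩) ⟨j + 1, by omega⟩
  have hne : ¬ ((i : ℕ) + 1 = k) := by omega
  simpa [cornerMatrix, hne] using h'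

/-- A matrix with the prescribed first column and last row is of the form `cornerMatrix X`. -/
theorem exists_eq_cornerMatrix {n k : ℕ} (N : Matrix (Fin k) (Fin (n + 1 - k)) F)
    (h1 : ∀ (i : Fin k) (j : Fin (n + 1 - k)), (j : ℕ) = 0 →
      N i j = if (i : ℕ) + 1 = k then 1 else 0)
    (h2 : ∀ (i : Fin k) (j : Fin (n + 1 - k)), (i : ℕ) + 1 = k →
      N i j = if (j : ℕ) = 0 then 1 else 0) :
    ∃ X : Matrix (Fin (k - 1)) (Fin (n - k)) F, N = cornerMatrix X := by
  refine ⟨Matrix.of fun i j => N ⟨i, by omega⟩ ⟨j + 1, by omega⟩, ?_⟩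
  ext i j
  by_cases hi : (i : ℕ) + 1 = k
  · rw [cornerMatrix_last _ _ _ hi, h2 _ _ hi]
  · by_cases hj : (j : ℕ) = 0
    · rw [cornerMatrix_first _ _ _ hj, h1 _ _ hj]
    · simp only [cornerMatrix, hi, hj, dif_neg, not_false_iff, Matrix.of_apply]
      congr 1
      apply Fin.ext; simp only; omega

section Intertwiners

open Matrix

/-- A matrix that intertwines two matrices of the form `J^p(α) ⊕ J^q(α-λ)` is block diagonal, since
`α ≠ α - λ`. -/
theorem twoBlocks_intertwine {p q p' q' : ℕ} {α lam : F} (hlam : lam ≠ 0)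
    {P : Matrix (Fin p' ⊕ Fin q') (Fin p ⊕ Fin q) F}
    (h : P * twoBlocks p q α lam = twoBlocks p' q' α lam * P) :
    ∃ (P₁ : Matrix (Fin p') (Fin p) F) (P₂ : Matrix (Fin q') (Fin q) F),
      P = fromBlocks P₁ 0 0 P₂ ∧ upperJordan p' α * P₁ = P₁ * upperJordan p α ∧
        upperJordan q' (α - lam) * P₂ = P₂ * upperJordan q (α - lam) := by
  obtain ⟨P₁, P₁₂, P₂₁, P₂, rfl⟩ : ∃ A B C D, P = fromBlocks A B C D :=
    ⟨_, _, _, _, (fromBlocks_toBlocks P).symm⟩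
  simp only [twoBlocks, fromBlocks_multiply, fromBlocks_inj] at h
  obtain ⟨h1, h2, h3, h4⟩ := h
  simp only [Matrix.mul_zero, Matrix.zero_mul, add_zero, zero_add] at h1 h2 h3 h4
  have e1 : P₁₂ = 0 := eq_zero_of_upperJordan_intertwine
    (by intro h'; apply hlam; linear_combination h' : α ≠ α - lam) h2.symm
  have e2 : P₂₁ = 0 := eq_zero_of_upperJordan_intertwine
    (by intro h'; apply hlam; linear_combination -h' : α - lam ≠ α) h3.symm
  exact ⟨P₁, P₂, by rw [e1, e2], h1.symm, h4.symm⟩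

/-- An endomorphism of a representation that takes the values `J^k(α) ⊕ J^{n+1-k}(α-λ)` and `E_0`
is a scalar; more generally this holds for intertwining operators between two choices of `E_0`. -/
theorem corner_intertwiner_scalar {n k : ℕ} {α lam : F} (hlam : lam ≠ 0) (hk : 1 ≤ k)
    (hkn : k ≤ n) {X Y : Matrix (Fin (k - 1)) (Fin (n - k)) F}
    {P : Matrix (Fin k ⊕ Fin (n + 1 - k)) (Fin k ⊕ Fin (n + 1 - k)) F}
    (h : P * twoBlocks k (n + 1 - k) α lam = twoBlocks k (n + 1 - k) α lam * P)
    (hE : P * (cornerHat X).1 = (cornerHat Y).1 * P) :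
    ∃ c : F, P = c • (1 : Matrix _ _ F) ∧ c • X = c • Y := by
  obtain ⟨P₁, P₂, rfl, h1, h2⟩ := twoBlocks_intertwine hlam h
  simp only [cornerHat, fromBlocks_multiply, fromBlocks_inj] at hE
  have hE' : P₁ * cornerMatrix X = cornerMatrix Y * P₂ := by simpa using hE.2.1
  set k' : Fin k := ⟨k - 1, by omega⟩ with hk'
  set z : Fin (n + 1 - k) := ⟨0, by omega⟩ with hz
  set c := P₂ z z with hc
  -- the first columns of `P₁ N = N' P₂` give the last column of `P₁`
  have hP1 : P₁ = c • (1 : Matrix _ _ F) := by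
    refine eq_scalar_of_commute_of_last_col h1 fun i j hj => ?_
    have hj' : j = k' := Fin.ext (by simp only [hk']; omega)
    have := congrFun (congrFun hE' i) z
    rw [Matrix.mul_apply, Matrix.mul_apply, Finset.sum_eq_single k', Finset.sum_eq_single z] at this
    · rw [cornerMatrix_first X _ _ rfl, cornerMatrix_first Y _ _ rfl,
        if_pos (by simp only [hk']; omega), mul_one] at this
      rw [hj', this]
      by_cases hi : i = k'
      · rw [if_pos hi, if_pos (by rw [hi, hk']; simp only; omega), one_mul]
      · rw [if_neg hi, if_neg, zero_mul]
        intro hh; exact hi (Fin.ext (by simp only [hk']; omega))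
    · intro b _ hb
      rw [first_col_of_commute h2 b z rfl hb, mul_zero]
    · simp
    · intro b _ hb
      rw [cornerMatrix_first X _ _ rfl, if_neg, mul_zero]
      intro hh; exact hb (Fin.ext (by simp only [hk']; omega))
    · simp
  -- the last rows of `P₁ N = N' P₂` give the first row of `P₂`
  rw [hP1, Matrix.smul_mul, Matrix.one_mul] at hE'
  have hP2 : P₂ = c • (1 : Matrix _ _ F) := by
    refine eq_scalar_of_commute_of_first_row h2 fun i j hi => ?_
    have hi' : i = z := Fin.ext hi
    have := congrFun (congrFun hE' k') j
    rw [Matrix.mul_apply, Finset.sum_eq_single z, Matrix.smul_apply,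
      cornerMatrix_last X _ _ (by simp only [hk']; omega),
      cornerMatrix_last Y _ _ (by simp only [hk']; omega), if_pos (show (z : ℕ) = 0 from rfl),
      one_mul] at this
    · rw [hi', ← this]
      simp only [smul_eq_mul, mul_ite, mul_one, mul_zero, Fin.ext_iff, hz]
      congr 1
      exact propext eq_comm
    · intro b _ hb
      rw [cornerMatrix_last Y _ _ (by simp only [hk']; omega), if_neg, zero_mul]
      intro hh; exact hb (Fin.ext hh)
    · simp
  refine ⟨c, ?_, ?_⟩
  · rw [hP1, hP2, ← fromBlocks_one, fromBlocks_smul]; simp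
  · rw [hP2, Matrix.mul_smul, Matrix.mul_one] at hE'
    by_cases h0 : c = 0
    · simp [h0]
    · rw [cornerMatrix_injective (smul_right_injective _ h0 hE')]

/-- The three diagonal blocks of `J^1(α) ⊕ J^n(α-λ) ⊕ J^1(α-2λ)` have different eigenvalues, so a
matrix that commutes with it is block diagonal. -/
theorem threeBlocks_intertwine {n : ℕ} {α lam : F} (hlam : lam ≠ 0) (h2 : (2 : F) ≠ 0)
    {P : Matrix (Idx n) (Idx n) F}
    (h : P * threeBlocks n α lam = threeBlocks n α lam * P) :
    ∃ (P₁ : Matrix (Fin 1) (Fin 1) F) (P₂ : Matrix (Fin n) (Fin n) F)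
      (P₃ : Matrix (Fin 1) (Fin 1) F),
      P = fromBlocks P₁ 0 0 (fromBlocks P₂ 0 0 P₃) ∧
        upperJordan n (α - lam) * P₂ = P₂ * upperJordan n (α - lam) := by
  obtain ⟨P₁, Q, R, S, rfl⟩ : ∃ A B C D, P = fromBlocks A B C D :=
    ⟨_, _, _, _, (fromBlocks_toBlocks P).symm⟩
  obtain ⟨P₂, P₂₃, P₃₂, P₃, rfl⟩ : ∃ A B C D, S = fromBlocks A B C D :=
    ⟨_, _, _, _, (fromBlocks_toBlocks S).symm⟩
  obtain ⟨Q₁, Q₂, rfl⟩ : ∃ A B, Q = fromCols A B := ⟨_, _, (fromCols_toCols Q).symm⟩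
  obtain ⟨R₁, R₂, rfl⟩ : ∃ A B, R = fromRows A B := ⟨_, _, (fromRows_toRows R).symm⟩
  simp only [threeBlocks, fromBlocks_multiply, fromBlocks_inj, fromCols_mul_fromBlocks,
    fromBlocks_mul_fromRows, Matrix.mul_zero, Matrix.zero_mul, add_zero, zero_add,
    mul_fromCols, fromRows_mul, fromRows_inj.eq_iff] at h
  obtain ⟨h1, hq, hr, h22, h23, h32, h33⟩ := h
  have hq' := fromCols_inj hq
  have hr' := hr
  have e1 : Q₁ = 0 := eq_zero_of_upperJordan_intertwine
    (by intro h'; apply hlam; linear_combination h' : α ≠ α - lam) hq'.1.symm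
  have e2 : Q₂ = 0 := eq_zero_of_upperJordan_intertwine
    (by intro h'; apply mul_ne_zero h2 hlam; linear_combination h' : α ≠ α - 2 * lam) hq'.2.symm
  have e3 : R₁ = 0 := eq_zero_of_upperJordan_intertwine
    (by intro h'; apply hlam; linear_combination -h' : α - lam ≠ α) hr'.1.symm
  have e4 : R₂ = 0 := eq_zero_of_upperJordan_intertwine
    (by intro h'; apply mul_ne_zero h2 hlam; linear_combination -h' : α - 2 * lam ≠ α) hr'.2.symm
  have e5 : P₂₃ = 0 := eq_zero_of_upperJordan_intertwine
    (by intro h'; apply hlam; linear_combination h' : α - lam ≠ α - 2 * lam) h23.symm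
  have e6 : P₃₂ = 0 := eq_zero_of_upperJordan_intertwine
    (by intro h'; apply hlam; linear_combination -h' : α - 2 * lam ≠ α - lam) h32.symm
  exact ⟨P₁, P₂, P₃, by rw [e1, e2, e3, e4, e5, e6, fromCols_zero, fromRows_zero], h22.symm⟩

section Entries

variable {n : ℕ} (a : Fin n → F)

@[simp]
theorem rowColumn_inl_inl (i j : Fin 1) : rowColumn a (Sum.inl i) (Sum.inl j) = 0 := rfl

@[simp]
theorem rowColumn_row (i : Fin 1) (j : Fin n) :
    rowColumn a (Sum.inl i) (Sum.inr (Sum.inl j)) = a j := rfl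

@[simp]
theorem rowColumn_inl_inr_inr (i j : Fin 1) :
    rowColumn a (Sum.inl i) (Sum.inr (Sum.inr j)) = 0 := rfl

@[simp]
theorem rowColumn_inr_inl (i : Fin n ⊕ Fin 1) (j : Fin 1) :
    rowColumn a (Sum.inr i) (Sum.inl j) = 0 := rfl

@[simp]
theorem rowColumn_inr_inr_inl (i : Fin n ⊕ Fin 1) (j : Fin n) :
    rowColumn a (Sum.inr i) (Sum.inr (Sum.inl j)) = 0 := by
  rcases i with i | i <;> rfl

@[simp]
theorem rowColumn_col (i : Fin n) (j : Fin 1) :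
    rowColumn a (Sum.inr (Sum.inl i)) (Sum.inr (Sum.inr j)) =
      if (i : ℕ) + 1 = n then 1 else 0 := rfl

@[simp]
theorem rowColumn_inr_inr_inr (i j : Fin 1) :
    rowColumn a (Sum.inr (Sum.inr i)) (Sum.inr (Sum.inr j)) = 0 := rfl

end Entries

/-- The analogue of `corner_intertwiner_scalar` for the blocks `J^1(α)`, `J^n(α-λ)`,
`J^1(α-2λ)`. -/
theorem rowColumn_intertwiner_scalar {n : ℕ} {α lam : F} (hlam : lam ≠ 0) (h2 : (2 : F) ≠ 0)
    (hn : 1 ≤ n) {a b : Fin n → F} (ha : IsAdmissible a) (hb : IsAdmissible b)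
    {P : Matrix (Idx n) (Idx n) F}
    (h : P * threeBlocks n α lam = threeBlocks n α lam * P)
    (hE : P * rowColumn a = rowColumn b * P) :
    ∃ c : F, P = c • (1 : Matrix _ _ F) ∧ c • a = c • b := by
  obtain ⟨P₁, P₂, P₃, rfl, hP⟩ := threeBlocks_intertwine hlam h2 h
  set z : Fin n := ⟨0, hn⟩ with hz
  have hent := fun i j => congrFun (congrFun hE i) j
  -- the entries in the last column of `P E = E' P` give the last column of `P₂`
  have hcol : ∀ i : Fin n, P₂ i ⟨n - 1, by omega⟩ = if (i : ℕ) + 1 = n then P₃ 0 0 else 0 := by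
    intro i
    have := hent (Sum.inr (Sum.inl i)) (Sum.inr (Sum.inr 0))
    simp only [Matrix.mul_apply, Fintype.sum_sum_type, fromBlocks_apply₂₂,
      fromBlocks_apply₁₂, fromBlocks_apply₁₁, fromBlocks_apply₂₁, Finset.univ_unique,
      Finset.sum_singleton, Matrix.zero_apply, mul_zero, add_zero, zero_add,
      Finset.sum_const_zero, rowColumn_inl_inr_inr, rowColumn_inr_inl, rowColumn_inr_inr_inl,
      rowColumn_col, rowColumn_inr_inr_inr, Fin.default_eq_zero] at this
    rw [Finset.sum_eq_single ⟨n - 1, by omega⟩,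
      if_pos (show n - 1 + 1 = n from Nat.sub_add_cancel hn), mul_one] at this
    · rw [this]
      split_ifs <;> simp
    · intro b _ hb
      rw [if_neg, mul_zero]
      intro hh; exact hb (Fin.ext (by simp only; omega))
    · simp
  have hP2 : P₂ = P₃ 0 0 • (1 : Matrix _ _ F) := by
    refine eq_scalar_of_commute_of_last_col hP fun i j hj => ?_
    have hj' : j = ⟨n - 1, by omega⟩ := Fin.ext (by simp only; omega)
    rw [hj', hcol]
    simp only [Fin.ext_iff]
    congr 1
    apply propext; omega
  -- the entries in the first row relate `a` and `b`, whose first entries are both `1`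
  have hrow : ∀ j : Fin n, P₁ 0 0 * a j = P₃ 0 0 * b j := by
    intro j
    have := hent (Sum.inl 0) (Sum.inr (Sum.inl j))
    rw [hP2] at this
    simp only [Matrix.mul_apply, Fintype.sum_sum_type, fromBlocks_apply₂₂,
      fromBlocks_apply₁₂, fromBlocks_apply₁₁, fromBlocks_apply₂₁, Finset.univ_unique,
      Finset.sum_singleton, Matrix.zero_apply, mul_zero, add_zero, zero_add,
      Finset.sum_const_zero, rowColumn_inl_inl, rowColumn_row, rowColumn_inl_inr_inr,
      rowColumn_inr_inr_inl, Fin.default_eq_zero, Matrix.smul_apply, Matrix.one_apply,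
      smul_eq_mul, mul_ite, mul_one, Finset.sum_ite_eq', Finset.mem_univ, if_true] at this
    rw [this, mul_comm]
  have h13 : P₁ 0 0 = P₃ 0 0 := by
    have := hrow z
    rwa [ha.1 z (by simp [hz]), hb.1 z (by simp [hz]), mul_one, mul_one] at this
  refine ⟨P₃ 0 0, ?_, ?_⟩
  · have e1 : P₁ = P₃ 0 0 • (1 : Matrix _ _ F) := by
      ext i j; fin_cases i; fin_cases j; simpa using h13
    have e3 : P₃ = P₃ 0 0 • (1 : Matrix _ _ F) := by
      ext i j; fin_cases i; fin_cases j; simp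
    rw [hP2, e1, ← fromBlocks_one, fromBlocks_smul, ← fromBlocks_one, fromBlocks_smul, ← e3]
    simp
  · ext j
    have := hrow j
    rw [h13] at this
    simpa using this

end Intertwiners

/-! ### A criterion for uniseriality -/

section Uniserial

variable {ι : Type*} [Fintype ι] [DecidableEq ι]

open Matrix

/-- A subspace that contains a vector with leading index `a` contains all standard vectors of rank
at most that of `a`, provided that there are matrices which preserve the subspace and move leading
indices one step down. -/
theorem single_mem_of_leading (r : ι → ℕ) (hr : Function.Injective r)
    (P : Submodule F (ι → F))
    (H : ∀ a, r a ≠ 0 → ∃ (a' : ι) (M : Matrix ι ι F), r a' + 1 = r a ∧ (∀ u ∈ P, M.mulVec u ∈ P) ∧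
      (∀ c c', r a ≤ r c → r c' ≤ r a → M c c' = 0) ∧ (∀ c', r c' < r a → M a' c' = 0) ∧
      M a' a ≠ 0) :
    ∀ (s : ℕ) (a : ι), r a = s → ∀ u ∈ P, u a ≠ 0 → (∀ c, r a < r c → u c = 0) →
      ∀ c, r c ≤ r a → (Pi.single c 1 : ι → F) ∈ P := by
  have fin : ∀ (a : ι) (u : ι → F), u ∈ P → u a ≠ 0 → (∀ c, r a < r c → u c = 0) →
      (∀ c, r c < r a → (Pi.single c 1 : ι → F) ∈ P) →
      ∀ c, r c ≤ r a → (Pi.single c 1 : ι → F) ∈ P := by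
    intro a u hu ha hlead hlow c hc
    rcases hc.lt_or_eq with hc | hc
    · exact hlow c hc
    · have hca := hr hc
      subst hca
      have hsum : u = u c • (Pi.single c 1 : ι → F) +
          ∑ c' ∈ Finset.univ.erase c, u c' • (Pi.single c' 1 : ι → F) := by
        rw [Finset.add_sum_erase Finset.univ (fun c' => u c' • (Pi.single c' 1 : ι → F))
          (Finset.mem_univ c)]
        exact pi_eq_sum_univ' u
      have h1 : u c • (Pi.single c 1 : ι → F) ∈ P := by
        rw [eq_sub_of_add_eq hsum.symm]
        refine P.sub_mem hu (P.sum_mem fun c' hc' => ?_)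
        rcases lt_trichotomy (r c') (r c) with h | h | h
        · exact P.smul_mem _ (hlow c' h)
        · exact absurd (hr h) (Finset.ne_of_mem_erase hc')
        · rw [hlead c' h, zero_smul]; exact P.zero_mem
      exact (P.smul_mem_iff ha).mp h1
  intro s
  induction s with
  | zero =>
    intro a ha u hu hua hlead
    exact fin a u hu hua hlead fun c hc => absurd hc (by omega)
  | succ s ih =>
    intro a ha u hu hua hlead
    obtain ⟨a', M, haa', hM, hM1, hM2, hM3⟩ := H a (by omega)
    refine fin a u hu hua hlead fun c hc => ?_
    have hcoef : ∀ c, r a ≤ r c → M.mulVec u c = 0 := by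
      intro c hc
      refine Finset.sum_eq_zero fun c' _ => ?_
      change M c c' * u c' = 0
      rcases le_or_gt (r c') (r a) with h | h
      · rw [hM1 c c' hc h, zero_mul]
      · rw [hlead c' h, mul_zero]
    refine ih a' (by omega) (M.mulVec u) (hM u hu) ?_ (fun c hc => hcoef c (by omega)) c (by omega)
    have : M.mulVec u a' = M a' a * u a := by
      refine Finset.sum_eq_single a (fun c' _ hc' => ?_) (by simp)
      change M a' c' * u c' = 0
      rcases lt_trichotomy (r c') (r a) with h | h | h
      · rw [hM2 c' h, zero_mul]
      · exact absurd (hr h) hc'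
      · rw [hlead c' h, mul_zero]
    rw [this]
    exact mul_ne_zero hM3 hua

/-- A criterion for a family of subspaces to be a chain: leading indices can be moved down one
step at a time by matrices that preserve all the subspaces. -/
theorem chain_of_leading (r : ι → ℕ) (hr : Function.Injective r)
    (S : Submodule F (ι → F) → Prop)
    (H : ∀ a, r a ≠ 0 → ∃ (a' : ι) (M : Matrix ι ι F), r a' + 1 = r a ∧
      (∀ P, S P → ∀ u ∈ P, M.mulVec u ∈ P) ∧
      (∀ c c', r a ≤ r c → r c' ≤ r a → M c c' = 0) ∧ (∀ c', r c' < r a → M a' c' = 0) ∧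
      M a' a ≠ 0) (P Q : Submodule F (ι → F)) (hP : S P) (hQ : S Q) : P ≤ Q ∨ Q ≤ P := by
  classical
  have lead : ∀ u : ι → F, u ≠ 0 → ∃ a, u a ≠ 0 ∧ ∀ c, r a < r c → u c = 0 := by
    intro u hu
    obtain ⟨a, ha, hmax⟩ := Finset.exists_max_image (Finset.univ.filter fun a => u a ≠ 0) r (by
      obtain ⟨a, ha⟩ := Function.ne_iff.mp hu
      exact ⟨a, by simpa using ha⟩)
    refine ⟨a, by simpa using ha, fun c hc => ?_⟩
    by_contra h
    exact absurd (hmax c (by simpa using h)) (by omega)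
  have gen : ∀ P, S P → ∀ u ∈ P, ∀ a, u a ≠ 0 → (∀ c, r a < r c → u c = 0) →
      ∀ w : ι → F, (∀ c, r a < r c → w c = 0) → w ∈ P := by
    intro P hP u hu a ha hlead w hw
    have := single_mem_of_leading r hr P (fun a ha => by
      obtain ⟨a', M, h1, h2, h3⟩ := H a ha
      exact ⟨a', M, h1, h2 P hP, h3⟩) (r a) a rfl u hu ha hlead
    rw [pi_eq_sum_univ' w]
    refine P.sum_mem fun c _ => ?_
    rcases le_or_gt (r c) (r a) with h | h
    · exact P.smul_mem _ (this c h)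
    · rw [hw c h, zero_smul]; exact P.zero_mem
  by_contra hcon
  rw [not_or, SetLike.not_le_iff_exists, SetLike.not_le_iff_exists] at hcon
  obtain ⟨⟨p, hpP, hpQ⟩, q, hqQ, hqP⟩ := hcon
  obtain ⟨a, ha, ha'⟩ := lead p (by rintro rfl; exact hpQ Q.zero_mem)
  obtain ⟨b, hb, hb'⟩ := lead q (by rintro rfl; exact hqP P.zero_mem)
  rcases le_total (r a) (r b) with h | h
  · exact hpQ (gen Q hQ q hqQ b hb hb' p fun c hc => ha' c (by omega))
  · exact hqP (gen P hP p hpP a ha ha' q fun c hc => hb' c (by omega))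

theorem sub_smul_mulVec_mem {P : Submodule F (ι → F)} {A : Matrix ι ι F}
    (h : ∀ u ∈ P, A.mulVec u ∈ P) (c : F) : ∀ u ∈ P, (A - c • (1 : Matrix ι ι F)).mulVec u ∈ P := by
  intro u hu
  rw [Matrix.sub_mulVec, Matrix.smul_mulVec, Matrix.one_mulVec]
  exact P.sub_mem (h u hu) (P.smul_mem _ hu)

/-- The subspaces stable under `A` and `E_0` form a chain: `A - α 1` and `A - (α-λ) 1` lower the
leading index within the two blocks, and `E_0` lowers it from the second block to the first. -/
theorem twoBlocks_chain {n k : ℕ} {α lam : F} (hk : 1 ≤ k) (hkn : k ≤ n)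
    (X : Matrix (Fin (k - 1)) (Fin (n - k)) F)
    (P Q : Submodule F (Fin k ⊕ Fin (n + 1 - k) → F))
    (hP : (∀ u ∈ P, (twoBlocks k (n + 1 - k) α lam).mulVec u ∈ P) ∧
      ∀ u ∈ P, (cornerHat X).1.mulVec u ∈ P)
    (hQ : (∀ u ∈ Q, (twoBlocks k (n + 1 - k) α lam).mulVec u ∈ Q) ∧
      ∀ u ∈ Q, (cornerHat X).1.mulVec u ∈ Q) : P ≤ Q ∨ Q ≤ P := by
  refine chain_of_leading (ι := Fin k ⊕ Fin (n + 1 - k))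
    (Sum.elim (fun i => (i : ℕ)) fun j => k + (j : ℕ)) ?_
    (fun P => (∀ u ∈ P, (twoBlocks k (n + 1 - k) α lam).mulVec u ∈ P) ∧
      ∀ u ∈ P, (cornerHat X).1.mulVec u ∈ P) ?_ P Q hP hQ
  · rintro (i | i) (j | j) h <;> simp only [Sum.elim_inl, Sum.elim_inr] at h
    · rw [Fin.ext h]
    · omega
    · omega
    · rw [Fin.ext (by omega : (i : ℕ) = j)]
  · rintro (i | j) ha
    · simp only [Sum.elim_inl] at ha
      refine ⟨Sum.inl ⟨i - 1, by omega⟩, _, by simp only [Sum.elim_inl]; omega,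
        fun P hP => sub_smul_mulVec_mem hP.1 α, ?_, ?_, ?_⟩
      · rintro (c | c) (c' | c') h1 h2 <;> simp only [Sum.elim_inl, Sum.elim_inr] at h1 h2
        · simp only [twoBlocks, upperJordan, Matrix.sub_apply, Matrix.smul_apply, Matrix.one_apply,
            fromBlocks_apply₁₁, Sum.inl.injEq, smul_eq_mul]
          by_cases h : c = c'
          · simp [h]
          · simp [h]; omega
        · omega
        · simp [twoBlocks]
        · omega
      · rintro (c' | c') h2 <;> simp only [Sum.elim_inl, Sum.elim_inr] at h2
        · simp only [twoBlocks, upperJordan, Matrix.sub_apply, Matrix.smul_apply, Matrix.one_apply,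
            fromBlocks_apply₁₁, Sum.inl.injEq, smul_eq_mul]
          by_cases h : ⟨i - 1, by omega⟩ = c'
          · simp [h]
          · simp [h]; omega
        · omega
      · have : ¬ (⟨i - 1, by omega⟩ : Fin k) = i := by rw [Fin.ext_iff]; simp only; omega
        simp [twoBlocks, upperJordan, this]
        omega
    · by_cases hj : (j : ℕ) = 0
      · refine ⟨Sum.inl ⟨k - 1, by omega⟩, _, by simp only [Sum.elim_inl, Sum.elim_inr]; omega,
          fun P hP => hP.2, ?_, ?_, ?_⟩
        · rintro (c | c) (c' | c') h1 h2 <;> simp only [Sum.elim_inl, Sum.elim_inr] at h1 h2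
          · omega
          · omega
          · simp [cornerHat]
          · simp [cornerHat]
        · rintro (c' | c') h2 <;> simp only [Sum.elim_inl, Sum.elim_inr] at h2
          · simp [cornerHat]
          · omega
        · simp only [cornerHat, fromBlocks_apply₁₂]
          rw [cornerMatrix_last _ _ _ (by simp only; omega), if_pos hj]
          exact one_ne_zero
      · refine ⟨Sum.inr ⟨j - 1, by omega⟩, _, by simp only [Sum.elim_inr]; omega,
          fun P hP => sub_smul_mulVec_mem hP.1 (α - lam), ?_, ?_, ?_⟩
        · rintro (c | c) (c' | c') h1 h2 <;> simp only [Sum.elim_inl, Sum.elim_inr] at h1 h2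
          · omega
          · omega
          · simp [twoBlocks]
          · simp only [twoBlocks, upperJordan, Matrix.sub_apply, Matrix.smul_apply,
              Matrix.one_apply, fromBlocks_apply₂₂, Sum.inr.injEq, smul_eq_mul]
            by_cases h : c = c'
            · simp [h]
            · simp [h]; omega
        · rintro (c' | c') h2 <;> simp only [Sum.elim_inl, Sum.elim_inr] at h2
          · simp [twoBlocks]
          · simp only [twoBlocks, upperJordan, Matrix.sub_apply, Matrix.smul_apply,
              Matrix.one_apply, fromBlocks_apply₂₂, Sum.inr.injEq, smul_eq_mul]
            by_cases h : ⟨j - 1, by omega⟩ = c'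
            · simp [h]
            · simp [h]; omega
        · have : ¬ (⟨j - 1, by omega⟩ : Fin (n + 1 - k)) = j := by
            rw [Fin.ext_iff]; simp only; omega
          simp [twoBlocks, upperJordan, this]
          omega

/-- The analogue of `twoBlocks_chain` for three blocks, where the second matrix lowers the
leading index from each block to the preceding one. -/
theorem threeBlocks_chain {n : ℕ} {α lam : F} (hn : 1 ≤ n) {a : Fin n → F}
    (ha : IsAdmissible a) (P Q : Submodule F (Idx n → F))
    (hP : (∀ u ∈ P, (threeBlocks n α lam).mulVec u ∈ P) ∧
      ∀ u ∈ P, (rowColumn a).mulVec u ∈ P)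
    (hQ : (∀ u ∈ Q, (threeBlocks n α lam).mulVec u ∈ Q) ∧
      ∀ u ∈ Q, (rowColumn a).mulVec u ∈ Q) : P ≤ Q ∨ Q ≤ P := by
  refine chain_of_leading (ι := Idx n)
    (Sum.elim (fun _ => 0) (Sum.elim (fun j => 1 + (j : ℕ)) fun _ => n + 1)) ?_
    (fun P => (∀ u ∈ P, (threeBlocks n α lam).mulVec u ∈ P) ∧
      ∀ u ∈ P, (rowColumn a).mulVec u ∈ P) ?_ P Q hP hQ
  · rintro (i | i | i) (j | j | j) h <;> simp only [Sum.elim_inl, Sum.elim_inr] at h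
    · rw [Subsingleton.elim i j]
    · omega
    · omega
    · omega
    · rw [Fin.ext (by omega : (i : ℕ) = j)]
    · omega
    · omega
    · omega
    · rw [Subsingleton.elim i j]
  · rintro (i | j | i) hi
    · simp at hi
    · by_cases hj : (j : ℕ) = 0
      · refine ⟨Sum.inl 0, _, by simp only [Sum.elim_inl, Sum.elim_inr]; omega,
          fun P hP => hP.2, ?_, ?_, ?_⟩
        · rintro (c | c | c) (c' | c' | c') h1 h2 <;>
            simp only [Sum.elim_inl, Sum.elim_inr] at h1 h2 <;> first | omega | simp
        · rintro (c' | c' | c') h2 <;> simp only [Sum.elim_inl, Sum.elim_inr] at h2 <;>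
            first | omega | simp
        · simp [ha.1 j (by omega)]
      · refine ⟨Sum.inr (Sum.inl ⟨j - 1, by omega⟩), _,
          by simp only [Sum.elim_inl, Sum.elim_inr]; omega,
          fun P hP => sub_smul_mulVec_mem hP.1 (α - lam), ?_, ?_, ?_⟩
        · rintro (c | c | c) (c' | c' | c') h1 h2 <;>
            simp only [Sum.elim_inl, Sum.elim_inr] at h1 h2 <;>
            first | omega | (simp [threeBlocks]; done) | skip
          simp only [threeBlocks, upperJordan, Matrix.sub_apply, Matrix.smul_apply,
              Matrix.one_apply, fromBlocks_apply₂₂, fromBlocks_apply₁₁, Sum.inr.injEq,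
              Sum.inl.injEq, smul_eq_mul]
          by_cases h : c = c'
          · simp [h]
          · simp [h]; omega
        · rintro (c' | c' | c') h2 <;> simp only [Sum.elim_inl, Sum.elim_inr] at h2 <;>
            first | omega | (simp [threeBlocks]; done) | skip
          simp only [threeBlocks, upperJordan, Matrix.sub_apply, Matrix.smul_apply,
              Matrix.one_apply, fromBlocks_apply₂₂, fromBlocks_apply₁₁, Sum.inr.injEq,
              Sum.inl.injEq, smul_eq_mul]
          by_cases h : ⟨j - 1, by omega⟩ = c'
          · simp [h]
          · simp [h]; omega
        · have : ¬ (⟨j - 1, by omega⟩ : Fin n) = j := by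
            rw [Fin.ext_iff]; simp only; omega
          simp [threeBlocks, upperJordan, this]
          omega
    · refine ⟨Sum.inr (Sum.inl ⟨n - 1, by omega⟩), _,
        by simp only [Sum.elim_inl, Sum.elim_inr]; omega,
        fun P hP => hP.2, ?_, ?_, ?_⟩
      · rintro (c | c | c) (c' | c' | c') h1 h2 <;>
          simp only [Sum.elim_inl, Sum.elim_inr] at h1 h2 <;> first | omega | simp
      · rintro (c' | c' | c') h2 <;> simp only [Sum.elim_inl, Sum.elim_inr] at h2 <;>
          first | omega | simp
      · rw [rowColumn_col, if_pos (by simp only; omega)]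
        exact one_ne_zero

end Uniserial
end JordanMatrices
end UniserialSolvable

namespace UniserialSolvable

/-! ### Torsion modules over `F[t]` -/

section TorsionModules

open Polynomial

variable {F : Type*} [Field F] {M : Type*} [AddCommGroup M] [Module F M]

/-- The elements of `F[t]/(t^m)` that are killed by `t` are the multiples of `t^{m-1}`. -/
theorem quotient_X_smul_eq_zero {m : ℕ} (hm : 0 < m)
    {z : F[X] ⧸ Ideal.span {(X : F[X]) ^ m}} (hz : (X : F[X]) • z = 0) :
    ∃ c : F, z = c • Ideal.Quotient.mk (Ideal.span {(X : F[X]) ^ m}) (X ^ (m - 1)) := by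
  obtain ⟨p, rfl⟩ := Ideal.Quotient.mk_surjective z
  have h1 : Ideal.Quotient.mk (Ideal.span {(X : F[X]) ^ m}) (X * p) = 0 := hz
  rw [Ideal.Quotient.eq_zero_iff_dvd] at h1
  obtain ⟨m, rfl⟩ : ∃ k, m = k + 1 := ⟨m - 1, by omega⟩
  rw [pow_succ', mul_dvd_mul_iff_left X_ne_zero] at h1
  obtain ⟨r, rfl⟩ := h1
  refine ⟨r.coeff 0, ?_⟩
  rw [← sub_eq_zero]
  change Ideal.Quotient.mk (Ideal.span {(X : F[X]) ^ (m + 1)}) (X ^ m * r - r.coeff 0 • X ^ m) = 0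
  rw [Ideal.Quotient.eq_zero_iff_dvd, smul_eq_C_mul, mul_comm (C _), ← mul_sub, pow_succ]
  refine mul_dvd_mul_left _ ?_
  rw [X_dvd_iff]
  simp

theorem X_pow_smul_torsion {s : ℕ} (m : Fin s → ℕ) {j : ℕ} {i : Fin s} (h : m i ≤ j)
    (z : Torsion F m) : ((X : F[X]) ^ j • z) i = 0 := by
  obtain ⟨p, hp⟩ := Ideal.Quotient.mk_surjective (z i)
  rw [Pi.smul_apply, ← hp]
  change Ideal.Quotient.mk _ (X ^ j * p) = 0
  rw [Ideal.Quotient.eq_zero_iff_dvd]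
  exact Dvd.dvd.mul_right (pow_dvd_pow _ h) _

/-- The homomorphism `⊕ F[t]/(t^{m_i}) → M` that sends the `i`-th generator to `g_i`. -/
noncomputable def torsionMap (t : End F M) {s : ℕ} (m : Fin s → ℕ) (g : Fin s → M)
    (h : ∀ i, (t ^ m i) (g i) = 0) : Torsion F m →ₗ[F[X]] AEval' t :=
  ∑ i, (Submodule.liftQ (Ideal.span {(X : F[X]) ^ m i})
    (LinearMap.toSpanSingleton F[X] (AEval' t) (AEval'.of t (g i)))
    (by
      rw [Ideal.span, Submodule.span_singleton_le_iff_mem, LinearMap.mem_ker,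
        LinearMap.toSpanSingleton_apply, AEval'.X_pow_smul_of]
      simp [h i])) ∘ₗ LinearMap.proj i

theorem torsionMap_apply (t : End F M) {s : ℕ} (m : Fin s → ℕ) (g : Fin s → M)
    (h : ∀ i, (t ^ m i) (g i) = 0) (p : Fin s → F[X]) :
    torsionMap t m g h (fun i => Ideal.Quotient.mk _ (p i)) =
      ∑ i, p i • AEval'.of t (g i) := by
  rw [torsionMap, LinearMap.sum_apply]
  rfl

instance finiteDimensional_quotient (m : ℕ) :
    FiniteDimensional F (F[X] ⧸ Ideal.span {(X : F[X]) ^ m}) :=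
  (monic_X_pow m).finite_quotient

theorem finrank_torsion {s : ℕ} (m : Fin s → ℕ) : finrank F (Torsion F m) = ∑ i, m i := by
  rw [Module.finrank_pi_fintype]
  refine Finset.sum_congr rfl fun i _ => ?_
  rw [finrank_quotient_span_eq_natDegree, natDegree_X_pow]

/-- Since every nonzero submodule of `⊕ F[t]/(t^{m_i})` contains a nonzero element killed by `t`,
it is enough that the images `t^{m_i-1} g_i` of the generators of the socle are linearly
independent. -/
theorem torsionMap_injective (t : End F M) {s : ℕ} (m : Fin s → ℕ) (hm : ∀ i, 0 < m i)
    (g : Fin s → M) (h : ∀ i, (t ^ m i) (g i) = 0)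
    (hli : LinearIndependent F fun i => (t ^ (m i - 1)) (g i)) :
    Function.Injective (torsionMap t m g h) := by
  have socle : ∀ z : Torsion F m, (X : F[X]) • z = 0 → torsionMap t m g h z = 0 → z = 0 := by
    intro z hz hz'
    have hz1 : ∀ i, (X : F[X]) • z i = 0 := fun i => congrFun hz i
    choose c hc using fun i => quotient_X_smul_eq_zero (hm i) (hz1 i)
    have e : z = fun i => Ideal.Quotient.mk (Ideal.span {(X : F[X]) ^ m i})
        (C (c i) * X ^ (m i - 1)) := by
      ext i
      rw [hc i, ← smul_eq_C_mul]
      rfl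
    rw [e, torsionMap_apply] at hz'
    have : ∑ i, c i • (t ^ (m i - 1)) (g i) = 0 := by
      apply (AEval'.of t).injective
      rw [map_sum, map_zero, ← hz']
      refine Finset.sum_congr rfl fun i _ => ?_
      rw [mul_smul, AEval'.X_pow_smul_of, map_smul]
      exact (AEval.C_smul (R := F) (a := t) (c i) _).symm
    have hc0 := Fintype.linearIndependent_iff.mp hli c this
    rw [e]
    ext i
    simp [hc0 i]
  rw [injective_iff_map_eq_zero]
  intro z hz
  have nil : ∀ z : Torsion F m, ∃ j, (X : F[X]) ^ j • z = 0 := by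
    intro z
    refine ⟨∑ i, m i, ?_⟩
    ext i
    rw [X_pow_smul_torsion m (Finset.single_le_sum (fun _ _ => Nat.zero_le _)
      (Finset.mem_univ i)) z]
    rfl
  obtain ⟨j, hj⟩ := nil z
  induction j with
  | zero => simpa using hj
  | succ j ih =>
    refine ih (socle _ ?_ ?_)
    · rw [smul_smul, ← pow_succ']; exact hj
    · rw [map_smul, hz, smul_zero]

/-- Elements `g_i` that are killed by `t^{m_i}` and for which the elements `t^{m_i-1} g_i` are
linearly independent generate a direct sum of modules `F[t]/(t^{m_i})`. If the dimensions agree,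
this is the whole module. -/
theorem exists_torsion_equiv [FiniteDimensional F M] (t : End F M) {s : ℕ} (m : Fin s → ℕ)
    (hm : ∀ i, 0 < m i) (g : Fin s → M) (h : ∀ i, (t ^ m i) (g i) = 0)
    (hli : LinearIndependent F fun i => (t ^ (m i - 1)) (g i))
    (hdim : finrank F M = ∑ i, m i) :
    ∃ Q : AEval' t ≃ₗ[F[X]] Torsion F m, ∀ i : Fin s, (i : ℕ) = 0 →
      Q (AEval'.of t (g i)) = inFirst m 1 := by
  have hinj := torsionMap_injective t m hm g h hli
  have : FiniteDimensional F (AEval' t) := Module.Finite.equiv (AEval'.of t)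
  have hbij : Function.Bijective (torsionMap t m g h) := by
    refine ⟨hinj, ?_⟩
    have h1 : finrank F (Torsion F m) = finrank F (AEval' t) := by
      rw [finrank_torsion, ← hdim]
      exact (AEval'.of t).finrank_eq
    exact (LinearMap.injective_iff_surjective_of_finrank_eq_finrank
      (f := (torsionMap t m g h).restrictScalars F) h1).mp hinj
  refine ⟨(LinearEquiv.ofBijective _ hbij).symm, fun i hi => ?_⟩
  rw [LinearEquiv.symm_apply_eq, LinearEquiv.ofBijective_apply]
  have : inFirst m (1 : F[X]) = fun j => Ideal.Quotient.mk (Ideal.span {(X : F[X]) ^ m j})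
      (if j = i then 1 else 0) := by
    ext j
    have hij : j = i ↔ (j : ℕ) = 0 := by rw [Fin.ext_iff, hi]
    simp only [inFirst, hij]
    split_ifs <;> simp
  rw [this, torsionMap_apply]
  simp

theorem inFirst_eq_smul {s : ℕ} (m : Fin s → ℕ) (p : F[X]) : inFirst m p = p • inFirst m 1 := by
  ext i
  rw [Pi.smul_apply, inFirst, inFirst]
  split_ifs
  · rw [← Ideal.Quotient.mk_eq_mk, ← Ideal.Quotient.mk_eq_mk, ← Submodule.Quotient.mk_smul,
      smul_eq_mul, mul_one]
  · rw [smul_zero]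

/-- Linearly independent elements of `⊕ F[t]/(t^{m_i})`, with `m_i` decreasing, that are killed by
`t` and divisible by `t^j` are at most as many as the indices `i` with `m_i > j`. -/
theorem lt_of_linearIndependent_torsion {s : ℕ} (m : Fin s → ℕ) (hm : ∀ i, 0 < m i)
    (hanti : Antitone m) {l j : ℕ} (z : Fin (l + 1) → Torsion F m) (hz : LinearIndependent F z)
    (hX : ∀ a, (X : F[X]) • z a = 0) (hdiv : ∀ a, ∃ y, z a = (X : F[X]) ^ j • y) :
    ∃ h : l < s, j < m ⟨l, h⟩ := by
  classical
  by_contra hcon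
  push Not at hcon
  set T : Finset (Fin s) := Finset.univ.filter fun i => (i : ℕ) < l with hT
  set b : Fin s → Torsion F m := fun i =>
    Pi.single i (Ideal.Quotient.mk (Ideal.span {(X : F[X]) ^ m i}) (X ^ (m i - 1))) with hb
  have hspan : ∀ a, z a ∈ Submodule.span F ((T.image b : Finset (Torsion F m)) :
      Set (Torsion F m)) := by
    intro a
    have h1 : ∀ i, (X : F[X]) • z a i = 0 := fun i => congrFun (hX a) i
    choose c hc using fun i => quotient_X_smul_eq_zero (hm i) (h1 i)
    obtain ⟨y, hy⟩ := hdiv a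
    have : z a = ∑ i, c i • b i := by
      ext i
      rw [Finset.sum_apply, Finset.sum_eq_single i]
      · simp only [hb, Pi.smul_apply, Pi.single_eq_same]
        exact hc i
      · intro i' _ hi'
        simp only [hb, Pi.smul_apply, Pi.single_eq_of_ne' hi', smul_zero]
      · simp
    have h2 : ∀ i, i ∉ T → c i • b i = 0 := by
      intro i hi
      have hli : l ≤ (i : ℕ) := by simpa [hT] using hi
      have hmj : m i ≤ j :=
        (hanti (show (⟨l, by omega⟩ : Fin s) ≤ i from hli)).trans (hcon (by omega))
      have h3 : z a i = 0 := by rw [hy]; exact X_pow_smul_torsion m hmj y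
      have h4 : c i • b i = Pi.single i (z a i) := by
        rw [hc i]; exact (Pi.single_smul i (c i) _).symm
      rw [h4, h3, Pi.single_zero]
    rw [this]
    refine Submodule.sum_mem _ fun i _ => ?_
    by_cases hi : i ∈ T
    · exact Submodule.smul_mem _ _ (Submodule.subset_span (by
        simpa using ⟨i, hi, rfl⟩))
    · rw [h2 i hi]; exact Submodule.zero_mem _
  have hcard : (T.image b).card ≤ l := by
    refine Finset.card_image_le.trans ?_
    have : T.card ≤ (Finset.range l).card := by
      refine Finset.card_le_card_of_injOn (fun i => (i : ℕ)) ?_ ?_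
      · intro i hi
        simpa [hT] using hi
      · intro i _ i' _ hii
        exact Fin.ext hii
    simpa using this
  have h5 : Submodule.span F (Set.range z) ≤ Submodule.span F
      ((T.image b : Finset (Torsion F m)) : Set (Torsion F m)) := by
    rw [Submodule.span_le]
    rintro _ ⟨a, rfl⟩
    exact hspan a
  have h6 := Submodule.finrank_mono h5
  have h7 := finrank_span_eq_card hz
  have h8 := finrank_span_finset_le_card (R := F) (T.image b)
  rw [h7, Fintype.card_fin] at h6
  have := h6.trans h8
  omega

/-- Multiplication by `t^{b-a}`, as a map `F[t]/(t^a) → F[t]/(t^b)`. -/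
noncomputable def shiftMap (F : Type*) [Field F] (a b : ℕ) (h : a ≤ b) :
    (F[X] ⧸ Ideal.span {(X : F[X]) ^ a}) →ₗ[F[X]] (F[X] ⧸ Ideal.span {(X : F[X]) ^ b}) :=
  Submodule.liftQ (Ideal.span {(X : F[X]) ^ a})
    (LinearMap.toSpanSingleton F[X] _ (Ideal.Quotient.mk _ (X ^ (b - a))))
    (by
      rw [Ideal.span, Submodule.span_singleton_le_iff_mem, LinearMap.mem_ker,
        LinearMap.toSpanSingleton_apply]
      change Ideal.Quotient.mk (Ideal.span {(X : F[X]) ^ b}) (X ^ a * X ^ (b - a)) = 0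
      rw [Ideal.Quotient.eq_zero_iff_dvd, ← pow_add, Nat.add_sub_cancel' h])

theorem shiftMap_mk (a b : ℕ) (h : a ≤ b) (p : F[X]) :
    shiftMap F a b h (Ideal.Quotient.mk _ p) = Ideal.Quotient.mk _ (p * X ^ (b - a)) := rfl

theorem shiftMap_injective (a b : ℕ) (h : a ≤ b) : Function.Injective (shiftMap F a b h) := by
  rw [injective_iff_map_eq_zero]
  intro z hz
  obtain ⟨p, rfl⟩ := Ideal.Quotient.mk_surjective z
  rw [shiftMap_mk, Ideal.Quotient.eq_zero_iff_dvd] at hz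
  rw [Ideal.Quotient.eq_zero_iff_dvd]
  have e : (X : F[X]) ^ b = X ^ a * X ^ (b - a) := by rw [← pow_add, Nat.add_sub_cancel' h]
  rw [e] at hz
  exact (mul_dvd_mul_iff_right (pow_ne_zero _ X_ne_zero)).mp hz

/-- If `n_i ≤ m_i` for all `i` in the first index set, with equality for `i = 0`, there is a
monomorphism `⊕ F[t]/(t^{n_i}) → ⊕ F[t]/(t^{m_i})` that is the identity on the first summand. -/
theorem nonempty_abstractMono {r s : ℕ} (hr : 0 < r) (hrs : r ≤ s) (n : Fin r → ℕ)
    (m : Fin s → ℕ) (h0 : n ⟨0, hr⟩ = m ⟨0, hr.trans_le hrs⟩)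
    (hle : ∀ i : Fin r, n i ≤ m (Fin.castLE hrs i)) : Nonempty (AbstractMono F n m) := by
  classical
  set f : Torsion F n →ₗ[F[X]] Torsion F m := LinearMap.pi fun j =>
    if h : (j : ℕ) < r then (shiftMap F (n ⟨j, h⟩) (m j) (hle ⟨j, h⟩)) ∘ₗ
      LinearMap.proj (⟨j, h⟩ : Fin r) else 0 with hf
  have hfi : ∀ z (i : Fin r), f z (Fin.castLE hrs i) = shiftMap F _ _ (hle i) (z i) := by
    intro z i
    have hi : ((Fin.castLE hrs i : Fin s) : ℕ) < r := i.2
    rw [hf, LinearMap.pi_apply, dif_pos hi]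
    rfl
  have hfo : ∀ z (j : Fin s), ¬ (j : ℕ) < r → f z j = 0 := by
    intro z j hj
    rw [hf, LinearMap.pi_apply, dif_neg hj]
    rfl
  refine ⟨f, ?_, ?_⟩
  · rw [injective_iff_map_eq_zero]
    intro z hz
    ext i
    apply shiftMap_injective _ _ (hle i)
    rw [← hfi, hz, Pi.zero_apply, Pi.zero_apply, map_zero]
  · intro p
    ext j
    by_cases hj : (j : ℕ) < r
    · have := hfi (inFirst n p) ⟨j, hj⟩
      change f (inFirst n p) (Fin.castLE hrs ⟨j, hj⟩) = _
      rw [this]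
      by_cases h00 : (j : ℕ) = 0
      · have ej : j = ⟨0, hr.trans_le hrs⟩ := Fin.ext h00
        subst ej
        simp only [inFirst, if_true]
        rw [shiftMap_mk]
        change Ideal.Quotient.mk (Ideal.span {(X : F[X]) ^ m (Fin.castLE hrs ⟨0, hj⟩)}) _ =
          Ideal.Quotient.mk (Ideal.span {(X : F[X]) ^ m (Fin.castLE hrs ⟨0, hj⟩)}) _
        have e0 : m (Fin.castLE hrs ⟨0, hj⟩) - n ⟨0, hj⟩ = 0 := by
          have : m (Fin.castLE hrs ⟨0, hj⟩) = n ⟨0, hj⟩ := h0.symm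
          omega
        rw [e0, pow_zero, mul_one]
      · simp only [inFirst, h00, if_false, map_zero]
    · rw [hfo _ _ hj, inFirst, if_neg (by omega)]

end TorsionModules

/-! ### The Clebsch-Gordan decomposition of `M_{p,q}` -/

section ClebschGordan

variable {F : Type*} [Field F]

/-- The matrix block space `M_{p,q}` is identified with the space of `p × q` matrices. -/
def hatEquiv (F : Type*) [Field F] (p q : ℕ) :
    Matrix (Fin p) (Fin q) F ≃ₗ[F] hatMatrices F p q where
  toFun N := ⟨Matrix.fromBlocks 0 N 0 0, N, rfl⟩
  map_add' N N' := Subtype.ext (by simp [Matrix.fromBlocks_add])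
  map_smul' c N := Subtype.ext (by simp [Matrix.fromBlocks_smul])
  invFun B := B.1.toBlocks₁₂
  left_inv N := by simp
  right_inv := by
    rintro ⟨_, N, rfl⟩
    simp

theorem finrank_hatMatrices (p q : ℕ) : finrank F (hatMatrices F p q) = p * q := by
  rw [← (hatEquiv F p q).finrank_eq, Module.finrank_matrix]
  simp

instance finiteDimensional_hatMatrices (p q : ℕ) : FiniteDimensional F (hatMatrices F p q) :=
  Module.Finite.equiv (hatEquiv F p q)

/-- On entries, `theta` is the difference of a shift of rows and a shift of columns. -/
theorem theta_hatEquiv_apply (p q : ℕ) (α lam : F) (B : hatMatrices F p q) (i : Fin p)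
    (j : Fin q) :
    (hatEquiv F p q).symm (theta p q α lam B) i j =
      (if h : (i : ℕ) + 1 < p then (hatEquiv F p q).symm B ⟨i + 1, h⟩ j else 0) -
        if 0 < (j : ℕ) then (hatEquiv F p q).symm B i ⟨j - 1, by omega⟩ else 0 := by
  obtain ⟨_, N, rfl⟩ := B
  have h1 : theta p q α lam ⟨Matrix.fromBlocks 0 N 0 0, N, rfl⟩ =
      hatEquiv F p q (upperJordan p α * N - N * upperJordan q (α - lam) - lam • N) := by
    apply Subtype.ext
    change _ = Matrix.fromBlocks 0 (upperJordan p α * N - N * upperJordan q (α - lam) - lam • N) 0 0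
    simp [theta, adSub, twoBlocks, LieAlgebra.ad_apply, Ring.lie_def,
      Matrix.fromBlocks_multiply, Matrix.fromBlocks_smul, sub_eq_add_neg, Matrix.fromBlocks_neg,
      Matrix.fromBlocks_add]
  have h2 : (hatEquiv F p q).symm ⟨Matrix.fromBlocks 0 N 0 0, N, rfl⟩ = N :=
    (hatEquiv F p q).symm_apply_apply N
  rw [h1, h2, LinearEquiv.symm_apply_apply, Matrix.sub_apply, Matrix.sub_apply,
    upperJordan_mul_apply, mul_upperJordan_apply, Matrix.smul_apply, smul_eq_mul]
  ring

/-- `theta` raises the degree `(p - 1 - i) + j` of the matrix unit in position `(i, j)`. -/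
theorem theta_degree (p q : ℕ) (α lam : F) (B : hatMatrices F p q) (d : ℕ)
    (hB : ∀ (i : Fin p) (j : Fin q), p - 1 - (i : ℕ) + j < d → (hatEquiv F p q).symm B i j = 0)
    (r : ℕ) :
    ∀ (i : Fin p) (j : Fin q), p - 1 - (i : ℕ) + j < d + r →
      (hatEquiv F p q).symm ((theta p q α lam ^ r) B) i j = 0 := by
  induction r with
  | zero => simpa using hB
  | succ r ih =>
    intro i j hij
    rw [pow_succ', Module.End.mul_apply, theta_hatEquiv_apply]
    have e1 : (if h : (i : ℕ) + 1 < p then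
        (hatEquiv F p q).symm ((theta p q α lam ^ r) B) ⟨i + 1, h⟩ j else 0) = 0 := by
      split_ifs with h
      · exact ih _ _ (by simp only; omega)
      · rfl
    have e2 : (if 0 < (j : ℕ) then
        (hatEquiv F p q).symm ((theta p q α lam ^ r) B) i ⟨j - 1, by omega⟩ else 0) = 0 := by
      split_ifs with h
      · exact ih _ _ (by simp only; omega)
      · rfl
    rw [e1, e2, sub_zero]

/-- Matrices whose entries vanish in degrees below `d` are killed by `theta^r` once `d + r`
exceeds the largest degree `p + q - 2`. -/
theorem theta_pow_eq_zero (p q : ℕ) (α lam : F) (B : hatMatrices F p q) (d r : ℕ)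
    (hB : ∀ (i : Fin p) (j : Fin q), p - 1 - (i : ℕ) + j < d → (hatEquiv F p q).symm B i j = 0)
    (hr : p + q ≤ d + r + 1) : (theta p q α lam ^ r) B = 0 := by
  apply (hatEquiv F p q).symm.injective
  ext i j
  rw [theta_degree p q α lam B d hB r i j (by omega)]
  simp

section Leibniz

variable {R : Type*} [CommRing R] [Algebra F R] (δ : Derivation F R R)

/-- If `δ^a f = 0` and `δ^b g = 0`, then `δ^{a+b-1} (f g) = 0`. -/
theorem leibniz_pow_eq_zero : ∀ (s a b : ℕ) (f g : R), a + b ≤ s + 1 →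
    ((δ : R →ₗ[F] R) ^ a) f = 0 → ((δ : R →ₗ[F] R) ^ b) g = 0 →
    ((δ : R →ₗ[F] R) ^ s) (f * g) = 0 := by
  intro s
  induction s with
  | zero =>
    intro a b f g hab hf hg
    rcases Nat.eq_zero_or_pos a with rfl | ha
    · have : f = 0 := by simpa using hf
      simp [this]
    · have hb : b = 0 := by omega
      subst hb
      have : g = 0 := by simpa using hg
      simp [this]
  | succ s ih =>
    intro a b f g hab hf hg
    rcases Nat.eq_zero_or_pos a with rfl | ha
    · have : f = 0 := by simpa using hf
      simp [this]
    rcases Nat.eq_zero_or_pos b with rfl | hb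
    · have : g = 0 := by simpa using hg
      simp [this]
    rw [pow_succ, Module.End.mul_apply]
    have e : (δ : R →ₗ[F] R) (f * g) = f * δ g + δ f * g := by
      change δ (f * g) = _
      rw [δ.leibniz]; simp [mul_comm]
    rw [e, map_add]
    rw [ih a (b - 1) f (δ g) (by omega) hf ?_, ih (a - 1) b (δ f) g (by omega) ?_ hg, add_zero]
    · change ((δ : R →ₗ[F] R) ^ (a - 1)) ((δ : R →ₗ[F] R) f) = 0
      rw [← Module.End.mul_apply, ← pow_succ, Nat.sub_add_cancel ha]; exact hf
    · change ((δ : R →ₗ[F] R) ^ (b - 1)) ((δ : R →ₗ[F] R) g) = 0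
      rw [← Module.End.mul_apply, ← pow_succ, Nat.sub_add_cancel hb]; exact hg

theorem derivation_pow_pow_eq_zero (f : R) (hf : δ (δ f) = 0) (m : ℕ) :
    ((δ : R →ₗ[F] R) ^ (m + 1)) (f ^ m) = 0 := by
  induction m with
  | zero => simp
  | succ m ih =>
    rw [pow_succ f]
    refine leibniz_pow_eq_zero δ _ (m + 1) 2 _ _ (by omega) ih ?_
    rw [pow_two]
    exact hf

theorem derivation_pow_mul_of_eq_zero (f g : R) (hf : δ f = 0) (m : ℕ) :
    ((δ : R →ₗ[F] R) ^ m) (f * g) = f * ((δ : R →ₗ[F] R) ^ m) g := by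
  induction m with
  | zero => simp
  | succ m ih =>
    rw [pow_succ', Module.End.mul_apply, ih, Module.End.mul_apply]
    change δ (f * _) = f * δ _
    rw [δ.leibniz, hf]
    simp

end Leibniz

open MvPolynomial in
theorem pderiv_commute (f : MvPolynomial (Fin 2) F) :
    pderiv 0 (pderiv 1 f) = pderiv 1 (pderiv 0 f) := by
  have h : ⁅(pderiv 0 : Derivation F (MvPolynomial (Fin 2) F) (MvPolynomial (Fin 2) F)),
      (pderiv 1 : Derivation F (MvPolynomial (Fin 2) F) (MvPolynomial (Fin 2) F))⁆ = 0 := by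
    apply MvPolynomial.derivation_ext
    intro i
    rw [Derivation.commutator_apply]
    fin_cases i <;> simp [pderiv_X]
  have h' := DFunLike.congr_fun h f
  rw [Derivation.commutator_apply] at h'
  exact sub_eq_zero.mp h'

section Jets

open MvPolynomial

/-- The partial derivative `∂_x` on polynomials in two variables. -/
noncomputable def dx (F : Type*) [Field F] : End F (MvPolynomial (Fin 2) F) :=
  (pderiv 0).toLinearMap

/-- The partial derivative `∂_y` on polynomials in two variables. -/
noncomputable def dy (F : Type*) [Field F] : End F (MvPolynomial (Fin 2) F) :=
  (pderiv 1).toLinearMap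

theorem dx_commute_dy : Commute (dx F) (dy F) := LinearMap.ext fun f => pderiv_commute f

/-- The matrix of Taylor coefficients at the origin, `N_{i,j} = (∂_x^i ∂_y^{q-1-j} f)(0)`. On
polynomials of bidegree less than `(p, q)` it transports `∂_x - ∂_y` to `theta`. -/
noncomputable def jetMap (p q : ℕ) :
    MvPolynomial (Fin 2) F →ₗ[F] Matrix (Fin p) (Fin q) F where
  toFun f := Matrix.of fun i j => constantCoeff ((dx F ^ (i : ℕ) * dy F ^ (q - 1 - (j : ℕ))) f)
  map_add' f g := by ext; simp
  map_smul' c f := by ext; simp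

theorem jetMap_apply (p q : ℕ) (f : MvPolynomial (Fin 2) F) (i : Fin p) (j : Fin q) :
    jetMap p q f i j = constantCoeff ((dx F ^ (i : ℕ) * dy F ^ (q - 1 - (j : ℕ))) f) := rfl

theorem theta_jetMap {p q : ℕ} (α lam : F) (f : MvPolynomial (Fin 2) F)
    (hx : (dx F ^ p) f = 0) (hy : (dy F ^ q) f = 0) :
    theta p q α lam (hatEquiv F p q (jetMap p q f)) =
      hatEquiv F p q (jetMap p q ((dx F - dy F) f)) := by
  apply (hatEquiv F p q).symm.injective
  ext i j
  rw [theta_hatEquiv_apply, LinearEquiv.symm_apply_apply, LinearEquiv.symm_apply_apply,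
    jetMap_apply p q ((dx F - dy F) f), LinearMap.sub_apply, map_sub, map_sub,
    ← Module.End.mul_apply, ← Module.End.mul_apply]
  congr 1
  · have e : dx F ^ (i : ℕ) * dy F ^ (q - 1 - (j : ℕ)) * dx F =
        dx F ^ ((i : ℕ) + 1) * dy F ^ (q - 1 - (j : ℕ)) := by
      rw [mul_assoc, ← (dx_commute_dy.pow_right _).eq, ← mul_assoc, pow_succ]
    rw [e]
    split_ifs with h
    · rfl
    · have : (i : ℕ) + 1 = p := by omega
      rw [this, ((dx_commute_dy.pow_pow _ _)).eq, Module.End.mul_apply, hx, map_zero, map_zero]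
  · rw [mul_assoc, ← pow_succ]
    split_ifs with h
    · rw [jetMap_apply]
      have : q - 1 - (j : ℕ) + 1 = q - 1 - ((⟨(j : ℕ) - 1, by omega⟩ : Fin q) : ℕ) := by
        simp only; omega
      rw [this]
    · have : q - 1 - (j : ℕ) + 1 = q := by omega
      rw [this, Module.End.mul_apply, hy, map_zero, map_zero]

theorem theta_pow_jetMap {p q : ℕ} (α lam : F) (f : MvPolynomial (Fin 2) F)
    (hx : (dx F ^ p) f = 0) (hy : (dy F ^ q) f = 0) (r : ℕ) :
    (theta p q α lam ^ r) (hatEquiv F p q (jetMap p q f)) =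
      hatEquiv F p q (jetMap p q (((dx F - dy F) ^ r) f)) := by
  induction r with
  | zero => rfl
  | succ r ih =>
    have cx' : Commute (dx F ^ p) ((dx F - dy F) ^ r) := by
      have h : Commute (dx F) (dx F - dy F) := (Commute.refl (dx F)).sub_right dx_commute_dy
      exact h.pow_pow p r
    have cy' : Commute (dy F ^ q) ((dx F - dy F) ^ r) := by
      have h : Commute (dy F) (dx F - dy F) := dx_commute_dy.symm.sub_right (Commute.refl (dy F))
      exact h.pow_pow q r
    have hx' : (dx F ^ p) (((dx F - dy F) ^ r) f) = 0 := by
      have := LinearMap.congr_fun cx'.eq f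
      rw [Module.End.mul_apply, Module.End.mul_apply, hx, map_zero] at this
      exact this
    have hy' : (dy F ^ q) (((dx F - dy F) ^ r) f) = 0 := by
      have := LinearMap.congr_fun cy'.eq f
      rw [Module.End.mul_apply, Module.End.mul_apply, hy, map_zero] at this
      exact this
    have e := theta_jetMap α lam _ hx' hy'
    rw [pow_succ', Module.End.mul_apply, ih, e, pow_succ' (dx F - dy F),
      Module.End.mul_apply]

/-- The difference `∂_x - ∂_y`, as a derivation. -/
noncomputable def dxy (F : Type*) [Field F] :
    Derivation F (MvPolynomial (Fin 2) F) (MvPolynomial (Fin 2) F) :=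
  pderiv 0 - pderiv 1

theorem dxy_toLinearMap : (dxy F).toLinearMap = dx F - dy F := rfl

theorem dxy_pow_monomial (s : ℕ) : ∀ a b : ℕ, a + b = s →
    ((dx F - dy F) ^ s) ((X 0 : MvPolynomial (Fin 2) F) ^ a * X 1 ^ b) =
      C ((-1) ^ b * (s.factorial : F)) := by
  induction s with
  | zero =>
    intro a b h
    have ha : a = 0 := by omega
    have hb : b = 0 := by omega
    subst ha hb
    simp
  | succ s ih =>
    intro a b h
    have e : (dx F - dy F) ((X 0 : MvPolynomial (Fin 2) F) ^ a * X 1 ^ b) =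
        (a : F) • (X 0 ^ (a - 1) * X 1 ^ b) - (b : F) • (X 0 ^ a * X 1 ^ (b - 1)) := by
      change pderiv 0 ((X 0 : MvPolynomial (Fin 2) F) ^ a * X 1 ^ b) -
        pderiv 1 ((X 0 : MvPolynomial (Fin 2) F) ^ a * X 1 ^ b) = _
      simp only [pderiv_mul, pderiv_pow, pderiv_X_self,
        pderiv_X_of_ne (show (1 : Fin 2) ≠ 0 by decide),
        pderiv_X_of_ne (show (0 : Fin 2) ≠ 1 by decide), smul_eq_C_mul, map_natCast]
      ring
    rw [pow_succ, Module.End.mul_apply, e, map_sub, map_smul, map_smul]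
    have h1 : (a : F) • ((dx F - dy F) ^ s) ((X 0 : MvPolynomial (Fin 2) F) ^ (a - 1) * X 1 ^ b) =
        C ((a : F) * ((-1) ^ b * (s.factorial : F))) := by
      rcases Nat.eq_zero_or_pos a with rfl | ha
      · simp
      · rw [ih _ _ (by omega), smul_eq_C_mul, ← C_mul]
    have h2 : (b : F) • ((dx F - dy F) ^ s) ((X 0 : MvPolynomial (Fin 2) F) ^ a * X 1 ^ (b - 1)) =
        C (-(b : F) * ((-1) ^ b * (s.factorial : F))) := by
      rcases Nat.eq_zero_or_pos b with rfl | hb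
      · simp
      · rw [ih _ _ (by omega), smul_eq_C_mul, ← C_mul]
        obtain ⟨b, rfl⟩ : ∃ b', b = b' + 1 := ⟨b - 1, by omega⟩
        rw [Nat.add_sub_cancel, pow_succ]
        congr 1; ring
    rw [h1, h2, ← C_sub, Nat.factorial_succ]
    congr 1
    have : ((s : F) + 1) = (a : F) + b := by
      rw [← Nat.cast_add, h]; push_cast; ring
    push_cast
    rw [this]; ring

theorem dx_pow_sum_pow (r i : ℕ) :
    (dx F ^ r) ((X 0 + X 1 : MvPolynomial (Fin 2) F) ^ i) =
      (i.descFactorial r : F) • (X 0 + X 1) ^ (i - r) := by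
  induction r with
  | zero => simp
  | succ r ih =>
    rw [pow_succ', Module.End.mul_apply, ih, map_smul]
    have e : dx F ((X 0 + X 1 : MvPolynomial (Fin 2) F) ^ (i - r)) =
        ((i - r : ℕ) : F) • (X 0 + X 1) ^ (i - (r + 1)) := by
      change pderiv 0 ((X 0 + X 1 : MvPolynomial (Fin 2) F) ^ (i - r)) = _
      rw [pderiv_pow, map_add, pderiv_X_self, pderiv_X_of_ne (show (1 : Fin 2) ≠ 0 by decide),
        smul_eq_C_mul, map_natCast, Nat.sub_sub]
      ring
    rw [e, smul_smul, Nat.descFactorial_succ]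
    push_cast
    rw [mul_comm]

/-- The last column of the matrix of `(x + y)^i` is a multiple of the `i`-th standard vector. -/
theorem jetMap_sum_pow {p q : ℕ} (i : ℕ) (r : Fin p) (j : Fin q) (hj : (j : ℕ) + 1 = q) :
    jetMap p q ((X 0 + X 1 : MvPolynomial (Fin 2) F) ^ i) r j =
      if (r : ℕ) = i then (i.factorial : F) else 0 := by
  rw [jetMap_apply, show q - 1 - (j : ℕ) = 0 by omega, pow_zero, mul_one, dx_pow_sum_pow]
  rw [smul_eq_C_mul, map_mul, constantCoeff_C, map_pow, map_add, constantCoeff_X, constantCoeff_X]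
  split_ifs with h
  · rw [h, Nat.descFactorial_self, Nat.sub_self, pow_zero, mul_one]
  · rcases lt_or_gt_of_ne h with h | h
    · rw [add_zero, zero_pow (by omega), mul_zero]
    · rw [Nat.descFactorial_eq_zero_iff_lt.mpr h, Nat.cast_zero, zero_mul]

/-- The generator `(x + y)^i x^{p-1-i} y^{q-1-i}` of the `i`-th summand of `M_{p,q}`. -/
noncomputable def stringGen (F : Type*) [Field F] (p q i : ℕ) : MvPolynomial (Fin 2) F :=
  (X 0 + X 1) ^ i * (X 0 ^ (p - 1 - i) * X 1 ^ (q - 1 - i))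

theorem dx_pow_stringGen {p q i : ℕ} (hi : i < min p q) :
    (dx F ^ p) (stringGen F p q i) = 0 := by
  have h1 := derivation_pow_pow_eq_zero (F := F) (pderiv 0)
    (X 0 + X 1 : MvPolynomial (Fin 2) F) (by simp [pderiv_X]) i
  have h2 := derivation_pow_pow_eq_zero (F := F) (pderiv 0)
    (X 0 : MvPolynomial (Fin 2) F) (by simp [pderiv_X]) (p - 1 - i)
  have h3 : ((pderiv 0 : Derivation F (MvPolynomial (Fin 2) F) _).toLinearMap ^ 1)
      ((X 1 : MvPolynomial (Fin 2) F) ^ (q - 1 - i)) = 0 := by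
    rw [pow_one]
    change pderiv 0 ((X 1 : MvPolynomial (Fin 2) F) ^ (q - 1 - i)) = 0
    rw [pderiv_pow, pderiv_X_of_ne (show (1 : Fin 2) ≠ 0 by decide), mul_zero]
  have hi' := lt_min_iff.mp hi
  exact leibniz_pow_eq_zero _ _ (i + 1) (p - i) _ _ (by omega) h1
    (leibniz_pow_eq_zero _ _ (p - 1 - i + 1) 1 _ _ (by omega) h2 h3)

theorem dy_pow_stringGen {p q i : ℕ} (hi : i < min p q) :
    (dy F ^ q) (stringGen F p q i) = 0 := by
  have h1 := derivation_pow_pow_eq_zero (F := F) (pderiv 1)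
    (X 0 + X 1 : MvPolynomial (Fin 2) F) (by simp [pderiv_X]) i
  have h2 := derivation_pow_pow_eq_zero (F := F) (pderiv 1)
    (X 1 : MvPolynomial (Fin 2) F) (by simp [pderiv_X]) (q - 1 - i)
  have h3 : ((pderiv 1 : Derivation F (MvPolynomial (Fin 2) F) _).toLinearMap ^ 1)
      ((X 0 : MvPolynomial (Fin 2) F) ^ (p - 1 - i)) = 0 := by
    rw [pow_one]
    change pderiv 1 ((X 0 : MvPolynomial (Fin 2) F) ^ (p - 1 - i)) = 0
    rw [pderiv_pow, pderiv_X_of_ne (show (0 : Fin 2) ≠ 1 by decide), mul_zero]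
  have hi' := lt_min_iff.mp hi
  exact leibniz_pow_eq_zero _ _ (i + 1) (q - i) _ _ (by omega) h1
    (leibniz_pow_eq_zero _ _ 1 (q - 1 - i + 1) _ _ (by omega) h3 h2)

/-- The operator `∂_x - ∂_y` annihilates `x + y`, so its powers only see the other factor. -/
theorem dxy_pow_stringGen {p q i : ℕ} (r : ℕ) (hr : (p - 1 - i) + (q - 1 - i) = r) :
    ((dx F - dy F) ^ r) (stringGen F p q i) =
      ((-1) ^ (q - 1 - i) * (r.factorial : F)) • (X 0 + X 1) ^ i := by
  have h0 : (dxy F) ((X 0 + X 1 : MvPolynomial (Fin 2) F) ^ i) = 0 := by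
    rw [(dxy F).leibniz_pow]
    have : (dxy F) (X 0 + X 1) = 0 := by
      simp [dxy, pderiv_X]
    rw [this]; simp
  rw [stringGen, ← dxy_toLinearMap, derivation_pow_mul_of_eq_zero _ _ _ h0, dxy_toLinearMap,
    dxy_pow_monomial r _ _ hr, mul_comm, smul_eq_C_mul]

end Jets

/-- The dimensions add up: `pq = ∑ (p + q - 1 - 2i)`, by removing a row and a column. -/
theorem sum_string_lengths (N : ℕ) : ∀ p q : ℕ, N + 1 = p + q →
    p * q = ∑ i : Fin (min p q), (N - 2 * (i : ℕ)) := by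
  induction N using Nat.strong_induction_on with
  | _ N ih =>
    intro p q h
    rcases Nat.eq_zero_or_pos p with rfl | hp
    · rw [Nat.zero_mul, Fin.sum_univ_eq_sum_range (fun i => N - 2 * i)]; simp
    rcases Nat.eq_zero_or_pos q with rfl | hq
    · rw [Nat.mul_zero, Fin.sum_univ_eq_sum_range (fun i => N - 2 * i)]; simp
    obtain ⟨p, rfl⟩ : ∃ p', p = p' + 1 := ⟨p - 1, by omega⟩
    obtain ⟨q, rfl⟩ : ∃ q', q = q' + 1 := ⟨q - 1, by omega⟩
    rw [Fin.sum_univ_eq_sum_range (fun i => N - 2 * i), Nat.add_min_add_right,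
      Finset.sum_range_succ']
    rcases lt_or_ge (p + q) 1 with h1 | h1
    · have : p = 0 := by omega
      have : q = 0 := by omega
      subst p q
      simp; omega
    · have := ih (p + q - 1) (by omega) p q (by omega)
      rw [Fin.sum_univ_eq_sum_range (fun i => p + q - 1 - 2 * i)] at this
      have e : ∀ i, N - 2 * (i + 1) = p + q - 1 - 2 * i := by intro i; omega
      simp only [e]
      rw [← this]
      have : N = p + q + 1 := by omega
      subst this
      simp only [Nat.mul_zero, Nat.sub_zero]
      ring

/-- The Clebsch-Gordan decomposition of `M_{p,q}` in characteristic `0`, where any matrix with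
nonzero lower left entry may serve as the generator of the largest summand. -/
theorem exists_hatMatrices_equiv [CharZero F] {N p q : ℕ} (hp : 0 < p) (hq : 0 < q)
    (hN : N + 1 = p + q) (α lam : F) (B : hatMatrices F p q)
    (hB : (hatEquiv F p q).symm B ⟨p - 1, by omega⟩ ⟨0, hq⟩ ≠ 0) :
    ∃ Q : AEval' (theta p q α lam) ≃ₗ[Polynomial F]
        Torsion F (fun i : Fin (min p q) => N - 2 * (i : ℕ)),
      Q (AEval'.of _ B) = inFirst _ 1 := by
  have hmin : 0 < min p q := lt_min hp hq
  set z : Fin q := ⟨q - 1, by omega⟩ with hz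
  set G : ℕ → hatMatrices F p q := fun i => hatEquiv F p q (jetMap p q (stringGen F p q i)) with hG
  set m : Fin (min p q) → ℕ := fun i => N - 2 * (i : ℕ) with hm
  have hmi : ∀ i : Fin (min p q), m i - 1 = (p - 1 - i) + (q - 1 - i) ∧ 0 < m i := by
    intro i
    have := lt_min_iff.mp i.2
    simp only [hm]; omega
  -- the `i`-th generator is taken by the highest power of `theta` to a multiple of `(x + y)^i`
  have hsoc : ∀ i : Fin (min p q), ∃ c : F, c ≠ 0 ∧ (theta p q α lam ^ (m i - 1)) (G i) =
      c • hatEquiv F p q (jetMap p q ((MvPolynomial.X 0 + MvPolynomial.X 1) ^ (i : ℕ))) := by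
    intro i
    refine ⟨(-1) ^ (q - 1 - (i : ℕ)) * ((m i - 1).factorial : F), ?_, ?_⟩
    · exact mul_ne_zero (pow_ne_zero _ (by simp)) (Nat.cast_ne_zero.mpr (Nat.factorial_ne_zero _))
    · rw [hG, theta_pow_jetMap α lam _ (dx_pow_stringGen i.2) (dy_pow_stringGen i.2),
        dxy_pow_stringGen (m i - 1) (hmi i).1.symm, map_smul, map_smul]
  have hkill : ∀ i : Fin (min p q), (theta p q α lam ^ (m i)) (G i) = 0 := by
    intro i
    have h1 := (hmi i).2
    have e : m i = 1 + (m i - 1) := by omega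
    have h0 : (dx F - dy F) ((MvPolynomial.X 0 + MvPolynomial.X 1) ^ (i : ℕ)) = 0 := by
      have h0 : (dxy F) ((MvPolynomial.X 0 + MvPolynomial.X 1) ^ (i : ℕ)) = 0 := by
        rw [(dxy F).leibniz_pow]
        have : (dxy F) (MvPolynomial.X 0 + MvPolynomial.X 1) = 0 := by
          simp [dxy, MvPolynomial.pderiv_X]
        rw [this]; simp
      exact h0
    rw [hG, theta_pow_jetMap α lam _ (dx_pow_stringGen i.2) (dy_pow_stringGen i.2), e, pow_add,
      pow_one, Module.End.mul_apply, dxy_pow_stringGen (m i - 1) (hmi i).1.symm, map_smul, h0,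
      smul_zero, map_zero, map_zero]
  -- the entries in the last column distinguish the generators of the socle
  have hent : ∀ (i : ℕ) (r : Fin (min p q)),
      (hatEquiv F p q).symm (hatEquiv F p q (jetMap p q
        ((MvPolynomial.X 0 + MvPolynomial.X 1) ^ i))) ⟨r, (lt_min_iff.mp r.2).1⟩ z =
        if (r : ℕ) = i then (i.factorial : F) else 0 := by
    intro i r
    rw [LinearEquiv.symm_apply_apply, jetMap_sum_pow _ _ _ (by simp only [hz]; omega)]
  -- only the lower left entry of a matrix matters for its image under `theta^{N-1}`, so that any
  -- `B` for which this entry is nonzero may serve as the first generator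
  set z₀ : Fin (min p q) := ⟨0, hmin⟩ with hz₀
  have hm0 : m z₀ = N := by simp [hm, hz₀]
  have hcorner : ∀ B' : hatMatrices F p q,
      (hatEquiv F p q).symm B' ⟨p - 1, by omega⟩ ⟨0, hq⟩ = 0 →
      (theta p q α lam ^ (N - 1)) B' = 0 := by
    intro B' hB'
    refine theta_pow_eq_zero p q α lam B' 1 (N - 1) (fun i j hij => ?_) (by omega)
    have hi : i = ⟨p - 1, by omega⟩ := Fin.ext (by simp only; omega)
    have hj : j = ⟨0, hq⟩ := Fin.ext (by simp only; omega)
    rw [hi, hj, hB']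
  obtain ⟨c₀, hc₀, hs₀⟩ := hsoc z₀
  have hG0 : (hatEquiv F p q).symm (G 0) ⟨p - 1, by omega⟩ ⟨0, hq⟩ ≠ 0 := by
    intro h
    have h1 := hcorner _ h
    rw [hm0] at hs₀
    have h2 : c₀ • hatEquiv F p q (jetMap p q
        ((MvPolynomial.X 0 + MvPolynomial.X 1) ^ (0 : ℕ))) = 0 := hs₀.symm.trans h1
    have h3 := (smul_eq_zero.mp h2).resolve_left hc₀
    have h4 := hent 0 z₀
    rw [h3] at h4
    simp [hz₀] at h4
  set c := (hatEquiv F p q).symm B ⟨p - 1, by omega⟩ ⟨0, hq⟩ /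
    (hatEquiv F p q).symm (G 0) ⟨p - 1, by omega⟩ ⟨0, hq⟩ with hc
  have hc0 : c ≠ 0 := div_ne_zero hB hG0
  have hBG : (theta p q α lam ^ (N - 1)) B = c • (theta p q α lam ^ (N - 1)) (G 0) := by
    rw [← sub_eq_zero, ← map_smul, ← map_sub]
    apply hcorner
    rw [map_sub, map_smul, Matrix.sub_apply, Matrix.smul_apply, smul_eq_mul, hc,
      div_mul_cancel₀ _ hG0, sub_self]
  set g : Fin (min p q) → hatMatrices F p q := fun i => if (i : ℕ) = 0 then B else G i with hg
  have hsoc' : ∀ i : Fin (min p q), ∃ c : F, c ≠ 0 ∧ (theta p q α lam ^ (m i - 1)) (g i) =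
      c • hatEquiv F p q (jetMap p q ((MvPolynomial.X 0 + MvPolynomial.X 1) ^ (i : ℕ))) := by
    intro i
    by_cases hi : (i : ℕ) = 0
    · have : i = z₀ := Fin.ext hi
      subst this
      refine ⟨c * c₀, mul_ne_zero hc0 hc₀, ?_⟩
      rw [mul_smul, ← hs₀, hg]
      simp only [hi, if_true]
      rw [hm0, hBG]
    · obtain ⟨c', h1, h2⟩ := hsoc i
      exact ⟨c', h1, by rw [hg]; simp only [hi, if_false]; exact h2⟩
  have hkill' : ∀ i, (theta p q α lam ^ (m i)) (g i) = 0 := by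
    intro i
    by_cases hi : (i : ℕ) = 0
    · refine theta_pow_eq_zero p q α lam _ 0 _ (fun _ _ h => absurd h (by omega)) ?_
      have : i = z₀ := Fin.ext hi
      rw [this, hm0]; omega
    · rw [hg]; simp only [hi, if_false]; exact hkill i
  have hli : LinearIndependent F fun i => (theta p q α lam ^ (m i - 1)) (g i) := by
    choose d hd hd' using hsoc'
    rw [Fintype.linearIndependent_iff]
    intro a ha r
    have h1 := congrArg (fun B => (hatEquiv F p q).symm B ⟨r, (lt_min_iff.mp r.2).1⟩ z) ha
    simp only [hd', map_sum, map_smul, map_zero, Matrix.sum_apply, Matrix.smul_apply,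
      Matrix.zero_apply, hent, smul_eq_mul] at h1
    rw [Finset.sum_eq_single r] at h1
    · rw [if_pos rfl] at h1
      have h2 : (((r : ℕ).factorial : ℕ) : F) ≠ 0 := Nat.cast_ne_zero.mpr (Nat.factorial_ne_zero _)
      exact (mul_eq_zero.mp h1).resolve_right (mul_ne_zero (hd r) h2)
    · intro i _ hir
      rw [if_neg, mul_zero, mul_zero]
      intro h; exact hir (Fin.ext h.symm)
    · simp
  obtain ⟨Q, hQ⟩ := exists_torsion_equiv (theta p q α lam) m (fun i => (hmi i).2) g hkill' hli
    (by rw [finrank_hatMatrices, sum_string_lengths N p q hN])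
  refine ⟨Q, ?_⟩
  rw [← hQ z₀ rfl, hg]
  simp [hz₀]

end ClebschGordan
end UniserialSolvable

namespace UniserialSolvable

variable {F : Type*} [Field F]

/-! ### Representations of `⟨x⟩ ⋉ V` -/

section Build

variable {V : Type*} [LieRing V] [LieAlgebra F V] [IsLieAbelian V] {x : End F V}
variable {ι : Type*} [Fintype ι] [DecidableEq ι]

theorem alg_eq (y : Alg x) : y = y.right • gen x + ofV x y.left := by
  ext <;> simp

theorem rep_eq (R : Alg x →ₗ[F] Matrix ι ι F) (y : Alg x) :
    R y = y.right • R (gen x) + R (ofV x y.left) := by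
  conv_lhs => rw [alg_eq y]
  rw [map_add, map_smul]

/-- The restriction of a linear map on `⟨x⟩ ⋉ V` to `V`. -/
def repV (R : Alg x →ₗ[F] Matrix ι ι F) : V →ₗ[F] Matrix ι ι F where
  toFun v := R (ofV x v)
  map_add' v w := by rw [← map_add]; congr 1; ext <;> simp
  map_smul' c v := by rw [RingHom.id_apply, ← map_smul]; congr 1; ext <;> simp

theorem rep_lie_gen (R : Alg x →ₗ⁅F⁆ Matrix ι ι F) (v : V) :
    R (gen x) * R (ofV x v) - R (ofV x v) * R (gen x) = R (ofV x (x v)) := by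
  rw [← Ring.lie_def, ← LieHom.map_lie, lie_gen_ofV]

theorem rep_comm (R : Alg x →ₗ⁅F⁆ Matrix ι ι F) (v w : V) :
    R (ofV x v) * R (ofV x w) = R (ofV x w) * R (ofV x v) := by
  rw [← sub_eq_zero, ← Ring.lie_def, ← LieHom.map_lie, lie_ofV_ofV, map_zero]

/-- A representation is determined by its values on `x` and on `V`. -/
theorem rep_ext {R S : Alg x →ₗ⁅F⁆ Matrix ι ι F} (h : R (gen x) = S (gen x))
    (h' : ∀ v, R (ofV x v) = S (ofV x v)) : R = S := by
  ext1 y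
  have h1 := rep_eq (R : Alg x →ₗ[F] Matrix ι ι F) y
  have h2 := rep_eq (S : Alg x →ₗ[F] Matrix ι ι F) y
  simp only [LieHom.coe_toLinearMap] at h1 h2
  rw [h1, h2, h, h']

/-- A representation of `⟨x⟩ ⋉ V` is given by a matrix `A` and commuting matrices `φ v` such that
`[A, φ v] = φ (x v)`. -/
def buildRep (x : End F V) (A : Matrix ι ι F) (φ : V →ₗ[F] Matrix ι ι F)
    (h1 : ∀ v, A * φ v - φ v * A = φ (x v)) (h2 : ∀ v w, φ v * φ w = φ w * φ v) :
    Alg x →ₗ⁅F⁆ Matrix ι ι F where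
  toFun y := y.right • A + φ y.left
  map_add' y z := by
    have e1 : (y + z).left = y.left + z.left := rfl
    have e2 : (y + z).right = y.right + z.right := rfl
    rw [e1, e2, map_add, add_smul]; abel
  map_smul' c y := by
    have e1 : (c • y).left = c • y.left := rfl
    have e2 : (c • y).right = c • y.right := rfl
    rw [e1, e2, map_smul, smul_assoc, smul_add, RingHom.id_apply]
  map_lie' := by
    intro y z
    have e1 : ⁅y, z⁆.left = ⁅y.left, z.left⁆ + y.right • x z.left - z.right • x y.left := rfl
    have e2 : ⁅y, z⁆.right = ⁅y.right, z.right⁆ := rfl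
    rw [e1, e2, trivial_lie_zero V V y.left z.left, zero_add, Ring.lie_def y.right,
      mul_comm y.right, sub_self, zero_smul, zero_add, map_sub, map_smul, map_smul, ← h1, ← h1,
      Ring.lie_def]
    simp only [add_mul, mul_add, smul_mul_assoc, mul_smul_comm, smul_sub, smul_add,
      h2 z.left y.left]
    rw [smul_comm y.right z.right (A * A)]
    abel

theorem buildRep_gen (x : End F V) (A : Matrix ι ι F) (φ : V →ₗ[F] Matrix ι ι F)
    (h1 : ∀ v, A * φ v - φ v * A = φ (x v)) (h2 : ∀ v w, φ v * φ w = φ w * φ v) :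
    buildRep x A φ h1 h2 (gen x) = A := by
  change (1 : F) • A + φ 0 = A
  simp

theorem buildRep_ofV (x : End F V) (A : Matrix ι ι F) (φ : V →ₗ[F] Matrix ι ι F)
    (h1 : ∀ v, A * φ v - φ v * A = φ (x v)) (h2 : ∀ v w, φ v * φ w = φ w * φ v) (v : V) :
    buildRep x A φ h1 h2 (ofV x v) = φ v := by
  change (0 : F) • A + φ v = φ v
  simp

theorem adSub_apply (A B : Matrix ι ι F) (c : F) : adSub A c B = A * B - B * A - c • B := by
  simp [adSub, LieAlgebra.ad_apply, Ring.lie_def]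

/-- A representation intertwines `x - c 1` on `V` with `ad R(x) - c 1`. -/
theorem adSub_pow_rep (R : Alg x →ₗ⁅F⁆ Matrix ι ι F) (c : F) (v : V) (r : ℕ) :
    (adSub (R (gen x)) c ^ r) (R (ofV x v)) =
      R (ofV x (((x - c • (1 : End F V)) ^ r) v)) := by
  induction r with
  | zero => simp
  | succ r ih =>
    rw [pow_succ', Module.End.mul_apply, ih, adSub_apply, rep_lie_gen, pow_succ',
      Module.End.mul_apply]
    have : R (ofV x ((x - c • (1 : End F V)) (((x - c • (1 : End F V)) ^ r) v))) =
        repV (R : Alg x →ₗ[F] Matrix ι ι F)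
          ((x - c • (1 : End F V)) (((x - c • (1 : End F V)) ^ r) v)) := rfl
    rw [this, LinearMap.sub_apply, map_sub, LinearMap.smul_apply, map_smul]
    rfl

end Build

/-! ### Isomorphic representations -/

section Isomorphisms

variable {L : Type*} [LieRing L] [LieAlgebra F L]
variable {ι κ : Type*} [Fintype ι] [DecidableEq ι] [Fintype κ] [DecidableEq κ]

theorem IsIsomorphic.symm' {R : L →ₗ[F] Matrix ι ι F} {S : L →ₗ[F] Matrix κ κ F}
    (h : IsIsomorphic R S) : IsIsomorphic S R := by
  obtain ⟨T, hT⟩ := h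
  refine ⟨T.symm, fun y v => ?_⟩
  rw [LinearEquiv.symm_apply_eq, hT, LinearEquiv.apply_symm_apply]

theorem IsIsomorphic.trans' {μ : Type*} [Fintype μ] [DecidableEq μ] {R : L →ₗ[F] Matrix ι ι F}
    {S : L →ₗ[F] Matrix κ κ F} {U : L →ₗ[F] Matrix μ μ F}
    (h : IsIsomorphic R S) (h' : IsIsomorphic S U) : IsIsomorphic R U := by
  obtain ⟨T, hT⟩ := h
  obtain ⟨T', hT'⟩ := h'
  exact ⟨T.trans T', fun y v => by
    rw [LinearEquiv.trans_apply, LinearEquiv.trans_apply, hT, hT']⟩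

/-- Isomorphic representations are conjugate by an invertible matrix. -/
theorem IsIsomorphic.exists_matrix {R : L →ₗ[F] Matrix ι ι F} {S : L →ₗ[F] Matrix κ κ F}
    (h : IsIsomorphic R S) : ∃ (P : Matrix κ ι F) (P' : Matrix ι κ F), P * P' = 1 ∧ P' * P = 1 ∧
      ∀ y, P * R y = S y * P := by
  obtain ⟨T, hT⟩ := h
  refine ⟨LinearMap.toMatrix' (T : (ι → F) →ₗ[F] (κ → F)),
    LinearMap.toMatrix' (T.symm : (κ → F) →ₗ[F] (ι → F)), ?_, ?_, fun y => ?_⟩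
  · rw [← LinearMap.toMatrix'_comp]; simp
  · rw [← LinearMap.toMatrix'_comp]; simp
  · apply Matrix.toLin'.injective
    rw [Matrix.toLin'_mul, Matrix.toLin'_mul, Matrix.toLin'_toMatrix']
    exact LinearMap.ext fun v => by simpa using hT y v

/-- The submodules of a representation form a chain if those of an isomorphic one do. -/
theorem isUniserial_of_equiv {R : L →ₗ⁅F⁆ Matrix ι ι F} [Nonempty ι] (T : (ι → F) ≃ₗ[F] (κ → F))
    (A : Set (Matrix κ κ F))
    (hT : ∀ B ∈ A, ∃ y : L, ∀ v, T ((R y).mulVec v) = B.mulVec (T v))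
    (hA : ∀ P Q : Submodule F (κ → F), (∀ B ∈ A, ∀ u ∈ P, B.mulVec u ∈ P) →
      (∀ B ∈ A, ∀ u ∈ Q, B.mulVec u ∈ Q) → P ≤ Q ∨ Q ≤ P) : IsUniserial R := by
  refine ⟨inferInstance, fun P Q hP hQ => ?_⟩
  have key : ∀ P, IsSubmodule R P → ∀ B ∈ A, ∀ u ∈ P.map (T : (ι → F) →ₗ[F] (κ → F)),
      B.mulVec u ∈ P.map (T : (ι → F) →ₗ[F] (κ → F)) := by
    rintro P hP B hB _ ⟨v, hv, rfl⟩
    obtain ⟨y, hy⟩ := hT B hB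
    exact ⟨(R y).mulVec v, hP y v hv, hy v⟩
  have hinj : Function.Injective (T : (ι → F) →ₗ[F] (κ → F)) := T.injective
  rcases hA _ _ (key P hP) (key Q hQ) with h | h
  · exact Or.inl ((Submodule.map_le_map_iff_of_injective hinj _ _).mp h)
  · exact Or.inr ((Submodule.map_le_map_iff_of_injective hinj _ _).mp h)

end Isomorphisms

/-! ### Jordan decompositions -/

namespace JordanDecomposition

variable {V : Type*} [AddCommGroup V] [Module F V] {x : End F V} {e : ℕ}

theorem sub_apply_basis (D : JordanDecomposition x e) (i : Fin e) (j : Fin (D.size i)) :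
    (x - D.eigenvalue i • (1 : End F V)) (D.basis i j) =
      if h : (j : ℕ) + 1 < D.size i then (D.basis i ⟨j + 1, h⟩ : V) else 0 := by
  rw [LinearMap.sub_apply, D.apply_basis]
  have key : ∀ l : Fin (D.size i), lowerJordan (D.size i) (D.eigenvalue i) l j •
      (D.basis i l : V) = (if l = j then D.eigenvalue i • (D.basis i j : V) else 0) +
        (if (j : ℕ) + 1 = (l : ℕ) then (D.basis i l : V) else 0) := by
    intro l
    unfold lowerJordan
    by_cases h1 : l = j
    · subst h1; simp
    · by_cases h2 : (j : ℕ) + 1 = (l : ℕ) <;> simp [h1, h2]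
  rw [Finset.sum_congr rfl fun l _ => key l, Finset.sum_add_distrib, Finset.sum_ite_eq']
  simp only [Finset.mem_univ, if_true, LinearMap.smul_apply, Module.End.one_apply,
    add_sub_cancel_left]
  split_ifs with h
  · rw [Finset.sum_eq_single ⟨j + 1, h⟩]
    · simp
    · intro b _ hb
      rw [if_neg]
      intro hh; exact hb (Fin.ext hh.symm)
    · simp
  · refine Finset.sum_eq_zero fun b _ => if_neg ?_
    omega

theorem sub_pow_basis (D : JordanDecomposition x e) (i : Fin e) (j : Fin (D.size i)) (r : ℕ) :
    ((x - D.eigenvalue i • (1 : End F V)) ^ r) (D.basis i j) =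
      if h : (j : ℕ) + r < D.size i then (D.basis i ⟨j + r, h⟩ : V) else 0 := by
  induction r with
  | zero => simp
  | succ r ih =>
    rw [pow_succ', Module.End.mul_apply, ih]
    by_cases h : (j : ℕ) + r < D.size i
    · rw [dif_pos h, sub_apply_basis]
      rfl
    · rw [dif_neg h, map_zero, dif_neg (by omega)]

theorem sub_pow_of_mem (D : JordanDecomposition x e) (i : Fin e) {v : V} (hv : v ∈ D.block i)
    {r : ℕ} (hr : D.size i ≤ r) : ((x - D.eigenvalue i • (1 : End F V)) ^ r) v = 0 := by
  have h : v = ∑ j, (D.basis i).repr ⟨v, hv⟩ j • (D.basis i j : V) := by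
    have h' := congrArg (D.block i).subtype ((D.basis i).sum_repr ⟨v, hv⟩)
    rw [map_sum] at h'
    exact h'.symm
  rw [h, map_sum]
  refine Finset.sum_eq_zero fun j _ => ?_
  rw [map_smul, sub_pow_basis, dif_neg (by omega), smul_zero]

theorem basis_ne_zero (D : JordanDecomposition x e) (i : Fin e) (j : Fin (D.size i)) :
    (D.basis i j : V) ≠ 0 := by
  intro h
  exact (D.basis i).ne_zero j (Subtype.ext h)

/-- The basis of `V` that consists of the bases of all the blocks. -/
noncomputable def fullBasis (D : JordanDecomposition x e) :
    Basis (Σ i, Fin (D.size i)) F V := D.isInternal.collectedBasis D.basis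

theorem fullBasis_apply (D : JordanDecomposition x e) (a : Σ i, Fin (D.size i)) :
    D.fullBasis a = (D.basis a.1 a.2 : V) := by
  rw [fullBasis, DirectSum.IsInternal.collectedBasis_coe]

theorem finrank_eq (D : JordanDecomposition x e) : finrank F V = ∑ i, D.size i := by
  rw [Module.finrank_eq_card_basis D.fullBasis]
  simp

theorem iSup_block (D : JordanDecomposition x e) : ⨆ i, D.block i = ⊤ :=
  D.isInternal.submodule_iSup_eq_top

theorem induction_block (D : JordanDecomposition x e) {p : V → Prop} (h0 : p 0)
    (hadd : ∀ v w, p v → p w → p (v + w)) (h : ∀ i, ∀ v ∈ D.block i, p v) (v : V) : p v := by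
  have hv : v ∈ ⨆ i, D.block i := by rw [iSup_block]; trivial
  exact Submodule.iSup_induction _ (motive := p) hv h h0 hadd

theorem size_le [NeZero e] (D : JordanDecomposition x e) (i : Fin e) : D.size i ≤ D.size 0 :=
  D.size_antitone (Fin.zero_le _)

theorem sub_pow_eq_zero [NeZero e] (D : JordanDecomposition x e)
    (hD : ∀ i, D.eigenvalue i = D.eigenvalue 0) :
    (x - D.eigenvalue 0 • (1 : End F V)) ^ D.size 0 = 0 := by
  ext v
  refine D.induction_block (p := fun v => ((x - D.eigenvalue 0 • (1 : End F V)) ^ D.size 0) v = 0)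
    (map_zero _) (fun v w hv hw => by rw [map_add, hv, hw, add_zero]) (fun i v hv => ?_) v
  rw [← hD i]
  exact D.sub_pow_of_mem i hv (D.size_le i)

theorem eigenvalue_ne_zero (D : JordanDecomposition x e) (hx : IsUnit x) (i : Fin e) :
    D.eigenvalue i ≠ 0 := by
  intro h
  have h1 := D.sub_pow_basis i ⟨0, D.size_pos i⟩ (D.size i)
  rw [dif_neg (by simp), h, zero_smul, sub_zero] at h1
  exact D.basis_ne_zero i _ ((((Module.End.isUnit_iff _).mp (hx.pow (D.size i))).1)
    (h1.trans (map_zero _).symm))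

/-- If `x` is not diagonalizable, its largest Jordan block has size at least `2`. -/
theorem two_le_n [NeZero e] (D : JordanDecomposition x e) (hnd : ¬ IsDiagonalizable x) :
    2 ≤ D.size 0 := by
  by_contra hlt
  apply hnd
  have hs : ∀ i, D.size i = 1 := fun i => by
    have := D.size_le i
    have := D.size_pos i
    omega
  have : FiniteDimensional F V := Module.Basis.finiteDimensional_of_finite D.fullBasis
  have hcard : Fintype.card (Σ i, Fin (D.size i)) = finrank F V :=
    (Module.finrank_eq_card_basis D.fullBasis).symm
  let E := Fintype.equivFinOfCardEq hcard
  refine ⟨D.fullBasis.reindex E, fun i => D.eigenvalue (E.symm i).1, fun i => ?_⟩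
  rw [Basis.reindex_apply, fullBasis_apply]
  have h1 := D.sub_apply_basis (E.symm i).1 (E.symm i).2
  have h2 := hs (E.symm i).1
  rw [dif_neg (by omega), LinearMap.sub_apply, sub_eq_zero] at h1
  exact h1

theorem basis_eq_pow (D : JordanDecomposition x e) (i : Fin e) (l : Fin (D.size i)) :
    (D.basis i l : V) = ((x - D.eigenvalue i • (1 : End F V)) ^ (l : ℕ))
      (D.basis i ⟨0, D.size_pos i⟩) := by
  rw [sub_pow_basis, dif_pos (by simp)]
  congr 2
  exact Fin.ext (by simp)

end JordanDecomposition

/-! ### Restriction to the first block -/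

section LinearRep

variable {V : Type*} [LieRing V] [LieAlgebra F V] [IsLieAbelian V]
variable {x : End F V} {e : ℕ} [NeZero e]
variable {ι κ : Type*} [Fintype ι] [DecidableEq ι] [Fintype κ] [DecidableEq κ]

namespace JordanDecomposition

/-- The generator `x` of `𝔤_1`. -/
def gen₁ (D : JordanDecomposition x e) : D.g₁ := ⟨gen x, (D.block 0).zero_mem⟩

/-- The element of `𝔤_1` given by an element of `V_1`. -/
def ofV₁ (D : JordanDecomposition x e) (v : D.block 0) : D.g₁ := ⟨ofV x v, v.2⟩

theorem linearRep_gen (D : JordanDecomposition x e) (A E : Matrix ι ι F) :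
    D.linearRep A E D.gen₁ = A := by
  change (1 : F) • A + ∑ l : Fin D.n, (D.basis 0).repr (0 : D.block 0) l •
    (adSub A D.lam ^ (l : ℕ)) E = A
  simp

theorem linearRep_ofV (D : JordanDecomposition x e) (A E : Matrix ι ι F) (l : Fin D.n) :
    D.linearRep A E (D.ofV₁ (D.basis 0 l)) = (adSub A D.lam ^ (l : ℕ)) E := by
  change (0 : F) • A + ∑ j : Fin D.n, (D.basis 0).repr (D.basis 0 l) j •
    (adSub A D.lam ^ (j : ℕ)) E = _
  rw [zero_smul, zero_add, Finset.sum_eq_single l]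
  · simp
  · intro b _ hb
    rw [Basis.repr_self, Finsupp.single_eq_of_ne hb, zero_smul]
  · simp

/-- A representation of `𝔤` extends a map given by `A` and `E` if and only if it takes the value
`A` at `x` and the value `E` at `v_0`. -/
theorem restrict_eq_linearRep_iff (D : JordanDecomposition x e) (R : Alg x →ₗ⁅F⁆ Matrix ι ι F)
    (A E : Matrix ι ι F) :
    (D.restrict R : D.g₁ →ₗ[F] Matrix ι ι F) = D.linearRep A E ↔
      R (gen x) = A ∧ R (ofV x D.v₀) = E := by
  constructor
  · intro h
    refine ⟨?_, ?_⟩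
    · rw [← D.linearRep_gen A E, ← h]; rfl
    · have := D.linearRep_ofV A E ⟨0, D.size_pos 0⟩
      rw [← h] at this
      exact this
  · rintro ⟨rfl, rfl⟩
    ext1 y
    change R y.1 = y.1.right • R (gen x) + ∑ l : Fin D.n, (D.basis 0).repr ⟨y.1.left, y.2⟩ l •
      (adSub (R (gen x)) D.lam ^ (l : ℕ)) (R (ofV x D.v₀))
    have h1 := rep_eq (R : Alg x →ₗ[F] Matrix ι ι F) y.1
    simp only [LieHom.coe_toLinearMap] at h1
    rw [h1]
    congr 1
    have h : y.1.left = ∑ j, (D.basis 0).repr ⟨y.1.left, y.2⟩ j • (D.basis 0 j : V) := by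
      have h' := congrArg (D.block 0).subtype ((D.basis 0).sum_repr ⟨y.1.left, y.2⟩)
      rw [map_sum] at h'
      exact h'.symm
    change repV (R : Alg x →ₗ[F] Matrix ι ι F) y.1.left = _
    conv_lhs => rw [h, map_sum]
    refine Finset.sum_congr rfl fun l _ => ?_
    rw [map_smul, adSub_pow_rep, v₀, ← D.basis_eq_pow 0 l]
    rfl

/-- A representation of `𝔤` is isomorphic, on `𝔤_1`, to the map given by `A` and `E` as soon as the
values at `x` and `v_0` are conjugate to `A` and `E`. -/
theorem isIsomorphic_linearRep (D : JordanDecomposition x e) (R : Alg x →ₗ⁅F⁆ Matrix ι ι F)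
    (A E : Matrix κ κ F) (T : (ι → F) ≃ₗ[F] (κ → F))
    (hA : ∀ v, T ((R (gen x)).mulVec v) = A.mulVec (T v))
    (hE : ∀ v, T ((R (ofV x D.v₀)).mulVec v) = E.mulVec (T v)) :
    IsIsomorphic (D.restrict R : D.g₁ →ₗ[F] Matrix ι ι F) (D.linearRep A E) := by
  have hpow : ∀ (l : ℕ) v, T (((adSub (R (gen x)) D.lam ^ l) (R (ofV x D.v₀))).mulVec v) =
      ((adSub A D.lam ^ l) E).mulVec (T v) := by
    intro l
    induction l with
    | zero => simpa using hE
    | succ l ih =>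
      intro v
      rw [pow_succ', pow_succ', Module.End.mul_apply, Module.End.mul_apply, adSub_apply,
        adSub_apply, Matrix.sub_mulVec, Matrix.sub_mulVec, Matrix.sub_mulVec, Matrix.sub_mulVec,
        ← Matrix.mulVec_mulVec, ← Matrix.mulVec_mulVec, ← Matrix.mulVec_mulVec,
        ← Matrix.mulVec_mulVec, Matrix.smul_mulVec, Matrix.smul_mulVec, map_sub, map_sub,
        map_smul, hA, ih, ih, hA]
  refine ⟨T, fun y v => ?_⟩
  rw [(D.restrict_eq_linearRep_iff R _ _).mpr ⟨rfl, rfl⟩]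
  change T ((y.1.right • R (gen x) + ∑ l : Fin D.n, (D.basis 0).repr ⟨y.1.left, y.2⟩ l •
      (adSub (R (gen x)) D.lam ^ (l : ℕ)) (R (ofV x D.v₀))).mulVec v) =
    (y.1.right • A + ∑ l : Fin D.n, (D.basis 0).repr ⟨y.1.left, y.2⟩ l •
      (adSub A D.lam ^ (l : ℕ)) E).mulVec (T v)
  simp only [Matrix.add_mulVec, Matrix.sum_mulVec, Matrix.smul_mulVec, map_add, map_sum, map_smul,
    hA, hpow]

/-- An isomorphism between two of the linear maps on `𝔤_1` is given by an invertible matrix that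
intertwines the values on `x` and on `v_0`. -/
theorem exists_matrix_of_linearRep (D : JordanDecomposition x e) {A E : Matrix ι ι F}
    {A' E' : Matrix κ κ F} (h : IsIsomorphic (D.linearRep A E) (D.linearRep A' E')) :
    ∃ (P : Matrix κ ι F) (P' : Matrix ι κ F), P * P' = 1 ∧ P' * P = 1 ∧
      P * A = A' * P ∧ P * E = E' * P := by
  obtain ⟨P, P', h1, h2, h3⟩ := h.exists_matrix
  refine ⟨P, P', h1, h2, ?_, ?_⟩
  · have := h3 D.gen₁
    rwa [linearRep_gen, linearRep_gen] at this
  · have := h3 (D.ofV₁ (D.basis 0 ⟨0, D.size_pos 0⟩))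
    rwa [linearRep_ofV, linearRep_ofV, pow_zero] at this

end JordanDecomposition
end LinearRep
end UniserialSolvable

namespace UniserialSolvable

variable {F : Type*} [Field F]

/-! ### Homomorphisms of `F[t]`-modules given by operators -/

section PolyMaps

variable {M N : Type*} [AddCommGroup M] [Module F M] [AddCommGroup N] [Module F N]

/-- A linear map that commutes with given operators, as a homomorphism of `F[t]`-modules. -/
noncomputable def polyMap (t : End F M) (s : End F N) (ψ : M →ₗ[F] N)
    (h : ∀ m, ψ (t m) = s (ψ m)) : AEval' t →ₗ[Polynomial F] AEval' s :=
  LinearMap.ofAEval t ((AEval'.of s).toLinearMap ∘ₗ ψ) fun m => by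
    have : ψ (t • m) = s (ψ m) := h m
    rw [LinearMap.comp_apply, this, LinearMap.comp_apply]
    exact (AEval'.X_smul_of s (ψ m)).symm

theorem polyMap_of (t : End F M) (s : End F N) (ψ : M →ₗ[F] N)
    (h : ∀ m, ψ (t m) = s (ψ m)) (m : M) :
    polyMap t s ψ h (AEval'.of t m) = AEval'.of s (ψ m) := rfl

theorem polyHom_commute (t : End F M) (s : End F N) (φ : AEval' t →ₗ[Polynomial F] AEval' s)
    (m : M) : (AEval'.of s).symm (φ (AEval'.of t (t m))) =
      s ((AEval'.of s).symm (φ (AEval'.of t m))) := by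
  rw [← AEval'.X_smul_of, map_smul, AEval'.of_symm_X_smul]

end PolyMaps

/-! ### Extensions of `R_{α,k,X}` and monomorphisms -/

section TwoBlocks

theorem hat_mul_hat {p q : ℕ} {B C : Matrix (Fin p ⊕ Fin q) (Fin p ⊕ Fin q) F}
    (hB : B ∈ hatMatrices F p q) (hC : C ∈ hatMatrices F p q) : B * C = 0 := by
  obtain ⟨N, rfl⟩ := hB
  obtain ⟨M, rfl⟩ := hC
  simp [Matrix.fromBlocks_multiply]

/-- The space `M_{p,q}` is the generalized eigenspace of `ad A` with eigenvalue `λ`, because `ad A`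
has the eigenvalues `0`, `0` and `-λ` on the other three blocks. -/
theorem mem_hat_of_adSub_mem {p q : ℕ} {α lam : F} (hlam : lam ≠ 0) (h2 : (2 : F) ≠ 0)
    {B : Matrix (Fin p ⊕ Fin q) (Fin p ⊕ Fin q) F}
    (h : adSub (twoBlocks p q α lam) lam B ∈ hatMatrices F p q) : B ∈ hatMatrices F p q := by
  obtain ⟨N, hN⟩ := h
  obtain ⟨B₁, B₁₂, B₂₁, B₂, rfl⟩ : ∃ A B' C D, B = Matrix.fromBlocks A B' C D :=
    ⟨_, _, _, _, (Matrix.fromBlocks_toBlocks B).symm⟩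
  have e : adSub (twoBlocks p q α lam) lam (Matrix.fromBlocks B₁ B₁₂ B₂₁ B₂) =
      Matrix.fromBlocks
        (upperJordan p α * B₁ - B₁ * upperJordan p α - lam • B₁)
        (upperJordan p α * B₁₂ - B₁₂ * upperJordan q (α - lam) - lam • B₁₂)
        (upperJordan q (α - lam) * B₂₁ - B₂₁ * upperJordan p α - lam • B₂₁)
        (upperJordan q (α - lam) * B₂ - B₂ * upperJordan q (α - lam) - lam • B₂) := by
    rw [adSub_apply, twoBlocks]
    simp only [Matrix.fromBlocks_multiply, Matrix.zero_mul, Matrix.mul_zero, add_zero, zero_add,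
      Matrix.fromBlocks_smul, sub_eq_add_neg, Matrix.fromBlocks_neg, Matrix.fromBlocks_add]
  rw [e, Matrix.fromBlocks_inj] at hN
  obtain ⟨h11, -, h21, h22⟩ := hN
  have e1 : B₁ = 0 := eq_zero_of_upperJordan_sylvester (c := lam)
    (by rw [sub_self]; exact hlam.symm) (sub_eq_zero.mp h11)
  have e2 : B₂ = 0 := eq_zero_of_upperJordan_sylvester (c := lam)
    (by rw [sub_self]; exact hlam.symm) (sub_eq_zero.mp h22)
  have e3 : B₂₁ = 0 := eq_zero_of_upperJordan_sylvester (c := lam)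
    (by intro h'; apply mul_ne_zero h2 hlam; linear_combination -h') (sub_eq_zero.mp h21)
  exact ⟨B₁₂, by rw [e1, e2, e3]⟩

variable {V : Type*} [LieRing V] [LieAlgebra F V] [IsLieAbelian V]
variable {x : End F V} {e : ℕ} [NeZero e]

/-- If all eigenvalues of `x` are equal to `λ`, then `V` acts by elements of `M_{p,q}` as soon as
`x` acts by `J^p(α) ⊕ J^q(α-λ)`. -/
theorem rep_mem_hat (D : JordanDecomposition x e) (hlam : D.lam ≠ 0) (h2 : (2 : F) ≠ 0)
    (hD : ∀ i, D.eigenvalue i = D.lam) {p q : ℕ} {α : F}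
    (R : Alg x →ₗ⁅F⁆ Matrix (Fin p ⊕ Fin q) (Fin p ⊕ Fin q) F)
    (hR : R (gen x) = twoBlocks p q α D.lam) (v : V) : R (ofV x v) ∈ hatMatrices F p q := by
  have key : ∀ (r : ℕ) (B : Matrix (Fin p ⊕ Fin q) (Fin p ⊕ Fin q) F),
      (adSub (twoBlocks p q α D.lam) D.lam ^ r) B ∈ hatMatrices F p q → B ∈ hatMatrices F p q := by
    intro r
    induction r with
    | zero => intro B hB; simpa using hB
    | succ r ih =>
      intro B hB
      rw [pow_succ', Module.End.mul_apply] at hB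
      exact ih B (mem_hat_of_adSub_mem hlam h2 hB)
  apply key (D.size 0)
  rw [← hR, adSub_pow_rep, D.sub_pow_eq_zero hD]
  have : R (ofV x ((0 : End F V) v)) =
      repV (R : Alg x →ₗ[F] Matrix (Fin p ⊕ Fin q) (Fin p ⊕ Fin q) F) 0 := rfl
  rw [this, map_zero]
  exact Submodule.zero_mem _

/-- If `V` acts faithfully by elements of `M_{p,q}` and `p > 1`, the whole representation is
faithful: the matrix of `x` has a nonzero entry above the diagonal in its upper left block. -/
theorem isFaithful_of_hat {p q : ℕ} {α lam : F} (hp : 1 < p)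
    (R : Alg x →ₗ⁅F⁆ Matrix (Fin p ⊕ Fin q) (Fin p ⊕ Fin q) F)
    (hR : R (gen x) = twoBlocks p q α lam) (hV : ∀ v, R (ofV x v) ∈ hatMatrices F p q)
    (hinj : ∀ v, R (ofV x v) = 0 → v = 0) : IsFaithful R := by
  have : ∀ y, R y = 0 → y = 0 := by
    intro y hy
    have h1 := rep_eq (R : Alg x →ₗ[F] Matrix (Fin p ⊕ Fin q) (Fin p ⊕ Fin q) F) y
    simp only [LieHom.coe_toLinearMap] at h1
    rw [h1] at hy
    obtain ⟨N, hN⟩ := hV y.left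
    have h3 := congrFun (congrFun hy (Sum.inl ⟨0, by omega⟩)) (Sum.inl ⟨1, hp⟩)
    rw [hR, hN] at h3
    have h4 : y.right = 0 := by
      simpa [twoBlocks, upperJordan] using h3
    rw [h4, zero_smul, zero_add] at hy
    rw [alg_eq y, h4, hinj _ hy]
    ext <;> simp
  exact (injective_iff_map_eq_zero R).mpr this

/-- A representation is uniserial as soon as two of its matrices are, in suitable coordinates,
the values of `R_{α,k,X}` on `x` and `v_0`. -/
theorem isUniserial_of_twoBlocks {L : Type*} [LieRing L] [LieAlgebra F L] {ι : Type*} [Fintype ι]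
    [DecidableEq ι] [Nonempty ι] {n k : ℕ} {α lam : F} (hk : 1 ≤ k) (hkn : k ≤ n)
    (X : Matrix (Fin (k - 1)) (Fin (n - k)) F) (R : L →ₗ⁅F⁆ Matrix ι ι F)
    (T : (ι → F) ≃ₗ[F] (Fin k ⊕ Fin (n + 1 - k) → F)) (y z : L)
    (hy : ∀ v, T ((R y).mulVec v) = (twoBlocks k (n + 1 - k) α lam).mulVec (T v))
    (hz : ∀ v, T ((R z).mulVec v) = (cornerHat X).1.mulVec (T v)) : IsUniserial R := by
  refine isUniserial_of_equiv T {twoBlocks k (n + 1 - k) α lam, (cornerHat X).1} ?_ ?_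
  · rintro B (rfl | rfl)
    · exact ⟨y, hy⟩
    · exact ⟨z, hz⟩
  · intro P Q hP hQ
    exact twoBlocks_chain (α := α) (lam := lam) hk hkn X P Q ⟨hP _ (by simp), hP _ (by simp)⟩
      ⟨hQ _ (by simp), hQ _ (by simp)⟩

/-- The analogue of `isUniserial_of_twoBlocks` for `R_{α,a}`. -/
theorem isUniserial_of_threeBlocks {L : Type*} [LieRing L] [LieAlgebra F L] {ι : Type*}
    [Fintype ι] [DecidableEq ι] [Nonempty ι] {n : ℕ} {α lam : F} (hn : 1 ≤ n) {a : Fin n → F}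
    (ha : IsAdmissible a) (R : L →ₗ⁅F⁆ Matrix ι ι F)
    (T : (ι → F) ≃ₗ[F] (Idx n → F)) (y z : L)
    (hy : ∀ v, T ((R y).mulVec v) = (threeBlocks n α lam).mulVec (T v))
    (hz : ∀ v, T ((R z).mulVec v) = (rowColumn a).mulVec (T v)) : IsUniserial R := by
  refine isUniserial_of_equiv T {threeBlocks n α lam, rowColumn a} ?_ ?_
  · rintro B (rfl | rfl)
    · exact ⟨y, hy⟩
    · exact ⟨z, hz⟩
  · intro P Q hP hQ
    exact threeBlocks_chain (α := α) (lam := lam) hn ha P Q ⟨hP _ (by simp), hP _ (by simp)⟩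
      ⟨hQ _ (by simp), hQ _ (by simp)⟩

namespace JordanDecomposition

variable (D : JordanDecomposition x e) {α : F} {k : ℕ} {X : Matrix (Fin (k - 1)) (Fin (D.n - k)) F}

/-- The monomorphism `V → M_{k,n+1-k}` defined by a faithful representation. -/
noncomputable def monoOfRep (hlam : D.lam ≠ 0) (h2 : (2 : F) ≠ 0)
    (hD : ∀ i, D.eigenvalue i = D.lam)
    (R : Alg x →ₗ⁅F⁆ Matrix (Fin k ⊕ Fin (D.n + 1 - k)) (Fin k ⊕ Fin (D.n + 1 - k)) F)
    (hf : IsFaithful R) (hR : R (gen x) = twoBlocks k (D.n + 1 - k) α D.lam)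
    (hE : R (ofV x D.v₀) = (cornerHat X).1) : D.Mono α k X :=
  ⟨polyMap _ (theta k (D.n + 1 - k) α D.lam)
      ((repV (R : Alg x →ₗ[F]
        Matrix (Fin k ⊕ Fin (D.n + 1 - k)) (Fin k ⊕ Fin (D.n + 1 - k)) F)).codRestrict _
          (rep_mem_hat D hlam h2 hD R hR)) (by
        intro v
        apply Subtype.ext
        have h := adSub_pow_rep R D.lam v 1
        rw [pow_one, pow_one, hR] at h
        exact h.symm), by
    refine ⟨?_, ?_⟩
    · intro v w h
      obtain ⟨v, rfl⟩ := (AEval'.of _).surjective v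
      obtain ⟨w, rfl⟩ := (AEval'.of _).surjective w
      rw [polyMap_of, polyMap_of] at h
      have h' := congrArg Subtype.val ((AEval'.of _).injective h)
      have h'' : R (ofV x v) = R (ofV x w) := h'
      have := hf h''
      have hvw : v = w := congrArg LieAlgebra.SemiDirectSum.left this
      rw [hvw]
    · rw [polyMap_of]
      congr 1
      exact Subtype.ext hE⟩

theorem monoOfRep_matrix (hlam : D.lam ≠ 0) (h2 : (2 : F) ≠ 0)
    (hD : ∀ i, D.eigenvalue i = D.lam)
    (R : Alg x →ₗ⁅F⁆ Matrix (Fin k ⊕ Fin (D.n + 1 - k)) (Fin k ⊕ Fin (D.n + 1 - k)) F)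
    (hf : IsFaithful R) (hR : R (gen x) = twoBlocks k (D.n + 1 - k) α D.lam)
    (hE : R (ofV x D.v₀) = (cornerHat X).1) (v : V) :
    (D.monoOfRep hlam h2 hD R hf hR hE).matrix v = R (ofV x v) := rfl

variable {D} in
theorem Mono.ext_matrix {φ ψ : D.Mono α k X} (h : ∀ v, φ.matrix v = ψ.matrix v) : φ = ψ := by
  apply Subtype.ext
  ext v
  obtain ⟨v, rfl⟩ := (AEval'.of _).surjective v
  exact (AEval'.of (theta k (D.n + 1 - k) α D.lam)).symm.injective (Subtype.ext (h v))

variable {D} in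
/-- The values of a monomorphism, as a linear map into the space of matrices. -/
noncomputable def Mono.toLin (φ : D.Mono α k X) :
    V →ₗ[F] Matrix (Fin k ⊕ Fin (D.n + 1 - k)) (Fin k ⊕ Fin (D.n + 1 - k)) F :=
  (hatMatrices F k (D.n + 1 - k)).subtype ∘ₗ
    (AEval'.of (theta k (D.n + 1 - k) α D.lam)).symm.toLinearMap ∘ₗ
    φ.1.restrictScalars F ∘ₗ (AEval'.of (x - D.lam • (1 : End F V))).toLinearMap

variable {D} in
/-- The representation of `𝔤` defined by a monomorphism `V → M_{k,n+1-k}`. -/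
noncomputable def Mono.rep (φ : D.Mono α k X) :
    Alg x →ₗ⁅F⁆ Matrix (Fin k ⊕ Fin (D.n + 1 - k)) (Fin k ⊕ Fin (D.n + 1 - k)) F :=
  buildRep x (twoBlocks k (D.n + 1 - k) α D.lam) φ.toLin (by
    intro v
    have h := congrArg Subtype.val (polyHom_commute (x - D.lam • (1 : End F V))
      (theta k (D.n + 1 - k) α D.lam) φ.1 v)
    have h' : φ.toLin ((x - D.lam • (1 : End F V)) v) =
        adSub (twoBlocks k (D.n + 1 - k) α D.lam) D.lam (φ.toLin v) := h
    rw [LinearMap.sub_apply, map_sub, LinearMap.smul_apply, map_smul, adSub_apply] at h'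
    exact (sub_left_injective h').symm) (by
    intro v w
    have hm : ∀ v, φ.toLin v ∈ hatMatrices F k (D.n + 1 - k) := fun v => Subtype.mem _
    rw [hat_mul_hat (hm v) (hm w), hat_mul_hat (hm w) (hm v)])

variable {D} in
theorem Mono.rep_ofV (φ : D.Mono α k X) (v : V) : φ.rep (ofV x v) = φ.matrix v :=
  buildRep_ofV _ _ _ _ _ _

variable {D} in
theorem Mono.rep_gen (φ : D.Mono α k X) : φ.rep (gen x) = twoBlocks k (D.n + 1 - k) α D.lam :=
  buildRep_gen _ _ _ _ _

variable {D} in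
theorem Mono.matrix_v₀ (φ : D.Mono α k X) : φ.matrix D.v₀ = (cornerHat X).1 := by
  rw [Mono.matrix, φ.2.2, LinearEquiv.symm_apply_apply]

variable {D} in
theorem Mono.isFaithful_rep (hk : 1 < k) (φ : D.Mono α k X) : IsFaithful φ.rep := by
  refine isFaithful_of_hat hk φ.rep φ.rep_gen ?_ ?_
  · intro v
    rw [φ.rep_ofV]
    exact Subtype.mem _
  · intro v hv
    rw [φ.rep_ofV] at hv
    have h1 : (AEval'.of (theta k (D.n + 1 - k) α D.lam)).symm
      (φ.1 (AEval'.of (x - D.lam • (1 : End F V)) v)) = 0 := Subtype.ext hv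
    rw [LinearEquiv.map_eq_zero_iff] at h1
    have h3 := φ.2.1 (h1.trans (map_zero φ.1).symm)
    rwa [LinearEquiv.map_eq_zero_iff] at h3

/-- Extensions of `R_{α,k,X}` correspond to monomorphisms `V → M_{k,n+1-k}`. -/
noncomputable def extensionEquivMono (hlam : D.lam ≠ 0) (h2 : (2 : F) ≠ 0)
    (hD : ∀ i, D.eigenvalue i = D.lam) (hk : 1 < k) (hkn : k < D.n) :
    D.Extension (D.repX α k X) ≃ D.Mono α k X where
  toFun R := D.monoOfRep hlam h2 hD R.1 R.2.1
    ((D.restrict_eq_linearRep_iff _ _ _).mp R.2.2.2).1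
    ((D.restrict_eq_linearRep_iff _ _ _).mp R.2.2.2).2
  invFun φ := ⟨φ.rep, φ.isFaithful_rep hk, by
      have : Nonempty (Fin k) := ⟨⟨0, by omega⟩⟩
      exact isUniserial_of_twoBlocks hk.le hkn.le X φ.rep (LinearEquiv.refl _ _) (gen x)
        (ofV x D.v₀) (fun v => by rw [φ.rep_gen]; rfl)
        (fun v => by rw [φ.rep_ofV, φ.matrix_v₀]; rfl),
    (D.restrict_eq_linearRep_iff _ _ _).mpr ⟨φ.rep_gen, by rw [φ.rep_ofV, φ.matrix_v₀]⟩⟩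
  left_inv R := by
    apply Subtype.ext
    apply rep_ext
    · rw [Mono.rep_gen]
      exact ((D.restrict_eq_linearRep_iff _ _ _).mp R.2.2.2).1.symm
    · intro v
      rw [Mono.rep_ofV]
      rfl
  right_inv φ := by
    apply Mono.ext_matrix
    intro v
    rw [monoOfRep_matrix, Mono.rep_ofV]

/-- The Jordan decomposition of `x`, read as a decomposition into cyclic `F[t]`-modules with `t`
acting by `x - λ 1`. -/
theorem exists_polyV_equiv (hD : ∀ i, D.eigenvalue i = D.lam) :
    ∃ P : D.polyV ≃ₗ[Polynomial F] Torsion F D.size,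
      P (AEval'.of _ D.v₀) = inFirst _ 1 := by
  have : FiniteDimensional F V := Module.Basis.finiteDimensional_of_finite D.fullBasis
  obtain ⟨P, hP⟩ := exists_torsion_equiv (x - D.lam • (1 : End F V)) D.size D.size_pos
    (fun i => (D.basis i ⟨0, D.size_pos i⟩ : V)) (fun i => by
      rw [← hD i]
      exact D.sub_pow_of_mem i (Subtype.mem _) le_rfl) (by
      have h1 : (fun i => ((x - D.lam • (1 : End F V)) ^ (D.size i - 1))
          (D.basis i ⟨0, D.size_pos i⟩ : V)) = fun i => D.fullBasis
            ⟨i, ⟨D.size i - 1, Nat.sub_lt (D.size_pos i) one_pos⟩⟩ := by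
        funext i
        rw [D.fullBasis_apply, ← hD i, D.basis_eq_pow i ⟨D.size i - 1, _⟩]
      rw [h1]
      refine D.fullBasis.linearIndependent.comp
        (fun i => ⟨i, ⟨D.size i - 1, Nat.sub_lt (D.size_pos i) one_pos⟩⟩) ?_
      intro i j hij
      exact congrArg Sigma.fst hij) D.finrank_eq
  exact ⟨P, hP 0 rfl⟩

/-- A monomorphism `V → M_{k,n+1-k}` bounds the sizes of the Jordan blocks: the number of blocks of
size at least `j` in `V` cannot exceed the number of such summands in `M_{k,n+1-k}`. -/
theorem isTypeOne_of_mono [CharZero F] (hD : ∀ i, D.eigenvalue i = D.lam) (hk : 1 ≤ k)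
    (hkn : k ≤ D.n) (φ : D.Mono α k X) : D.IsTypeOne ∧ e ≤ min k (D.n + 1 - k) := by
  obtain ⟨Q, -⟩ := exists_hatMatrices_equiv (N := D.n) (p := k) (q := D.n + 1 - k) (by omega)
    (by omega) (by omega) α D.lam (cornerHat X) (by
      change cornerMatrix X _ _ ≠ 0
      rw [cornerMatrix_first _ _ _ rfl, if_pos (by simp only; omega)]
      exact one_ne_zero)
  set m : Fin (min k (D.n + 1 - k)) → ℕ := fun i => D.n - 2 * (i : ℕ) with hm
  have key : ∀ i : Fin e, ∃ h : (i : ℕ) < min k (D.n + 1 - k), D.size i - 1 < m ⟨i, h⟩ := by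
    intro i
    have hle : ∀ a : Fin ((i : ℕ) + 1), (a : ℕ) < e := fun a => by omega
    -- the last basis vectors of the first `i + 1` blocks are killed by `t` and divisible by
    -- `t^{d-1}`, where `d` is the size of the `i`-th block
    set b : Fin ((i : ℕ) + 1) → V := fun a => D.fullBasis
      ⟨⟨a, hle a⟩, ⟨D.size ⟨a, hle a⟩ - 1, Nat.sub_lt (D.size_pos _) one_pos⟩⟩ with hb
    have hbX : ∀ a, (x - D.lam • (1 : End F V)) (b a) = 0 := by
      intro a
      have := D.size_pos ⟨a, hle a⟩
      rw [hb]
      simp only [D.fullBasis_apply]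
      rw [← hD ⟨a, hle a⟩, D.sub_apply_basis, dif_neg (by simp only; omega)]
    have hbd : ∀ a, ∃ w, ((x - D.lam • (1 : End F V)) ^ (D.size i - 1)) w = b a := by
      intro a
      have h1 := D.size_pos ⟨a, hle a⟩
      have h2 : D.size i ≤ D.size ⟨a, hle a⟩ := D.size_antitone (by
        rw [Fin.le_def]; simp only; omega)
      refine ⟨D.basis ⟨a, hle a⟩ ⟨D.size ⟨a, hle a⟩ - D.size i, ?_⟩, ?_⟩
      · have := D.size_pos i; omega
      · have := D.size_pos i
        rw [← hD ⟨a, hle a⟩, D.sub_pow_basis, dif_pos (by simp only; omega), hb]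
        simp only [D.fullBasis_apply]
        congr 2
        apply Fin.ext
        simp only; omega
    set f : V →ₗ[F] Torsion F m := Q.toLinearMap.restrictScalars F ∘ₗ
      φ.1.restrictScalars F ∘ₗ (AEval'.of (x - D.lam • (1 : End F V))).toLinearMap with hf
    have hfX : ∀ v, f ((x - D.lam • (1 : End F V)) v) = (Polynomial.X : Polynomial F) • f v := by
      intro v
      change Q (φ.1 (AEval'.of _ _)) = _ • Q (φ.1 (AEval'.of _ _))
      rw [← map_smul, ← map_smul]
      rw [AEval'.X_smul_of]
      rfl
    have hfXp : ∀ (r : ℕ) v, f (((x - D.lam • (1 : End F V)) ^ r) v) =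
        (Polynomial.X : Polynomial F) ^ r • f v := by
      intro r
      induction r with
      | zero => simp
      | succ r ih =>
        intro v
        rw [pow_succ', Module.End.mul_apply, hfX, ih, smul_smul, pow_succ']
    have hfi : Function.Injective f := by
      intro v w h
      exact (AEval'.of _).injective (φ.2.1 (Q.injective h))
    refine lt_of_linearIndependent_torsion m ?_ ?_ (fun a => f (b a)) ?_ ?_ ?_
    · intro i'
      have := lt_min_iff.mp i'.2
      simp only [hm]; omega
    · intro i' j' hij
      have : (i' : ℕ) ≤ j' := hij
      simp only [hm]; omega
    · refine LinearIndependent.map' ?_ f (LinearMap.ker_eq_bot.mpr hfi)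
      refine D.fullBasis.linearIndependent.comp _ ?_
      intro a a' haa
      have := congrArg (fun s => (s.1 : ℕ)) haa
      exact Fin.ext this
    · intro a
      rw [← hfX, hbX, map_zero]
    · intro a
      obtain ⟨w, hw⟩ := hbd a
      exact ⟨f w, by rw [← hfXp, hw]⟩
  refine ⟨⟨hD, fun i => ?_⟩, ?_⟩
  · obtain ⟨h1, h3⟩ := key i
    have := lt_min_iff.mp h1
    have := D.size_pos i
    simp only [hm] at h3
    omega
  · have he : 0 < e := Nat.pos_of_ne_zero (NeZero.ne e)
    obtain ⟨h1, -⟩ := key ⟨e - 1, by omega⟩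
    simp only at h1
    omega

/-- Transport along isomorphisms with the abstract modules. -/
noncomputable def monoEquivAbstract {s : ℕ} {m : Fin s → ℕ}
    (P : D.polyV ≃ₗ[Polynomial F] Torsion F D.size)
    (Q : D.polyM α k ≃ₗ[Polynomial F] Torsion F m)
    (hP : P (AEval'.of _ D.v₀) = inFirst _ 1)
    (hQ : Q (AEval'.of _ (cornerHat X)) = inFirst _ 1) :
    D.Mono α k X ≃ AbstractMono F D.size m where
  toFun φ := ⟨Q.toLinearMap ∘ₗ φ.1 ∘ₗ P.symm.toLinearMap,
    Q.injective.comp (φ.2.1.comp P.symm.injective), fun p => by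
      rw [inFirst_eq_smul, map_smul, inFirst_eq_smul m p]
      congr 1
      change Q (φ.1 (P.symm _)) = _
      rw [← hP, LinearEquiv.symm_apply_apply, φ.2.2, hQ]⟩
  invFun f := ⟨Q.symm.toLinearMap ∘ₗ f.1 ∘ₗ P.toLinearMap,
    Q.symm.injective.comp (f.2.1.comp P.injective), by
      change Q.symm (f.1 (P _)) = _
      rw [hP, f.2.2, ← hQ, LinearEquiv.symm_apply_apply]⟩
  left_inv φ := by
    apply Subtype.ext
    ext v
    change Q.symm (Q (φ.1 (P.symm (P v)))) = φ.1 v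
    rw [LinearEquiv.symm_apply_apply, LinearEquiv.symm_apply_apply]
  right_inv f := by
    apply Subtype.ext
    apply LinearMap.ext
    intro v
    change Q (Q.symm (f.1 (P (P.symm v)))) = f.1 v
    rw [LinearEquiv.apply_symm_apply, LinearEquiv.apply_symm_apply]

/-- An isomorphism between two extensions is an endomorphism of `R_{α,k,X}`, hence a scalar. -/
theorem extension_repX_iso_iff (hlam : D.lam ≠ 0) (hk : 1 < k) (hkn : k < D.n)
    (R S : D.Extension (D.repX α k X)) :
    IsIsomorphic
      (R.1 : Alg x →ₗ[F] Matrix (Fin k ⊕ Fin (D.n + 1 - k)) (Fin k ⊕ Fin (D.n + 1 - k)) F)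
      (S.1 : Alg x →ₗ[F] Matrix (Fin k ⊕ Fin (D.n + 1 - k)) (Fin k ⊕ Fin (D.n + 1 - k)) F) ↔
      R = S := by
  constructor
  · intro h
    obtain ⟨P, P', h1, -, h3⟩ := h.exists_matrix
    have hR := (D.restrict_eq_linearRep_iff _ _ _).mp R.2.2.2
    have hS := (D.restrict_eq_linearRep_iff _ _ _).mp S.2.2.2
    have hg := h3 (gen x)
    have hv := h3 (ofV x D.v₀)
    simp only [LieHom.coe_toLinearMap] at hg hv h3
    rw [hR.1, hS.1] at hg
    rw [hR.2, hS.2] at hv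
    obtain ⟨c, rfl, -⟩ := corner_intertwiner_scalar hlam hk.le hkn.le hg hv
    have hc : c ≠ 0 := by
      rintro rfl
      rw [zero_smul, Matrix.zero_mul] at h1
      have := congrFun (congrFun h1 (Sum.inl ⟨0, by omega⟩)) (Sum.inl ⟨0, by omega⟩)
      simp at this
    apply Subtype.ext
    ext1 y
    have := h3 y
    rw [Matrix.smul_mul, Matrix.one_mul, Matrix.mul_smul, Matrix.mul_one] at this
    exact smul_right_injective _ hc this
  · rintro rfl
    exact ⟨LinearEquiv.refl _ _, fun _ _ => rfl⟩

/-- The triple `(α, k, X)` is determined by the isomorphism class of `R_{α,k,X}`. -/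
theorem repX_unique (hlam : D.lam ≠ 0) (h2 : (2 : F) ≠ 0) (hk : 1 ≤ k) (hkn : k ≤ D.n)
    {β : F} {l : ℕ} {Y : Matrix (Fin (l - 1)) (Fin (D.n - l)) F} (hl : 1 ≤ l)
    (h : IsIsomorphic (D.repX α k X) (D.repX β l Y)) : β = α ∧ l = k ∧ HEq Y X := by
  obtain ⟨P, P', h1, h1', hA, hE⟩ := D.exists_matrix_of_linearRep h
  have hαβ : α = β := by
    by_contra hne
    obtain ⟨P₁, P₁₂, P₂₁, P₂, rfl⟩ : ∃ A B C D, P = Matrix.fromBlocks A B C D :=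
      ⟨_, _, _, _, (Matrix.fromBlocks_toBlocks P).symm⟩
    simp only [twoBlocks, Matrix.fromBlocks_multiply, Matrix.fromBlocks_inj, Matrix.mul_zero,
      Matrix.zero_mul, add_zero, zero_add] at hA
    obtain ⟨a1, a2, a3, a4⟩ := hA
    have e1 : P₁ = 0 := eq_zero_of_upperJordan_intertwine (Ne.symm hne) a1.symm
    have e2 : β = α - D.lam := by
      by_contra hne'
      have e2 : P₁₂ = 0 := eq_zero_of_upperJordan_intertwine hne' a2.symm
      have := congrFun (congrFun h1 (Sum.inl ⟨0, by omega⟩)) (Sum.inl ⟨0, by omega⟩)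
      rw [e1, e2, Matrix.mul_apply] at this
      simp at this
    have e3 : β - D.lam = α := by
      by_contra hne'
      have e3 : P₂₁ = 0 := eq_zero_of_upperJordan_intertwine hne' a3.symm
      have := congrFun (congrFun h1' (Sum.inl ⟨0, by omega⟩)) (Sum.inl ⟨0, by omega⟩)
      rw [e1, e3, Matrix.mul_apply] at this
      simp at this
    apply mul_ne_zero h2 hlam
    linear_combination -e3 + e2
  subst hαβ
  have hA' : P' * twoBlocks l (D.n + 1 - l) α D.lam =
      twoBlocks k (D.n + 1 - k) α D.lam * P' := by
    calc P' * twoBlocks l (D.n + 1 - l) α D.lam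
        = P' * (twoBlocks l (D.n + 1 - l) α D.lam * P) * P' := by
          rw [Matrix.mul_assoc, Matrix.mul_assoc _ P, h1, Matrix.mul_one]
      _ = twoBlocks k (D.n + 1 - k) α D.lam * P' := by
          rw [← hA, ← Matrix.mul_assoc, h1', Matrix.one_mul]
  have hlk : l = k := by
    obtain ⟨P₁, P₂, rfl, -⟩ := twoBlocks_intertwine hlam hA
    obtain ⟨P₁', P₂', rfl, -⟩ := twoBlocks_intertwine hlam hA'
    rw [Matrix.fromBlocks_multiply, ← Matrix.fromBlocks_one, Matrix.fromBlocks_inj] at h1 h1'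
    have b1 : P₁ * P₁' = 1 := by simpa using h1.1
    have b2 : P₁' * P₁ = 1 := by simpa using h1'.1
    have := (Matrix.toLin'OfInv b1 b2).finrank_eq
    simpa using this
  subst hlk
  obtain ⟨c, rfl, hc⟩ := corner_intertwiner_scalar hlam hk hkn hA hE
  refine ⟨rfl, rfl, heq_of_eq ?_⟩
  by_cases h0 : c = 0
  · rw [h0, zero_smul, Matrix.zero_mul] at h1
    have := congrFun (congrFun h1 (Sum.inl ⟨0, by omega⟩)) (Sum.inl ⟨0, by omega⟩)
    simp at this
  · exact (smul_right_injective _ h0 hc).symm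

end JordanDecomposition
end TwoBlocks
end UniserialSolvable

namespace UniserialSolvable

variable {F : Type*} [Field F]

/-! ### Extensions of `R_{α,a}` -/

/-- The matrix with block rows `(0, b, β)`, `(0, 0, c)`, `(0, 0, 0)`. -/
def stripMatrix {n : ℕ} (b c : Fin n → F) (β : F) : Matrix (Idx n) (Idx n) F :=
  Matrix.fromBlocks 0 (Matrix.fromCols (Matrix.of fun _ j => b j) (Matrix.of fun _ _ => β)) 0
    (Matrix.fromBlocks 0 (Matrix.of fun i _ => c i) 0 0)

section Strip

variable {n : ℕ} (b c : Fin n → F) (β : F)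

@[simp]
theorem stripMatrix_inl_inl (i j : Fin 1) :
    stripMatrix b c β (Sum.inl i) (Sum.inl j) = 0 := rfl

@[simp]
theorem stripMatrix_row (i : Fin 1) (j : Fin n) :
    stripMatrix b c β (Sum.inl i) (Sum.inr (Sum.inl j)) = b j := rfl

@[simp]
theorem stripMatrix_corner (i j : Fin 1) :
    stripMatrix b c β (Sum.inl i) (Sum.inr (Sum.inr j)) = β := rfl

@[simp]
theorem stripMatrix_inr_inl (i : Fin n ⊕ Fin 1) (j : Fin 1) :
    stripMatrix b c β (Sum.inr i) (Sum.inl j) = 0 := rfl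

@[simp]
theorem stripMatrix_inr_inr_inl (i : Fin n ⊕ Fin 1) (j : Fin n) :
    stripMatrix b c β (Sum.inr i) (Sum.inr (Sum.inl j)) = 0 := by
  rcases i with i | i <;> rfl

@[simp]
theorem stripMatrix_col (i : Fin n) (j : Fin 1) :
    stripMatrix b c β (Sum.inr (Sum.inl i)) (Sum.inr (Sum.inr j)) = c i := rfl

@[simp]
theorem stripMatrix_inr_inr_inr (i j : Fin 1) :
    stripMatrix b c β (Sum.inr (Sum.inr i)) (Sum.inr (Sum.inr j)) = 0 := rfl

theorem rowColumn_eq_stripMatrix (a : Fin n → F) :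
    rowColumn a = stripMatrix a (fun i => if (i : ℕ) + 1 = n then 1 else 0) 0 := by
  ext i j
  rcases i with i | i | i <;> rcases j with j | j | j <;> simp

theorem single_eq_stripMatrix :
    β • (Matrix.single (Sum.inl 0) (Sum.inr (Sum.inr 0)) 1 : Matrix (Idx n) (Idx n) F) =
      stripMatrix 0 0 β := by
  ext i j
  rcases i with i | i | i <;> rcases j with j | j | j <;> simp [Matrix.single_apply]
  intro h
  exact absurd (Subsingleton.elim _ _) (h (Subsingleton.elim _ _))

theorem stripMatrix_mul (b' c' : Fin n → F) (β' : F) :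
    stripMatrix b c β * stripMatrix b' c' β' = stripMatrix 0 0 (∑ j, b j * c' j) := by
  ext i j
  rw [Matrix.mul_apply, Fintype.sum_sum_type, Fintype.sum_sum_type]
  rcases i with i | i | i <;> rcases j with j | j | j <;> simp

theorem adSub_stripMatrix (α lam : F) :
    adSub (threeBlocks n α lam) lam (stripMatrix b c β) = stripMatrix
      (fun j => if 0 < (j : ℕ) then - b ⟨j - 1, by omega⟩ else 0)
      (fun i => if h : (i : ℕ) + 1 < n then c ⟨i + 1, h⟩ else 0) (lam * β) := by
  have e : adSub (threeBlocks n α lam) lam (stripMatrix b c β) = Matrix.fromBlocks 0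
      (Matrix.fromCols
        (α • (Matrix.of fun _ j => b j) -
          (Matrix.of fun (_ : Fin 1) j => b j) * upperJordan n (α - lam) -
          lam • (Matrix.of fun _ j => b j))
        (Matrix.of fun _ _ => lam * β)) 0
      (Matrix.fromBlocks 0 (upperJordan n (α - lam) * (Matrix.of fun i (_ : Fin 1) => c i) -
        (α - 2 * lam) • (Matrix.of fun i _ => c i) - lam • (Matrix.of fun i _ => c i)) 0 0) := by
    have h1 : ∀ γ : F, upperJordan 1 γ = γ • (1 : Matrix (Fin 1) (Fin 1) F) := by
      intro γ
      ext i j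
      rw [Subsingleton.elim i j]
      simp [upperJordan]
    rw [adSub_apply, threeBlocks, stripMatrix, h1, h1]
    simp only [Matrix.fromBlocks_multiply, Matrix.fromBlocks_smul, sub_eq_add_neg,
      Matrix.fromBlocks_neg, Matrix.fromBlocks_add, Matrix.smul_mul, Matrix.mul_smul,
      Matrix.one_mul, Matrix.mul_one, Matrix.zero_mul, Matrix.mul_zero]
    ext i j
    rcases i with i | i | i <;> rcases j with j | j | j <;>
      simp [Matrix.fromBlocks, Matrix.mul_apply, Matrix.fromCols]
    rw [Subsingleton.elim j 0, Matrix.one_apply_eq]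
    ring
  rw [e]
  ext i j
  rcases i with i | i | i <;> rcases j with j | j | j <;>
    simp [Matrix.fromCols, Matrix.fromBlocks, mul_upperJordan_apply, upperJordan_mul_apply]
  · split_ifs <;> ring
  · split_ifs <;> ring

/-- The powers of `ad B - λ 1` on the matrix `(0, a, 0), (0, 0, e_n), (0, 0, 0)` shift `a`, with
alternating signs, and `e_n`. -/
theorem adSub_pow_rowColumn (a : Fin n → F) (α lam : F) (l : ℕ) :
    (adSub (threeBlocks n α lam) lam ^ l) (rowColumn a) = stripMatrix
      (fun j => if l ≤ (j : ℕ) then (-1) ^ l * a ⟨j - l, by omega⟩ else 0)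
      (fun i => if (i : ℕ) + l + 1 = n then 1 else 0) 0 := by
  induction l with
  | zero => simp [rowColumn_eq_stripMatrix]
  | succ l ih =>
    rw [pow_succ', Module.End.mul_apply, ih, adSub_stripMatrix, mul_zero]
    congr 1
    · funext j
      by_cases h : l + 1 ≤ (j : ℕ)
      · rw [if_pos (by omega), if_pos (by simp only; omega), if_pos h, pow_succ]
        have : (⟨(j : ℕ) - 1 - l, by omega⟩ : Fin n) = ⟨j - (l + 1), by omega⟩ :=
          Fin.ext (by simp only; omega)
        rw [this]
        ring
      · rw [if_neg h]
        split_ifs with h1 h2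
        · simp only at h2; omega
        · exact neg_zero
        · rfl
    · funext i
      by_cases h : (i : ℕ) + 1 < n
      · rw [dif_pos h]
        refine if_congr ?_ rfl rfl
        simp only; omega
      · rw [dif_neg h, if_neg (by omega)]

/-- The commutators vanish because `n` is odd and the entries of `a` at even positions vanish. -/
theorem adSub_pow_rowColumn_comm (hn : Odd n) {a : Fin n → F} (ha : IsAdmissible a) (α lam : F)
    (l m : ℕ) :
    (adSub (threeBlocks n α lam) lam ^ l) (rowColumn a) *
        (adSub (threeBlocks n α lam) lam ^ m) (rowColumn a) =
      (adSub (threeBlocks n α lam) lam ^ m) (rowColumn a) *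
        (adSub (threeBlocks n α lam) lam ^ l) (rowColumn a) := by
  have key : ∀ l m : ℕ, (∑ j : Fin n, (if l ≤ (j : ℕ) then (-1) ^ l * a ⟨j - l, by omega⟩ else 0) *
      (if (j : ℕ) + m + 1 = n then 1 else 0)) =
      if h : l + m + 1 ≤ n then (-1) ^ l * a ⟨n - 1 - m - l, by omega⟩ else 0 := by
    intro l m
    by_cases h : m + 1 ≤ n
    · rw [Finset.sum_eq_single ⟨n - 1 - m, by omega⟩]
      · rw [if_pos (c := _ + m + 1 = n) (by simp only; omega), mul_one]
        by_cases h' : l + m + 1 ≤ n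
        · rw [if_pos (by simp only; omega), dif_pos h']
        · rw [if_neg (by simp only; omega), dif_neg h']
      · intro b _ hb
        rw [if_neg (c := _ + m + 1 = n), mul_zero]
        intro hb'
        exact hb (Fin.ext (by simp only; omega))
      · simp
    · rw [dif_neg (by omega)]
      refine Finset.sum_eq_zero fun j _ => ?_
      rw [if_neg (c := _ + m + 1 = n) (by omega), mul_zero]
  rw [adSub_pow_rowColumn, adSub_pow_rowColumn, stripMatrix_mul, stripMatrix_mul, key, key]
  congr 1
  by_cases h : l + m + 1 ≤ n
  · rw [dif_pos h, dif_pos (by omega)]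
    have h1 : (⟨n - 1 - m - l, by omega⟩ : Fin n) = ⟨n - 1 - l - m, by omega⟩ :=
      Fin.ext (by simp only; omega)
    rw [h1]
    rcases Nat.even_or_odd (l + m) with he | ho
    · congr 1
      rw [neg_one_pow_eq_pow_mod_two l, neg_one_pow_eq_pow_mod_two m]
      congr 1
      obtain ⟨r, hr⟩ := he
      omega
    · rw [ha.2 ⟨n - 1 - l - m, by omega⟩ (by
        obtain ⟨r, hr⟩ := hn
        obtain ⟨t, ht⟩ := ho
        exact ⟨r - t, by simp only; omega⟩), mul_zero, mul_zero]
  · rw [dif_neg h, dif_neg (by omega)]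

end Strip

/-- The eigenvectors of `ad B` with eigenvalue `2λ` are the multiples of `E^{1,n+2}`. -/
theorem eq_single_of_ad_threeBlocks {n : ℕ} {α lam : F} (hlam : lam ≠ 0) (h2 : (2 : F) ≠ 0)
    (h3 : (3 : F) ≠ 0) {M : Matrix (Idx n) (Idx n) F}
    (h : threeBlocks n α lam * M - M * threeBlocks n α lam = (2 * lam) • M) :
    M = M (Sum.inl 0) (Sum.inr (Sum.inr 0)) •
      Matrix.single (Sum.inl 0) (Sum.inr (Sum.inr 0)) 1 := by
  obtain ⟨M₁, Q, R, S, rfl⟩ : ∃ A B C D, M = Matrix.fromBlocks A B C D :=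
    ⟨_, _, _, _, (Matrix.fromBlocks_toBlocks M).symm⟩
  obtain ⟨M₂, M₂₃, M₃₂, M₃, rfl⟩ : ∃ A B C D, S = Matrix.fromBlocks A B C D :=
    ⟨_, _, _, _, (Matrix.fromBlocks_toBlocks S).symm⟩
  obtain ⟨Q₁, Q₂, rfl⟩ : ∃ A B, Q = Matrix.fromCols A B :=
    ⟨_, _, (Matrix.fromCols_toCols Q).symm⟩
  obtain ⟨R₁, R₂, rfl⟩ : ∃ A B, R = Matrix.fromRows A B :=
    ⟨_, _, (Matrix.fromRows_toRows R).symm⟩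
  rw [sub_eq_iff_eq_add] at h
  simp only [threeBlocks, Matrix.fromBlocks_multiply, Matrix.fromBlocks_inj,
    Matrix.fromCols_mul_fromBlocks, Matrix.fromBlocks_mul_fromRows, Matrix.mul_zero,
    Matrix.zero_mul, add_zero, zero_add, Matrix.mul_fromCols, Matrix.fromRows_mul,
    Matrix.fromBlocks_smul, Matrix.fromBlocks_add] at h
  obtain ⟨h1, hq, hr, h22, h23, h32, h33⟩ := h
  have hq' : upperJordan 1 α * Q₁ = (2 * lam) • Q₁ + Q₁ * upperJordan n (α - lam) := by
    ext i j; exact congrFun (congrFun hq i) (Sum.inl j)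
  have hr' : upperJordan n (α - lam) * R₁ = (2 * lam) • R₁ + R₁ * upperJordan 1 α := by
    ext i j; exact congrFun (congrFun hr (Sum.inl i)) j
  have hr'' : upperJordan 1 (α - 2 * lam) * R₂ = (2 * lam) • R₂ + R₂ * upperJordan 1 α := by
    ext i j; exact congrFun (congrFun hr (Sum.inr i)) j
  have ne : ∀ r : F, r ≠ 0 → r * lam ≠ 0 := fun r hr => mul_ne_zero hr hlam
  have e0 : M₁ = 0 := eq_zero_of_upperJordan_sylvester
    (by intro h'; apply ne 2 h2; linear_combination -h' : α - α ≠ 2 * lam) (sub_eq_of_eq_add h1)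
  have e1 : Q₁ = 0 := eq_zero_of_upperJordan_sylvester
    (by intro h'; apply hlam; linear_combination -h' : α - (α - lam) ≠ 2 * lam)
    (sub_eq_of_eq_add hq')
  have e3 : R₁ = 0 := eq_zero_of_upperJordan_sylvester
    (by intro h'; apply ne 3 h3; linear_combination -h' : α - lam - α ≠ 2 * lam)
    (sub_eq_of_eq_add hr')
  have e4 : R₂ = 0 := eq_zero_of_upperJordan_sylvester
    (by intro h'; apply mul_ne_zero h2 (ne 2 h2); linear_combination -h' :
      α - 2 * lam - α ≠ 2 * lam) (sub_eq_of_eq_add hr'')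
  have e5 : M₂ = 0 := eq_zero_of_upperJordan_sylvester
    (by intro h'; apply ne 2 h2; linear_combination -h' : α - lam - (α - lam) ≠ 2 * lam)
    (sub_eq_of_eq_add h22)
  have e6 : M₂₃ = 0 := eq_zero_of_upperJordan_sylvester
    (by intro h'; apply hlam; linear_combination -h' : α - lam - (α - 2 * lam) ≠ 2 * lam)
    (sub_eq_of_eq_add h23)
  have e7 : M₃₂ = 0 := eq_zero_of_upperJordan_sylvester
    (by intro h'; apply ne 3 h3; linear_combination -h' : α - 2 * lam - (α - lam) ≠ 2 * lam)
    (sub_eq_of_eq_add h32)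
  have e8 : M₃ = 0 := eq_zero_of_upperJordan_sylvester
    (by intro h'; apply ne 2 h2; linear_combination -h' :
      α - 2 * lam - (α - 2 * lam) ≠ 2 * lam) (sub_eq_of_eq_add h33)
  rw [single_eq_stripMatrix, e0, e1, e3, e4, e5, e6, e7, e8, Matrix.fromRows_zero]
  ext i j
  rcases i with i | i | i <;> rcases j with j | j | j <;>
    simp [Matrix.fromBlocks, Matrix.fromCols]
  rw [Subsingleton.elim i 0, Subsingleton.elim j 0]

/-- The trace distinguishes the parameters `α` of isomorphic representations `R_{α,a}`. -/
theorem trace_threeBlocks (n : ℕ) (α lam : F) :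
    (threeBlocks n α lam).trace = α + (n * (α - lam) + (α - 2 * lam)) := by
  have h : ∀ (p : ℕ) (β : F), (upperJordan p β).trace = p * β := by
    intro p β
    simp [Matrix.trace, upperJordan]
  have h1 := h 1 α
  have h2 := h n (α - lam)
  have h3 := h 1 (α - 2 * lam)
  simp only [Matrix.trace, Matrix.diag] at h1 h2 h3
  rw [Matrix.trace, Fintype.sum_sum_type, Fintype.sum_sum_type]
  change ∑ i, upperJordan 1 α i i + (∑ i, upperJordan n (α - lam) i i +
    ∑ i, upperJordan 1 (α - 2 * lam) i i) = _
  rw [h1, h2, h3]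
  simp

section Two

variable {V : Type*} [LieRing V] [LieAlgebra F V] [IsLieAbelian V]
variable {x : End F V} {e : ℕ} [NeZero e]

namespace JordanDecomposition

variable (D : JordanDecomposition x e) {α : F} {a : Fin D.n → F}

/-- The pair `(α, a)` is determined by the isomorphism class of `R_{α,a}`. -/
theorem repA_unique [CharZero F] (hlam : D.lam ≠ 0) {β : F} {b : Fin D.n → F}
    (ha : IsAdmissible a) (hb : IsAdmissible b) (h : IsIsomorphic (D.repA α a) (D.repA β b)) :
    β = α ∧ b = a := by
  obtain ⟨P, P', h1, h1', hA, hE⟩ := D.exists_matrix_of_linearRep h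
  have ht : (threeBlocks D.n α D.lam).trace = (threeBlocks D.n β D.lam).trace := by
    calc (threeBlocks D.n α D.lam).trace = (P' * (P * threeBlocks D.n α D.lam)).trace := by
          rw [← Matrix.mul_assoc, h1', Matrix.one_mul]
      _ = (threeBlocks D.n β D.lam).trace := by
          rw [hA, Matrix.trace_mul_comm, Matrix.mul_assoc, h1, Matrix.mul_one]
  rw [trace_threeBlocks, trace_threeBlocks] at ht
  have hβ : β = α := by
    have h2 : ((D.n : F) + 2) ≠ 0 := by exact_mod_cast (by omega : D.n + 2 ≠ 0)
    have : ((D.n : F) + 2) * (β - α) = 0 := by linear_combination -ht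
    exact sub_eq_zero.mp ((mul_eq_zero.mp this).resolve_left h2)
  subst hβ
  obtain ⟨c, rfl, hc⟩ := rowColumn_intertwiner_scalar hlam two_ne_zero (D.size_pos 0) ha hb hA hE
  refine ⟨rfl, ?_⟩
  by_cases h0 : c = 0
  · rw [h0, zero_smul, Matrix.zero_mul] at h1
    have := congrFun (congrFun h1 (Sum.inl 0)) (Sum.inl 0)
    simp at this
  · exact (smul_right_injective _ h0 hc).symm

/-- An isomorphism between two extensions is an endomorphism of `R_{α,a}`, hence a scalar. -/
theorem extension_repA_iso_iff (hlam : D.lam ≠ 0) (h2 : (2 : F) ≠ 0) (ha : IsAdmissible a)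
    (R S : D.Extension (D.repA α a)) :
    IsIsomorphic (R.1 : Alg x →ₗ[F] Matrix (Idx D.n) (Idx D.n) F)
      (S.1 : Alg x →ₗ[F] Matrix (Idx D.n) (Idx D.n) F) ↔ R = S := by
  constructor
  · intro h
    obtain ⟨P, P', h1, -, h3⟩ := h.exists_matrix
    have hR := (D.restrict_eq_linearRep_iff _ _ _).mp R.2.2.2
    have hS := (D.restrict_eq_linearRep_iff _ _ _).mp S.2.2.2
    have hg := h3 (gen x)
    have hv := h3 (ofV x D.v₀)
    simp only [LieHom.coe_toLinearMap] at hg hv h3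
    rw [hR.1, hS.1] at hg
    rw [hR.2, hS.2] at hv
    obtain ⟨c, rfl, -⟩ := rowColumn_intertwiner_scalar hlam h2 (D.size_pos 0) ha ha hg hv
    have hc : c ≠ 0 := by
      rintro rfl
      rw [zero_smul, Matrix.zero_mul] at h1
      have := congrFun (congrFun h1 (Sum.inl 0)) (Sum.inl 0)
      simp at this
    apply Subtype.ext
    ext1 y
    have := h3 y
    rw [Matrix.smul_mul, Matrix.one_mul, Matrix.mul_smul, Matrix.mul_one] at this
    exact smul_right_injective _ hc this
  · rintro rfl
    exact ⟨LinearEquiv.refl _ _, fun _ _ => rfl⟩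

variable {D} in
theorem IsTypeTwo.eq_of_ne_zero (hD : D.IsTypeTwo) {i j : Fin e} (hi : i ≠ 0) (hj : j ≠ 0) :
    i = j := by
  have he := hD.1
  have hi' := Fin.pos_iff_ne_zero.mpr hi
  have hj' := Fin.pos_iff_ne_zero.mpr hj
  rw [Fin.lt_def] at hi' hj'
  exact Fin.ext (by omega)

variable {D} in
theorem IsTypeTwo.apply_eq (hD : D.IsTypeTwo) {i : Fin e} (hi : i ≠ 0) {w : V}
    (hw : w ∈ D.block i) : x w = (2 * D.lam) • w := by
  have h := D.sub_pow_of_mem i hw (hD.2 i hi).1.le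
  rw [pow_one, LinearMap.sub_apply, sub_eq_zero, (hD.2 i hi).2] at h
  exact h

variable {D} in
theorem IsTypeTwo.exists_smul_eq (hD : D.IsTypeTwo) {i : Fin e} (hi : i ≠ 0) {v w : V}
    (hv : v ∈ D.block i) (hv0 : v ≠ 0) (hw : w ∈ D.block i) : ∃ c : F, w = c • v := by
  have h1 : finrank F (D.block i) = 1 := by
    rw [Module.finrank_eq_card_basis (D.basis i), Fintype.card_fin, (hD.2 i hi).1]
  obtain ⟨c, hc⟩ := (finrank_eq_one_iff_of_nonzero' (⟨v, hv⟩ : D.block i)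
    (fun h => hv0 (congrArg Subtype.val h))).mp h1 ⟨w, hw⟩
  exact ⟨c, (congrArg Subtype.val hc).symm⟩

/-- The values of the extension of `R_{α,a}` that takes the value `β E^{1,n+2}` on the second
block. -/
noncomputable def stripLin (α : F) (a : Fin D.n → F) (β : F) :
    V →ₗ[F] Matrix (Idx D.n) (Idx D.n) F :=
  D.fullBasis.constr F fun s => if s.1 = 0 then
    (adSub (threeBlocks D.n α D.lam) D.lam ^ (s.2 : ℕ)) (rowColumn a) else stripMatrix 0 0 β

theorem stripLin_basis_zero (β : F) (l : Fin D.n) :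
    D.stripLin α a β (D.basis 0 l) =
      (adSub (threeBlocks D.n α D.lam) D.lam ^ (l : ℕ)) (rowColumn a) := by
  have := D.fullBasis.constr_basis F (fun s => if s.1 = 0 then
    (adSub (threeBlocks D.n α D.lam) D.lam ^ (s.2 : ℕ)) (rowColumn a) else stripMatrix 0 0 β) ⟨0, l⟩
  rwa [D.fullBasis_apply] at this

theorem stripLin_basis_ne_zero (β : F) {i : Fin e} (hi : i ≠ 0) (l : Fin (D.size i)) :
    D.stripLin α a β (D.basis i l) = stripMatrix 0 0 β := by
  have := D.fullBasis.constr_basis F (fun s => if s.1 = 0 then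
    (adSub (threeBlocks D.n α D.lam) D.lam ^ (s.2 : ℕ)) (rowColumn a) else stripMatrix 0 0 β) ⟨i, l⟩
  rw [D.fullBasis_apply, if_neg hi] at this
  exact this

theorem stripLin_comm (hn : Odd D.n) (ha : IsAdmissible a) (β : F) (v w : V) :
    D.stripLin α a β v * D.stripLin α a β w = D.stripLin α a β w * D.stripLin α a β v := by
  have key : ((LinearMap.mul F (Matrix (Idx D.n) (Idx D.n) F)).compl₁₂
      (D.stripLin α a β) (D.stripLin α a β)) =
      ((LinearMap.mul F (Matrix (Idx D.n) (Idx D.n) F)).flip.compl₁₂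
      (D.stripLin α a β) (D.stripLin α a β)) := by
    refine LinearMap.ext_basis D.fullBasis D.fullBasis fun s t => ?_
    simp only [LinearMap.compl₁₂_apply, LinearMap.flip_apply, LinearMap.mul_apply',
      D.fullBasis_apply]
    obtain ⟨i, l⟩ := s
    obtain ⟨j, m⟩ := t
    by_cases hi : i = 0 <;> by_cases hj : j = 0
    · subst hi hj
      simp only [D.stripLin_basis_zero]
      exact adSub_pow_rowColumn_comm hn ha α D.lam l m
    · subst hi
      simp only [D.stripLin_basis_zero, D.stripLin_basis_ne_zero β hj, adSub_pow_rowColumn,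
        stripMatrix_mul]
      simp
    · subst hj
      simp only [D.stripLin_basis_zero, D.stripLin_basis_ne_zero β hi, adSub_pow_rowColumn,
        stripMatrix_mul]
      simp
    · simp only [D.stripLin_basis_ne_zero β hj, D.stripLin_basis_ne_zero β hi]
  exact LinearMap.congr_fun₂ key v w

/-- On the first block this holds by construction of `v_l` and because the `n`-th power of
`ad B - λ 1` annihilates the matrix of `v_0`; on the second block both sides are `2λβ E^{1,n+2}`. -/
theorem stripLin_lie (hD : D.IsTypeTwo) (β : F) (v : V) :
    threeBlocks D.n α D.lam * D.stripLin α a β v - D.stripLin α a β v * threeBlocks D.n α D.lam =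
      D.stripLin α a β (x v) := by
  have hsub : ∀ (M : Matrix (Idx D.n) (Idx D.n) F), threeBlocks D.n α D.lam * M -
      M * threeBlocks D.n α D.lam = adSub (threeBlocks D.n α D.lam) D.lam M + D.lam • M := by
    intro M
    rw [adSub_apply, sub_add_cancel]
  have key : (LinearMap.mulLeft F (threeBlocks D.n α D.lam) -
      LinearMap.mulRight F (threeBlocks D.n α D.lam)) ∘ₗ D.stripLin α a β =
      D.stripLin α a β ∘ₗ x := by
    refine D.fullBasis.ext fun s => ?_
    rw [LinearMap.comp_apply, LinearMap.comp_apply, LinearMap.sub_apply, LinearMap.mulLeft_apply,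
      LinearMap.mulRight_apply, D.fullBasis_apply]
    obtain ⟨i, l⟩ := s
    by_cases hi : i = 0
    · subst hi
      have h1 := D.sub_apply_basis 0 l
      rw [LinearMap.sub_apply, sub_eq_iff_eq_add] at h1
      rw [hsub, h1, map_add, LinearMap.smul_apply, map_smul, Module.End.one_apply]
      simp only [D.stripLin_basis_zero]
      congr 1
      rw [← Module.End.mul_apply, ← pow_succ']
      by_cases h : (l : ℕ) + 1 < D.size 0
      · rw [dif_pos h, D.stripLin_basis_zero]
      · rw [dif_neg h, map_zero, adSub_pow_rowColumn]
        have hl : (l : ℕ) < D.n := l.2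
        have hl' : ¬ (l : ℕ) + 1 < D.n := h
        ext i j
        rcases i with i | i | i <;> rcases j with j | j | j <;> simp <;> omega
    · simp only
      rw [hD.apply_eq hi (Subtype.mem _), map_smul, D.stripLin_basis_ne_zero β hi, hsub,
        adSub_stripMatrix]
      ext i j
      rcases i with i | i | i <;> rcases j with j | j | j <;> simp
      ring
  exact LinearMap.congr_fun key v

theorem stripLin_apply (β : F) (v : V) : D.stripLin α a β v =
    ∑ s, D.fullBasis.repr v s • (if s.1 = 0 then
    (adSub (threeBlocks D.n α D.lam) D.lam ^ (s.2 : ℕ)) (rowColumn a) else stripMatrix 0 0 β) := by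
  rw [stripLin, Basis.constr_apply_fintype]
  rfl

/-- The coordinates of `v` in the first block are found in the last column of its image. -/
theorem stripLin_injective (hD : D.IsTypeTwo) {β : F} (hβ : β ≠ 0) {v : V}
    (hv : D.stripLin α a β v = 0) : v = 0 := by
  have h0 : ∀ l : Fin D.n, D.fullBasis.repr v ⟨0, l⟩ = 0 := by
    intro l
    have hl : (l : ℕ) < D.n := l.2
    have h := congrFun (congrFun hv (Sum.inr (Sum.inl ⟨D.n - 1 - l, by omega⟩)))
      (Sum.inr (Sum.inr 0))
    rw [D.stripLin_apply, Matrix.sum_apply, Finset.sum_eq_single ⟨0, l⟩] at h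
    · rw [if_pos rfl, adSub_pow_rowColumn, Matrix.smul_apply, stripMatrix_col,
        if_pos (by simp only; omega)] at h
      simpa using h
    · rintro ⟨i, m⟩ - hb
      by_cases hi : i = 0
      · subst hi
        rw [if_pos rfl, adSub_pow_rowColumn, Matrix.smul_apply, stripMatrix_col, if_neg, smul_zero]
        intro hm
        have hm' : (m : ℕ) < D.n := m.2
        apply hb
        congr 1
        apply Fin.ext
        simp only at hm
        omega
      · rw [if_neg hi]
        simp
    · simp
  rw [← D.fullBasis.repr.map_eq_zero_iff]
  ext ⟨i, l⟩
  by_cases hi : i = 0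
  · subst hi; exact h0 l
  · have h := congrFun (congrFun hv (Sum.inl 0)) (Sum.inr (Sum.inr 0))
    rw [D.stripLin_apply, Matrix.sum_apply, Finset.sum_eq_single ⟨i, l⟩] at h
    · rw [if_neg hi, Matrix.smul_apply, stripMatrix_corner] at h
      exact (mul_eq_zero.mp h).resolve_right hβ
    · rintro ⟨j, m⟩ - hb
      by_cases hj : j = 0
      · subst hj
        rw [h0 m, zero_smul]
        rfl
      · obtain rfl := hD.eq_of_ne_zero hi hj
        have := (hD.2 i hi).1
        exact absurd (by congr 1; exact Fin.ext (by omega)) hb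
    · simp

/-- Each nonzero `β` gives an extension of `R_{α,a}`. -/
theorem exists_extension_repA (hD : D.IsTypeTwo) (hn : Odd D.n) (hn2 : 2 ≤ D.n)
    (ha : IsAdmissible a) {β : F} (hβ : β ≠ 0) : ∃ R : D.Extension (D.repA α a),
      ∀ v, R.1 (ofV x v) = D.stripLin α a β v := by
  set R := buildRep x (threeBlocks D.n α D.lam) (D.stripLin α a β)
    (D.stripLin_lie hD β) (D.stripLin_comm hn ha β) with hR
  have hg : R (gen x) = threeBlocks D.n α D.lam := buildRep_gen _ _ _ _ _
  have hV : ∀ v, R (ofV x v) = D.stripLin α a β v := buildRep_ofV _ _ _ _ _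
  have hv0 : R (ofV x D.v₀) = rowColumn a := by
    rw [hV, v₀, D.stripLin_basis_zero]; rfl
  refine ⟨⟨R, ?_, ?_, (D.restrict_eq_linearRep_iff _ _ _).mpr ⟨hg, hv0⟩⟩, hV⟩
  · have : ∀ y, R y = 0 → y = 0 := by
      intro y hy
      have h1 := rep_eq (R : Alg x →ₗ[F] Matrix (Idx D.n) (Idx D.n) F) y
      simp only [LieHom.coe_toLinearMap] at h1
      rw [h1, hg, hV] at hy
      have h3 := congrFun (congrFun hy (Sum.inr (Sum.inl ⟨0, by omega⟩)))
        (Sum.inr (Sum.inl ⟨1, hn2⟩))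
      rw [D.stripLin_apply, Matrix.add_apply, Matrix.sum_apply, Finset.sum_eq_zero] at h3
      · have h4 : y.right = 0 := by
          simpa [threeBlocks, upperJordan] using h3
        rw [h4, zero_smul, zero_add] at hy
        rw [alg_eq y, h4, D.stripLin_injective hD hβ hy]
        ext <;> simp
      · rintro ⟨i, l⟩ -
        split_ifs
        · rw [adSub_pow_rowColumn]; simp
        · simp
    exact (injective_iff_map_eq_zero R).mpr this
  · exact isUniserial_of_threeBlocks (D.size_pos 0) ha R (LinearEquiv.refl _ _) (gen x)
      (ofV x D.v₀) (fun v => by rw [hg]; rfl) (fun v => by rw [hv0]; rfl)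

/-- The extensions of `R_{α,a}` are parametrized by the nonzero scalars. -/
theorem exists_extension_repA_equiv (hlam : D.lam ≠ 0) (h2 : (2 : F) ≠ 0) (h3 : (3 : F) ≠ 0)
    (hD : D.IsTypeTwo) (hn : Odd D.n) (hn2 : 2 ≤ D.n) (ha : IsAdmissible a) {i : Fin e}
    (hi : i ≠ 0) {w : V} (hw : w ∈ D.block i) (hw0 : w ≠ 0) :
    ∃ Φ : D.Extension (D.repA α a) ≃ {β : F // β ≠ 0}, ∀ R : D.Extension (D.repA α a),
      R.1 (ofV x w) = (Φ R).1 • Matrix.single (Sum.inl 0) (Sum.inr (Sum.inr 0)) 1 := by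
  have hval : ∀ R : D.Extension (D.repA α a), R.1 (ofV x w) =
      R.1 (ofV x w) (Sum.inl 0) (Sum.inr (Sum.inr 0)) •
        Matrix.single (Sum.inl 0) (Sum.inr (Sum.inr 0)) 1 := by
    intro R
    refine eq_single_of_ad_threeBlocks (α := α) (lam := D.lam) hlam h2 h3 ?_
    have hR := (D.restrict_eq_linearRep_iff _ _ _).mp R.2.2.2
    rw [← hR.1, rep_lie_gen, hD.apply_eq hi hw]
    exact map_smul (repV (R.1 : Alg x →ₗ[F] Matrix (Idx D.n) (Idx D.n) F)) _ _
  have hne : ∀ R : D.Extension (D.repA α a),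
      R.1 (ofV x w) (Sum.inl 0) (Sum.inr (Sum.inr 0)) ≠ 0 := by
    intro R h0
    have h := hval R
    rw [h0, zero_smul] at h
    have h' := R.2.1 (h.trans (map_zero R.1).symm)
    exact hw0 (congrArg LieAlgebra.SemiDirectSum.left h')
  refine ⟨Equiv.ofBijective (fun R => ⟨_, hne R⟩) ⟨?_, ?_⟩, hval⟩
  · intro R S hRS
    have hRS' := congrArg Subtype.val hRS
    simp only at hRS'
    have hw' : R.1 (ofV x w) = S.1 (ofV x w) := by rw [hval R, hval S, hRS']
    have hR := (D.restrict_eq_linearRep_iff _ _ _).mp R.2.2.2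
    have hS := (D.restrict_eq_linearRep_iff _ _ _).mp S.2.2.2
    apply Subtype.ext
    apply rep_ext (hR.1.trans hS.1.symm)
    have key : repV (R.1 : Alg x →ₗ[F] Matrix (Idx D.n) (Idx D.n) F) =
        repV (S.1 : Alg x →ₗ[F] Matrix (Idx D.n) (Idx D.n) F) := by
      refine D.fullBasis.ext fun s => ?_
      rw [D.fullBasis_apply]
      obtain ⟨j, l⟩ := s
      by_cases hj : j = 0
      · subst hj
        simp only
        rw [D.basis_eq_pow 0 l]
        change R.1 (ofV x _) = S.1 (ofV x _)
        rw [← adSub_pow_rep, ← adSub_pow_rep, hR.1, hS.1]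
        exact congrArg _ (hR.2.trans hS.2.symm)
      · obtain rfl := hD.eq_of_ne_zero hi hj
        obtain ⟨c, hc⟩ := hD.exists_smul_eq hi hw hw0 (D.basis i l).2
        simp only
        rw [hc, map_smul, map_smul]
        exact congrArg _ hw'
    exact fun v => LinearMap.congr_fun key v
  · rintro ⟨β, hβ⟩
    have hb := D.basis_ne_zero i ⟨0, D.size_pos i⟩
    obtain ⟨c, hc⟩ := hD.exists_smul_eq hi (D.basis i ⟨0, D.size_pos i⟩).2 hb hw
    have hc0 : c ≠ 0 := by
      rintro rfl
      exact hw0 (by rw [hc, zero_smul])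
    -- since `w` is `c` times the basis vector of its block, the latter has to act by
    -- `(β / c) E^{1,n+2}`
    obtain ⟨R, hR⟩ := D.exists_extension_repA (α := α) hD hn hn2 ha (div_ne_zero hβ hc0)
    refine ⟨R, Subtype.ext ?_⟩
    simp only
    rw [hR, hc, map_smul, D.stripLin_basis_ne_zero _ hi, Matrix.smul_apply, stripMatrix_corner,
      smul_eq_mul, mul_div_cancel₀ _ hc0]

end JordanDecomposition
end Two
end UniserialSolvable

namespace UniserialSolvable

variable {F : Type*} [Field F]
variable {V U : Type*} [AddCommGroup V] [Module F V] [AddCommGroup U] [Module F U]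

/-! ### Modules over `⟨x⟩ ⋉ V` as operators -/

/-- A module over `⟨x⟩ ⋉ V`, in terms of operators: `A` is the action of `x` and `ρ` is the action
of `V`. -/
structure Action (x : End F V) (U : Type*) [AddCommGroup U] [Module F U] where
  /-- the action of `x` -/
  A : End F U
  /-- the action of `V` -/
  ρ : V →ₗ[F] End F U
  lie : ∀ v u, A (ρ v u) = ρ (x v) u + ρ v (A u)
  comm : ∀ v w u, ρ v (ρ w u) = ρ w (ρ v u)

namespace Action

variable {x : End F V} (a : Action x U)

/-- The operator `A - β 1`. -/
def N (β : F) : End F U := a.A - β • 1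

theorem N_apply (β : F) (u : U) : a.N β u = a.A u - β • u := rfl

theorem A_apply (β : F) (u : U) : a.A u = a.N β u + β • u := by
  rw [N_apply, sub_add_cancel]

/-- The Leibniz rule for the shifted operators `A - β 1` and `x - ν 1`. -/
theorem N_ρ {β ν γ : F} (h : γ = β + ν) (v : V) (u : U) :
    a.N γ (a.ρ v u) = a.ρ ((x - ν • (1 : End F V)) v) u + a.ρ v (a.N β u) := by
  rw [N_apply, N_apply, a.lie, LinearMap.sub_apply, map_sub, map_sub, LinearMap.smul_apply,
    Module.End.one_apply, map_smul, map_smul, LinearMap.sub_apply, LinearMap.smul_apply, h,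
    add_smul]
  abel

theorem N_mem {P : Submodule F U} (hP : ∀ u ∈ P, a.A u ∈ P) (β : F) {u : U} (hu : u ∈ P) :
    a.N β u ∈ P := P.sub_mem (hP u hu) (P.smul_mem β hu)

theorem N_pow_mem {P : Submodule F U} (hP : ∀ u ∈ P, a.A u ∈ P) (β : F) (r : ℕ) {u : U}
    (hu : u ∈ P) : (a.N β ^ r) u ∈ P := by
  induction r with
  | zero => simpa using hu
  | succ r ih =>
    rw [pow_succ', Module.End.mul_apply]
    exact a.N_mem hP β ih

theorem N_comm (β γ : F) (u : U) : a.N β (a.N γ u) = a.N γ (a.N β u) := by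
  simp only [N_apply, map_sub, map_smul, smul_sub, smul_comm β γ]
  abel

theorem N_pow_comm (β γ : F) (r : ℕ) (u : U) : (a.N β ^ r) (a.N γ u) = a.N γ ((a.N β ^ r) u) := by
  induction r with
  | zero => rfl
  | succ r ih => rw [pow_succ', Module.End.mul_apply, Module.End.mul_apply, ih, N_comm]

/-- By the Leibniz rule, `ρ` takes generalized eigenvectors with eigenvalues `ν` and `β` to a
generalized eigenvector with eigenvalue `β + ν`. -/
theorem N_pow_ρ_eq_zero {β ν γ : F} (h : γ = β + ν) : ∀ (t r s : ℕ) (v : V) (u : U), r + s = t →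
    ((x - ν • (1 : End F V)) ^ r) v = 0 → (a.N β ^ s) u = 0 → (a.N γ ^ t) (a.ρ v u) = 0 := by
  intro t
  induction t with
  | zero =>
    intro r s v u hrs hv hu
    obtain ⟨rfl, rfl⟩ : r = 0 ∧ s = 0 := by omega
    have hv' : v = 0 := hv
    rw [hv', map_zero]; rfl
  | succ t ih =>
    intro r s v u hrs hv hu
    rcases Nat.eq_zero_or_pos r with rfl | hr
    · have hv' : v = 0 := hv
      rw [hv', map_zero, LinearMap.zero_apply, map_zero]
    rcases Nat.eq_zero_or_pos s with rfl | hs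
    · have hu' : u = 0 := hu
      rw [hu', map_zero, map_zero]
    rw [pow_succ, Module.End.mul_apply, a.N_ρ h, map_add, ih (r - 1) s _ _ (by omega) ?_ hu,
      ih r (s - 1) _ _ (by omega) hv ?_, add_zero]
    · rw [← Module.End.mul_apply, ← pow_succ, Nat.sub_add_cancel hs, hu]
    · rw [← Module.End.mul_apply, ← pow_succ, Nat.sub_add_cancel hr, hv]

theorem mem_maxGenEigenspace_iff (β : F) (u : U) :
    u ∈ a.A.maxGenEigenspace β ↔ ∃ r, (a.N β ^ r) u = 0 := Module.End.mem_maxGenEigenspace _ _ _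

theorem ρ_mem_maxGenEigenspace {β ν γ : F} (h : γ = β + ν) {v : V} {u : U}
    (hv : v ∈ x.maxGenEigenspace ν) (hu : u ∈ a.A.maxGenEigenspace β) :
    a.ρ v u ∈ a.A.maxGenEigenspace γ := by
  obtain ⟨r, hr⟩ := (Module.End.mem_maxGenEigenspace _ _ _).mp hv
  obtain ⟨s, hs⟩ := (a.mem_maxGenEigenspace_iff _ _).mp hu
  exact (a.mem_maxGenEigenspace_iff _ _).mpr ⟨r + s, a.N_pow_ρ_eq_zero h _ r s v u rfl hr hs⟩

theorem A_mem_maxGenEigenspace {β : F} {u : U} (hu : u ∈ a.A.maxGenEigenspace β) :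
    a.A u ∈ a.A.maxGenEigenspace β := by
  obtain ⟨s, hs⟩ := (a.mem_maxGenEigenspace_iff _ _).mp hu
  refine (a.mem_maxGenEigenspace_iff _ _).mpr ⟨s, ?_⟩
  rw [a.A_apply β, map_add, map_smul, hs, smul_zero, add_zero, N_pow_comm, hs, map_zero]

/-- If `P` is `A`-stable, then a generalized eigenvector with eigenvalue `β` that is killed modulo
`P` by a power of `A - γ`, where `γ ≠ β`, lies in `P`. -/
theorem mem_of_N_pow_mem {P : Submodule F U} (hP : ∀ u ∈ P, a.A u ∈ P) {β γ : F} (h : β ≠ γ)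
    (s : ℕ) : ∀ (r : ℕ) (u : U), (a.N β ^ r) u = 0 → (a.N γ ^ s) u ∈ P → u ∈ P := by
  intro r
  induction r with
  | zero => intro u hu _; rw [show u = 0 from hu]; exact P.zero_mem
  | succ r ih =>
    intro u hu hs
    have hw : a.N β u ∈ P := by
      apply ih
      · rw [← Module.End.mul_apply, ← pow_succ, hu]
      · rw [N_pow_comm]; exact a.N_mem hP _ hs
    have key : ∀ j : ℕ, (a.N γ ^ j) u - (β - γ) ^ j • u ∈ P := by
      intro j
      induction j with
      | zero => simp
      | succ j ihj =>
        have e : (a.N γ ^ (j + 1)) u - (β - γ) ^ (j + 1) • u =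
            a.N γ ((a.N γ ^ j) u - (β - γ) ^ j • u) + (β - γ) ^ j • a.N β u := by
          rw [pow_succ', Module.End.mul_apply, map_sub, map_smul, N_apply a γ u, N_apply a β u,
            pow_succ]
          module
        rw [e]
        exact P.add_mem (a.N_mem hP _ ihj) (P.smul_mem _ hw)
    have h2 := P.sub_mem hs (key s)
    rw [sub_sub_cancel] at h2
    have h3 := P.smul_mem (((β - γ) ^ s)⁻¹) h2
    rwa [inv_smul_smul₀ (pow_ne_zero _ (sub_ne_zero.mpr h))] at h3

/-- The subspaces stable under the action of `⟨x⟩ ⋉ V`. -/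
def IsStable (P : Submodule F U) : Prop :=
  (∀ u ∈ P, a.A u ∈ P) ∧ ∀ v, ∀ u ∈ P, a.ρ v u ∈ P

/-- The stable subspaces form a chain. -/
def IsChain : Prop := ∀ P Q, a.IsStable P → a.IsStable Q → P ≤ Q ∨ Q ≤ P

/-- The subspace `W · P` spanned by all `ρ(w) u` with `w ∈ W` and `u ∈ P`. -/
def act (W : Submodule F V) (P : Submodule F U) : Submodule F U := Submodule.map₂ a.ρ W P

theorem ρ_mem_act {W : Submodule F V} {P : Submodule F U} {v : V} {u : U} (hv : v ∈ W)
    (hu : u ∈ P) : a.ρ v u ∈ a.act W P := Submodule.apply_mem_map₂ a.ρ hv hu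

theorem act_le {W : Submodule F V} {P Q : Submodule F U} :
    a.act W P ≤ Q ↔ ∀ v ∈ W, ∀ u ∈ P, a.ρ v u ∈ Q := Submodule.map₂_le

theorem act_mono {W W' : Submodule F V} {P P' : Submodule F U} (h : W ≤ W') (h' : P ≤ P') :
    a.act W P ≤ a.act W' P' := Submodule.map₂_le_map₂ h h'

theorem act_sup (W : Submodule F V) (P Q : Submodule F U) :
    a.act W (P ⊔ Q) = a.act W P ⊔ a.act W Q := Submodule.map₂_sup_right _ _ _ _

theorem act_comm_le (W W' : Submodule F V) (P : Submodule F U) :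
    a.act W (a.act W' P) ≤ a.act W' (a.act W P) := by
  refine a.act_le.mpr fun v hv => ?_
  have : a.act W' P ≤ (a.act W' (a.act W P)).comap (a.ρ v) := by
    refine a.act_le.mpr fun w hw u hu => ?_
    rw [Submodule.mem_comap, a.comm]
    exact a.ρ_mem_act hw (a.ρ_mem_act hv hu)
  exact fun u hu => this hu

theorem act_A_mem {W : Submodule F V} {P : Submodule F U} (hW : ∀ v ∈ W, x v ∈ W)
    (hP : ∀ u ∈ P, a.A u ∈ P) : ∀ u ∈ a.act W P, a.A u ∈ a.act W P := by
  have : a.act W P ≤ (a.act W P).comap a.A := by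
    refine a.act_le.mpr fun w hw u hu => ?_
    rw [Submodule.mem_comap, a.lie]
    exact Submodule.add_mem _ (a.ρ_mem_act (hW w hw) hu) (a.ρ_mem_act hw (hP u hu))
  exact fun u hu => this hu

theorem IsStable.act_top_le {a : Action x U} {P : Submodule F U} (hP : a.IsStable P) :
    a.act ⊤ P ≤ P := a.act_le.mpr fun v _ u hu => hP.2 v u hu

theorem IsStable.act_top {a : Action x U} {P : Submodule F U} (hP : a.IsStable P) :
    a.IsStable (a.act ⊤ P) :=
  ⟨a.act_A_mem (fun _ _ => trivial) hP.1,
    fun _ _ hu => a.ρ_mem_act trivial (hP.act_top_le hu)⟩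

/-- The module `P/VP` has only one eigenvalue, since its submodules form a chain. -/
theorem IsChain.exists_eigenvalue {a : Action x U} (ha : a.IsChain) {P : Submodule F U}
    (hP : a.IsStable P) : ∃ β, ∀ γ, γ ≠ β → a.A.maxGenEigenspace γ ⊓ P ≤ a.act ⊤ P := by
  by_contra! hcon
  obtain ⟨β, -, hβ⟩ := hcon 0
  obtain ⟨γ, hγβ, hγ⟩ := hcon β
  have hst : ∀ δ, a.IsStable (a.A.maxGenEigenspace δ ⊓ P ⊔ a.act ⊤ P) := by
    intro δ
    have hle : a.A.maxGenEigenspace δ ⊓ P ⊔ a.act ⊤ P ≤ P :=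
      sup_le inf_le_right hP.act_top_le
    refine ⟨fun u hu => ?_, fun v u hu => ?_⟩
    · obtain ⟨y, hy, z, hz, rfl⟩ := Submodule.mem_sup.mp hu
      rw [map_add]
      exact Submodule.add_mem_sup ⟨a.A_mem_maxGenEigenspace hy.1, hP.1 _ hy.2⟩
        (hP.act_top.1 z hz)
    · exact Submodule.mem_sup_right (a.ρ_mem_act trivial (hle hu))
  have key : ∀ δ ε, δ ≠ ε → ¬ a.A.maxGenEigenspace δ ⊓ P ≤ a.act ⊤ P →
      ¬ a.A.maxGenEigenspace δ ⊓ P ⊔ a.act ⊤ P ≤ a.A.maxGenEigenspace ε ⊓ P ⊔ a.act ⊤ P := by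
    intro δ ε hne h h'
    refine h fun u hu => ?_
    obtain ⟨y, hy, z, hz, hyz⟩ := Submodule.mem_sup.mp (h' (Submodule.mem_sup_left hu))
    obtain ⟨r, hr⟩ := (a.mem_maxGenEigenspace_iff _ _).mp hu.1
    obtain ⟨s, hs⟩ := (a.mem_maxGenEigenspace_iff _ _).mp hy.1
    refine a.mem_of_N_pow_mem hP.act_top.1 hne s r u hr ?_
    rw [← hyz, map_add, hs, zero_add]
    exact a.N_pow_mem hP.act_top.1 _ _ hz
  rcases ha _ _ (hst β) (hst γ) with h | h
  · exact key β γ hγβ.symm hβ h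
  · exact key γ β hγβ hγ h

/-! ### A lemma of Nakayama type -/

section Nakayama

/-- If `P` is stable under commuting nilpotent operators and is contained in the sum of its images,
then it vanishes. -/
theorem _root_.Module.End.eq_bot_of_le_iSup_map {ι : Type*} (f : ι → End F U)
    (hf : ∀ i, IsNilpotent (f i)) (hc : ∀ i j u, f i (f j u) = f j (f i u)) {P : Submodule F U}
    (hP : ∀ i, ∀ u ∈ P, f i u ∈ P) (s : Finset ι) (h : P ≤ ⨆ i ∈ s, P.map (f i)) : P = ⊥ := by
  classical
  induction s using Finset.induction_on with
  | empty => simpa using h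
  | insert i s _ ih =>
    apply ih
    rw [Finset.iSup_insert] at h
    set Q := ⨆ i ∈ s, P.map (f i) with hQ
    have hQi : Q.map (f i) ≤ Q := by
      rw [hQ, Submodule.map_iSup]
      refine iSup_mono fun j => ?_
      rw [Submodule.map_iSup]
      refine iSup_mono fun hj => ?_
      rintro _ ⟨_, ⟨u, hu, rfl⟩, rfl⟩
      exact ⟨f i u, hP i u hu, (hc i j u).symm⟩
    have key : ∀ r : ℕ, P ≤ P.map (f i ^ r) ⊔ Q := by
      intro r
      induction r with
      | zero => rw [pow_zero]; exact le_sup_of_le_left (Submodule.map_id P).ge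
      | succ r ihr =>
        refine h.trans (sup_le ?_ le_sup_right)
        refine (Submodule.map_mono ihr).trans ?_
        rw [Submodule.map_sup, ← Submodule.map_comp]
        refine sup_le_sup ?_ hQi
        rw [pow_succ']
        exact le_rfl
    obtain ⟨r, hr⟩ := hf i
    have := key r
    rw [hr, Submodule.map_zero, bot_sup_eq] at this
    exact this

variable [IsAlgClosed F] [CharZero F] [FiniteDimensional F V] [FiniteDimensional F U]

/-- Since `x` is invertible, `V` is spanned by vectors of nonzero weight `ν`; such a vector moves
generalized eigenspaces of `A` along the progressions `β, β + ν, β + 2ν, …`, which leave the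
finite set of eigenvalues. -/
theorem isNilpotent_ρ (hx : IsUnit x) (v : V) : IsNilpotent (a.ρ v) := by
  have hv : v ∈ ⨆ ν, x.maxGenEigenspace ν := by
    rw [Module.End.iSup_maxGenEigenspace_eq_top]; trivial
  refine Submodule.iSup_induction _ (motive := fun v => IsNilpotent (a.ρ v)) hv ?_ ?_ ?_
  · intro ν v hv
    by_cases hν : ν = 0
    · subst hν
      obtain ⟨r, hr⟩ := (Module.End.mem_maxGenEigenspace _ _ _).mp hv
      rw [zero_smul, sub_zero] at hr
      have : v = 0 := ((Module.End.isUnit_iff _).mp (hx.pow r)).1 (hr.trans (map_zero _).symm)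
      rw [this, map_zero]
      exact IsNilpotent.zero
    · rw [Module.End.isNilpotent_iff_of_finite]
      intro u
      have hu : u ∈ ⨆ β, a.A.maxGenEigenspace β := by
        rw [Module.End.iSup_maxGenEigenspace_eq_top]; trivial
      refine Submodule.iSup_induction _ (motive := fun u => ∃ m, (a.ρ v ^ m) u = 0) hu ?_
        ⟨0, map_zero _⟩ ?_
      · intro β u hu
        have hm : ∀ m : ℕ, (a.ρ v ^ m) u ∈ a.A.maxGenEigenspace (β + m * ν) := by
          intro m
          induction m with
          | zero => simpa using hu
          | succ m ih =>
            rw [pow_succ', Module.End.mul_apply]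
            exact a.ρ_mem_maxGenEigenspace (by push_cast; ring) hv ih
        by_contra! hne
        have hev : ∀ m : ℕ, a.A.HasEigenvalue (β + m * ν) := by
          intro m
          obtain ⟨s, hs⟩ := (a.mem_maxGenEigenspace_iff _ _).mp (hm m)
          refine Module.End.hasEigenvalue_of_hasGenEigenvalue (k := s) ?_
          exact fun h => hne m ((Submodule.eq_bot_iff _).mp h _
            (Module.End.mem_genEigenspace_nat.mpr hs))
        have hinj : Function.Injective fun m : ℕ => β + m * ν := by
          intro m m' h
          have h' := mul_right_cancel₀ hν (add_left_cancel h)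
          exact_mod_cast h'
        exact Set.infinite_of_injective_forall_mem hinj hev (Module.End.finite_hasEigenvalue a.A)
      · rintro u w ⟨m, hm⟩ ⟨m', hm'⟩
        refine ⟨m + m', ?_⟩
        rw [map_add]
        nth_rewrite 1 [add_comm m]
        rw [pow_add, pow_add, Module.End.mul_apply, hm, map_zero, Module.End.mul_apply, hm',
          map_zero, add_zero]
  · rw [map_zero]; exact IsNilpotent.zero
  · intro v w hv hw
    rw [map_add]
    refine Commute.isNilpotent_add ?_ hv hw
    exact LinearMap.ext fun u => a.comm v w u

/-- A stable subspace `P` with `P = VP` vanishes. -/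
theorem IsStable.eq_bot_of_le (hx : IsUnit x) {a : Action x U} {P : Submodule F U}
    (hP : a.IsStable P) (h : P ≤ a.act ⊤ P) : P = ⊥ := by
  let b := Module.finBasis F V
  refine Module.End.eq_bot_of_le_iSup_map (fun i => a.ρ (b i)) (fun i => a.isNilpotent_ρ hx _)
    (fun i j u => a.comm _ _ _) (fun i u hu => hP.2 _ u hu) Finset.univ (h.trans ?_)
  refine a.act_le.mpr fun v _ u hu => ?_
  rw [← b.sum_repr v, map_sum, LinearMap.sum_apply]
  refine Submodule.sum_mem _ fun i _ => ?_
  rw [map_smul, LinearMap.smul_apply]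
  refine Submodule.smul_mem _ _ ?_
  exact Submodule.mem_iSup_of_mem i (Submodule.mem_iSup_of_mem (Finset.mem_univ i) ⟨u, hu, rfl⟩)

end Nakayama

end Action
end UniserialSolvable

namespace UniserialSolvable

variable {F : Type*} [Field F]
variable {V U : Type*} [AddCommGroup V] [Module F V] [AddCommGroup U] [Module F U]

namespace Action

variable {x : End F V} (a : Action x U)

/-! ### The grading by eigenvalues -/

/-- A decomposition of the module into `A`-stable subspaces `G_0, G_1, …`, where `G_i` consists of
generalized eigenvectors with eigenvalue `β + iμ`, and `V` maps `G_i` into the sum of the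
subspaces `G_j` with `j > i`. -/
structure Grading where
  /-- the eigenvalue of `A` on `G_0` -/
  β : F
  /-- the difference of consecutive eigenvalues of `A` -/
  μ : F
  /-- the subspaces `G_i` -/
  G : ℕ → Submodule F U
  μ_ne_zero : μ ≠ 0
  le_maxGenEigenspace : ∀ i, G i ≤ a.A.maxGenEigenspace (β + i * μ)
  iSup_eq_top : ⨆ i, G i = ⊤
  A_mem : ∀ i, ∀ u ∈ G i, a.A u ∈ G i
  ρ_mem : ∀ v i, ∀ u ∈ G i, a.ρ v u ∈ ⨆ j, ⨆ _ : i < j, G j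
  succ_eq_bot : ∀ i, G i = ⊥ → G (i + 1) = ⊥
  one_ne_bot : G 1 ≠ ⊥

variable {a} in
/-- A module `U` whose submodules form a chain has such a decomposition. The quotients `U/VU` and
`VU/V²U` have a single eigenvalue each, `β` and `β₁`. With `μ = β₁ - β` and `M` the space of vectors
of weight `μ` in `V`, the summands are `G_i = M^i G_0`, where `G_0` is the generalized eigenspace
with eigenvalue `β`. -/
theorem IsChain.nonempty_grading [IsAlgClosed F] [CharZero F] [FiniteDimensional F V]
    [FiniteDimensional F U] (ha : a.IsChain) (hx : IsUnit x) (hρ : a.ρ ≠ 0) :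
    Nonempty a.Grading := by
  have hst : a.IsStable ⊤ := ⟨fun _ _ => trivial, fun _ _ _ => trivial⟩
  obtain ⟨β, hβ⟩ := ha.exists_eigenvalue hst
  obtain ⟨β₁, hβ₁⟩ := ha.exists_eigenvalue hst.act_top
  set μ := β₁ - β with hμ
  set M := x.maxGenEigenspace μ with hM
  set G₀ := a.A.maxGenEigenspace β with hG₀
  set Y : ℕ → Submodule F U := fun i => (a.act M)^[i] G₀ with hY
  set L : ℕ → Submodule F U := fun i => (a.act ⊤)^[i] ⊤ with hL
  have Ysucc : ∀ i, Y (i + 1) = a.act M (Y i) := fun i => Function.iterate_succ_apply' _ _ _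
  have Lsucc : ∀ i, L (i + 1) = a.act ⊤ (L i) := fun i => Function.iterate_succ_apply' _ _ _
  have Lst : ∀ i, a.IsStable (L i) := by
    intro i
    induction i with
    | zero => exact hst
    | succ i ih => rw [Lsucc]; exact ih.act_top
  have Lanti : Antitone L := antitone_nat_of_succ_le fun i => by
    rw [Lsucc]; exact (Lst i).act_top_le
  have YL : ∀ i, Y i ≤ L i := by
    intro i
    induction i with
    | zero => exact le_top
    | succ i ih => rw [Ysucc, Lsucc]; exact a.act_mono le_top ih
  -- modulo `VU`, the module is its generalized eigenspace with eigenvalue `β`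
  have h0 : L 0 ≤ Y 0 ⊔ L 1 := by
    change ⊤ ≤ _
    rw [← Module.End.iSup_maxGenEigenspace_eq_top a.A]
    refine iSup_le fun γ => ?_
    by_cases h : γ = β
    · subst h; exact le_sup_left
    · refine le_sup_of_le_right (le_trans ?_ (hβ γ h))
      exact le_inf le_rfl le_top
  -- modulo `V²U`, only the vectors of weight `μ` contribute to `V G_0`, since `VU/V²U` has the
  -- single eigenvalue `β₁ = β + μ`
  have h1 : L 1 ≤ Y 1 ⊔ L 2 := by
    refine a.act_le.mpr fun v _ u _ => ?_
    have hv : v ∈ ⨆ ν, x.maxGenEigenspace ν := by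
      rw [Module.End.iSup_maxGenEigenspace_eq_top]; trivial
    refine Submodule.iSup_induction _ (motive := fun v => a.ρ v u ∈ Y 1 ⊔ L 2) hv ?_ ?_ ?_
    · intro ν v hv
      obtain ⟨g, hg, l, hl, rfl⟩ := Submodule.mem_sup.mp (h0 (show u ∈ L 0 from trivial))
      rw [map_add]
      refine Submodule.add_mem _ ?_ (Submodule.mem_sup_right (a.ρ_mem_act trivial hl))
      by_cases h : ν = μ
      · subst h
        exact Submodule.mem_sup_left (a.ρ_mem_act hv hg)
      · refine Submodule.mem_sup_right (hβ₁ (β + ν) ?_ ⟨?_, a.ρ_mem_act trivial trivial⟩)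
        · intro h'; apply h; rw [hμ, ← h']; ring
        · exact a.ρ_mem_maxGenEigenspace rfl hv hg
    · rw [map_zero]; exact Submodule.zero_mem _
    · intro v w hv hw
      rw [map_add]; exact Submodule.add_mem _ hv hw
  -- as `V` commutes with `M`, the case of `h1` carries over to all `i`
  have hTY : ∀ i, a.act ⊤ (Y i) ≤ Y (i + 1) ⊔ L (i + 2) := by
    have hcomm : ∀ i Q, a.act ⊤ ((a.act M)^[i] Q) ≤ (a.act M)^[i] (a.act ⊤ Q) := by
      intro i
      induction i with
      | zero => exact fun Q => le_rfl
      | succ i ih =>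
        intro Q
        rw [Function.iterate_succ_apply', Function.iterate_succ_apply']
        exact (a.act_comm_le _ _ _).trans (a.act_mono le_rfl (ih Q))
    have hsup : ∀ i Q Q', (a.act M)^[i] (Q ⊔ Q') = (a.act M)^[i] Q ⊔ (a.act M)^[i] Q' := by
      intro i
      induction i with
      | zero => exact fun Q Q' => rfl
      | succ i ih =>
        intro Q Q'
        rw [Function.iterate_succ_apply', Function.iterate_succ_apply',
          Function.iterate_succ_apply', ih, act_sup]
    have hmono : ∀ i Q Q', Q ≤ Q' → (a.act M)^[i] Q ≤ (a.act ⊤)^[i] Q' := by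
      intro i
      induction i with
      | zero => exact fun Q Q' h => h
      | succ i ih =>
        intro Q Q' h
        rw [Function.iterate_succ_apply', Function.iterate_succ_apply']
        exact a.act_mono le_top (ih _ _ h)
    have hmono' : ∀ i Q Q', Q ≤ Q' → (a.act M)^[i] Q ≤ (a.act M)^[i] Q' := by
      intro i
      induction i with
      | zero => exact fun Q Q' h => h
      | succ i ih =>
        intro Q Q' h
        rw [Function.iterate_succ_apply', Function.iterate_succ_apply']
        exact a.act_mono le_rfl (ih _ _ h)
    intro i
    refine (hcomm i G₀).trans ((hmono' i _ (Y 1 ⊔ L 2) ?_).trans ?_)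
    · exact le_trans (a.act_mono le_rfl le_top) h1
    · rw [hsup]
      refine sup_le_sup ?_ ?_
      · rw [hY]; exact (Function.iterate_succ_apply _ _ _).ge
      · refine (hmono i _ _ le_rfl).trans ?_
        rw [hL, ← Function.iterate_add_apply]
  have hLY : ∀ i, L i ≤ Y i ⊔ L (i + 1) := by
    intro i
    induction i with
    | zero => exact h0
    | succ i ih =>
      rw [Lsucc i]
      refine (a.act_mono le_rfl ih).trans ?_
      rw [act_sup]
      exact sup_le (hTY i) (le_sup_of_le_right (Lsucc (i + 1)).ge)
  -- the descending chain of the `V^i U` becomes stationary, hence reaches zero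
  obtain ⟨n, hn⟩ : ∃ n, L n = ⊥ := by
    obtain ⟨n, hn⟩ := IsArtinian.monotone_stabilizes (R := F) (M := U)
      ⟨fun i => OrderDual.toDual (L i), fun i j h => Lanti h⟩
    refine ⟨n, (Lst n).eq_bot_of_le hx ?_⟩
    have := hn (n + 1) (Nat.le_succ n)
    have h' : L n = L (n + 1) := this
    rw [Lsucc] at h'
    exact h'.le
  have htail : ∀ i, L i ≤ ⨆ j, ⨆ _ : i ≤ j, Y j := by
    intro i
    have : ∀ m, L i ≤ (⨆ j, ⨆ _ : i ≤ j, Y j) ⊔ L (i + m) := by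
      intro m
      induction m with
      | zero => exact le_sup_right
      | succ m ih =>
        refine ih.trans (sup_le le_sup_left ((hLY (i + m)).trans ?_))
        refine sup_le_sup ?_ le_rfl
        exact le_iSup₂_of_le (i + m) (by omega) le_rfl
    refine (this n).trans (sup_le le_rfl ?_)
    exact (Lanti (by omega : n ≤ i + n)).trans (hn.le.trans bot_le)
  have hsucc : ∀ i, Y i = ⊥ → Y (i + 1) = ⊥ := by
    intro i h
    rw [Ysucc, h]
    exact Submodule.map₂_bot_right _ _
  have hone : Y 1 ≠ ⊥ := by
    intro h
    have hall : ∀ j, Y (j + 1) = ⊥ := by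
      intro j
      induction j with
      | zero => exact h
      | succ j ih => exact hsucc _ ih
    have hL1 : L 1 ≤ ⊥ := by
      refine (htail 1).trans (iSup₂_le fun j hj => ?_)
      obtain ⟨j, rfl⟩ := Nat.exists_eq_add_of_le hj
      rw [add_comm]; exact (hall j).le
    apply hρ
    ext v u
    exact (Submodule.mem_bot F).mp (hL1 (a.ρ_mem_act (P := ⊤) (W := ⊤) trivial trivial))
  have hμ0 : μ ≠ 0 := by
    intro h
    apply hone
    have hM0 : M = ⊥ := by
      rw [Submodule.eq_bot_iff]
      intro v hv
      obtain ⟨r, hr⟩ := (Module.End.mem_maxGenEigenspace _ _ _).mp hv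
      rw [h, zero_smul, sub_zero] at hr
      exact ((Module.End.isUnit_iff _).mp (hx.pow r)).1 (hr.trans (map_zero _).symm)
    rw [Ysucc, hM0]
    exact Submodule.map₂_bot_left _ _
  exact ⟨{
    β := β
    μ := μ
    G := Y
    μ_ne_zero := hμ0
    le_maxGenEigenspace := by
      intro i
      induction i with
      | zero => rw [Nat.cast_zero, zero_mul, add_zero]; exact le_rfl
      | succ i ih =>
        rw [Ysucc]
        exact a.act_le.mpr fun v hv u hu =>
          a.ρ_mem_maxGenEigenspace (by push_cast; ring) hv (ih hu)
    iSup_eq_top := by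
      refine top_le_iff.mp ((htail 0).trans (iSup_mono fun j => ?_))
      exact iSup_le fun _ => le_rfl
    A_mem := by
      intro i
      induction i with
      | zero => exact fun u hu => a.A_mem_maxGenEigenspace hu
      | succ i ih =>
        rw [Ysucc]
        refine a.act_A_mem (fun v hv => ?_) ih
        exact Module.End.mapsTo_maxGenEigenspace_of_comm (Commute.refl x) μ hv
    ρ_mem := by
      intro v i u hu
      have : a.ρ v u ∈ L (i + 1) := by
        rw [Lsucc]; exact a.ρ_mem_act trivial (YL i hu)
      exact htail (i + 1) this
    succ_eq_bot := hsucc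
    one_ne_bot := hone }⟩

namespace Grading

variable {a} [CharZero F] (g : a.Grading)

/-- The eigenvalue of `A` on `G_i`. -/
def wt (i : ℕ) : F := g.β + i * g.μ

theorem wt_injective : Function.Injective g.wt := by
  intro i j h
  have h' := mul_right_cancel₀ g.μ_ne_zero (add_left_cancel h)
  exact_mod_cast h'

theorem wt_add (i j : ℕ) : g.wt (i + j) = g.wt i + j * g.μ := by
  simp only [wt]; push_cast; ring

theorem isInternal : DirectSum.IsInternal g.G :=
  DirectSum.isInternal_submodule_of_iSupIndep_of_iSup_eq_top
    (((Module.End.independent_maxGenEigenspace a.A).comp g.wt_injective).mono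
      g.le_maxGenEigenspace) g.iSup_eq_top

theorem induction {p : U → Prop} (h0 : p 0) (hadd : ∀ u w, p u → p w → p (u + w))
    (h : ∀ i, ∀ u ∈ g.G i, p u) (u : U) : p u := by
  have hu : u ∈ ⨆ i, g.G i := by rw [g.iSup_eq_top]; trivial
  exact Submodule.iSup_induction _ (motive := p) hu h h0 hadd

/-- The projection onto `G_i`. -/
noncomputable def proj (i : ℕ) : End F U :=
  (g.G i).subtype ∘ₗ DirectSum.component F ℕ (fun i => g.G i) i ∘ₗ
    (LinearEquiv.ofBijective (DirectSum.coeLinearMap g.G) g.isInternal).symm.toLinearMap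

theorem proj_mem (i : ℕ) (u : U) : g.proj i u ∈ g.G i := Subtype.mem _

theorem proj_of_mem {i : ℕ} {u : U} (hu : u ∈ g.G i) : g.proj i u = u := by
  have h : (LinearEquiv.ofBijective (DirectSum.coeLinearMap g.G) g.isInternal).symm u =
      DirectSum.lof F ℕ (fun i => g.G i) i ⟨u, hu⟩ := by
    rw [LinearEquiv.symm_apply_eq]
    exact (DirectSum.coeLinearMap_lof g.G i ⟨u, hu⟩).symm
  change ((DirectSum.component F ℕ (fun i => g.G i) i
    ((LinearEquiv.ofBijective (DirectSum.coeLinearMap g.G) g.isInternal).symm u)) : U) = u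
  rw [h, DirectSum.component.lof_self]

theorem proj_of_mem_ne {i j : ℕ} (hij : i ≠ j) {u : U} (hu : u ∈ g.G j) : g.proj i u = 0 := by
  have h : (LinearEquiv.ofBijective (DirectSum.coeLinearMap g.G) g.isInternal).symm u =
      DirectSum.lof F ℕ (fun i => g.G i) j ⟨u, hu⟩ := by
    rw [LinearEquiv.symm_apply_eq]
    exact (DirectSum.coeLinearMap_lof g.G j ⟨u, hu⟩).symm
  change ((DirectSum.component F ℕ (fun i => g.G i) i
    ((LinearEquiv.ofBijective (DirectSum.coeLinearMap g.G) g.isInternal).symm u)) : U) = 0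
  rw [h, DirectSum.component.of, dif_neg (Ne.symm hij)]
  rfl

theorem mem_of_proj_mem {S : Submodule F U} {u : U} (h : ∀ i, g.proj i u ∈ S) : u ∈ S := by
  have key : ∃ n, ∀ m, n ≤ m → u = ∑ i ∈ Finset.range m, g.proj i u := by
    refine g.induction (p := fun u => ∃ n, ∀ m, n ≤ m → u = ∑ i ∈ Finset.range m, g.proj i u)
      ⟨0, fun m _ => by simp⟩ ?_ ?_ u
    · rintro u w ⟨n, hn⟩ ⟨n', hn'⟩
      refine ⟨max n n', fun m hm => ?_⟩
      simp only [map_add, Finset.sum_add_distrib]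
      rw [← hn m (le_of_max_le_left hm), ← hn' m (le_of_max_le_right hm)]
    · intro i u hu
      refine ⟨i + 1, fun m hm => ?_⟩
      rw [Finset.sum_eq_single i, g.proj_of_mem hu]
      · exact fun j _ hj => g.proj_of_mem_ne hj hu
      · intro hi
        exact absurd (Finset.mem_range.mpr (by omega)) hi
  obtain ⟨n, hn⟩ := key
  rw [hn n le_rfl]
  exact Submodule.sum_mem _ fun i _ => h i

theorem proj_A (i : ℕ) (u : U) : g.proj i (a.A u) = a.A (g.proj i u) := by
  refine g.induction (p := fun u => g.proj i (a.A u) = a.A (g.proj i u)) (by simp)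
    (fun u w hu hw => by simp only [map_add, hu, hw]) (fun j u hu => ?_) u
  by_cases h : i = j
  · subst h
    rw [g.proj_of_mem hu, g.proj_of_mem (g.A_mem i u hu)]
  · rw [g.proj_of_mem_ne h hu, g.proj_of_mem_ne h (g.A_mem j u hu), map_zero]

theorem proj_N (i : ℕ) (γ : F) (u : U) : g.proj i (a.N γ u) = a.N γ (g.proj i u) := by
  rw [N_apply, N_apply, map_sub, map_smul, proj_A]

/-- A generalized eigenvector has no components with other eigenvalues. -/
theorem proj_eq_zero {γ : F} {i : ℕ} (h : γ ≠ g.wt i) {u : U} (hu : u ∈ a.A.maxGenEigenspace γ) :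
    g.proj i u = 0 := by
  obtain ⟨r, hr⟩ := (a.mem_maxGenEigenspace_iff _ _).mp hu
  obtain ⟨s, hs⟩ := (a.mem_maxGenEigenspace_iff _ _).mp (g.le_maxGenEigenspace i (g.proj_mem i u))
  have hpow : ∀ r u, g.proj i ((a.N γ ^ r) u) = (a.N γ ^ r) (g.proj i u) := by
    intro r
    induction r with
    | zero => exact fun u => rfl
    | succ r ih =>
      intro u
      rw [pow_succ', Module.End.mul_apply, Module.End.mul_apply, proj_N, ih]
  have := a.mem_of_N_pow_mem (P := ⊥) (fun u hu => by
    rw [(Submodule.mem_bot F).mp hu, map_zero]; exact Submodule.zero_mem _) h.symm r s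
    (g.proj i u) hs (by rw [← hpow, hr, map_zero]; exact Submodule.zero_mem _)
  exact (Submodule.mem_bot F).mp this

theorem proj_ρ_of_le {i j : ℕ} (hji : j ≤ i) (v : V) {u : U} (hu : u ∈ g.G i) :
    g.proj j (a.ρ v u) = 0 := by
  have h := g.ρ_mem v i u hu
  have hle : (⨆ j, ⨆ _ : i < j, g.G j) ≤ LinearMap.ker (g.proj j) := by
    refine iSup₂_le fun l hl w hw => ?_
    rw [LinearMap.mem_ker]
    exact g.proj_of_mem_ne (by omega) hw
  exact hle h

/-- The vectors of weight `ν` in `V` map `G_i` to `G_{i+j}` if `ν = jμ` with `j > 0`, and to zero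
if `ν` is not of this form. -/
theorem ρ_mem_of_weight {ν : F} {v : V} (hv : v ∈ x.maxGenEigenspace ν) {i : ℕ} {u : U}
    (hu : u ∈ g.G i) {j : ℕ} (hj : ν = j * g.μ) : a.ρ v u ∈ g.G (i + j) := by
  have h1 : a.ρ v u ∈ a.A.maxGenEigenspace (g.wt (i + j)) :=
    a.ρ_mem_maxGenEigenspace (by rw [g.wt_add, hj]; rfl) hv (g.le_maxGenEigenspace i hu)
  refine g.mem_of_proj_mem fun l => ?_
  by_cases h : l = i + j
  · subst h; exact g.proj_mem _ _
  · rw [g.proj_eq_zero (fun h' => h (g.wt_injective h').symm) h1]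
    exact Submodule.zero_mem _

theorem ρ_eq_zero_of_weight {ν : F} {v : V} (hv : v ∈ x.maxGenEigenspace ν) {i : ℕ} {u : U}
    (hu : u ∈ g.G i) (hν : ∀ j : ℕ, 0 < j → g.G (i + j) ≠ ⊥ → ν ≠ j * g.μ) : a.ρ v u = 0 := by
  have h1 : a.ρ v u ∈ a.A.maxGenEigenspace (g.wt i + ν) :=
    a.ρ_mem_maxGenEigenspace rfl hv (g.le_maxGenEigenspace i hu)
  refine (Submodule.mem_bot F).mp (g.mem_of_proj_mem fun l => ?_)
  rw [Submodule.mem_bot]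
  rcases Nat.lt_or_ge i l with h | h
  · obtain ⟨j, rfl⟩ := Nat.exists_eq_add_of_lt h
    by_cases hb : g.G (i + j + 1) = ⊥
    · have := g.proj_mem (i + j + 1) (a.ρ v u)
      rwa [hb, Submodule.mem_bot] at this
    · refine g.proj_eq_zero ?_ h1
      rw [add_assoc, g.wt_add]
      exact fun h' => hν (j + 1) (by omega) hb (add_left_cancel h')
  · exact g.proj_ρ_of_le h v hu

theorem eq_bot_of_le {i j : ℕ} (hij : i ≤ j) (h : g.G i = ⊥) : g.G j = ⊥ := by
  induction j, hij using Nat.le_induction with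
  | base => exact h
  | succ j _ ih => exact g.succ_eq_bot j ih

theorem ne_bot_of_le {i j : ℕ} (hij : i ≤ j) (h : g.G j ≠ ⊥) : g.G i ≠ ⊥ :=
  fun h' => h (g.eq_bot_of_le hij h')

end Grading
end Action
end UniserialSolvable

namespace UniserialSolvable

variable {F : Type*} [Field F]
variable {V U : Type*} [AddCommGroup V] [Module F V] [AddCommGroup U] [Module F U]

/-! ### The summands of the grading -/

/-- The vectors `q, N q, …, N^{k-1} q` are linearly independent if `N^{k-1} q ≠ 0 = N^k q`. -/
theorem linearIndependent_pow_apply (N : End F U) {q : U} {k : ℕ} (h0 : (N ^ k) q = 0)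
    (h1 : (N ^ (k - 1)) q ≠ 0) : LinearIndependent F fun j : Fin k => (N ^ (j : ℕ)) q := by
  rw [Fintype.linearIndependent_iff]
  intro c hc
  have key : ∀ (m : ℕ) (i : Fin k), (i : ℕ) = m → c i = 0 := by
    intro m
    induction m using Nat.strong_induction_on with
    | _ m ih =>
      intro i hi
      have hc' := congrArg (N ^ (k - 1 - m)) hc
      rw [map_sum, map_zero, Finset.sum_eq_single i] at hc'
      · rw [map_smul, ← Module.End.mul_apply, ← pow_add,
          show k - 1 - m + (i : ℕ) = k - 1 by omega] at hc'
        exact (smul_eq_zero.mp hc').resolve_right h1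
      · intro j _ hj
        rw [map_smul]
        rcases lt_or_gt_of_ne (fun h => hj (Fin.ext h) : (j : ℕ) ≠ i) with h | h
        · rw [ih j (by omega) j rfl, zero_smul]
        · rw [← Module.End.mul_apply, ← pow_add,
            show k - 1 - m + (j : ℕ) = (j - m - 1) + k by omega, pow_add, Module.End.mul_apply, h0,
            map_zero, smul_zero]
      · simp
  exact fun i => key i i rfl

namespace Action

variable {x : End F V} {a : Action x U}

/-- The structure of the summand `G_i` of a grading: it has a basis `q, N q, …, N^{k-1} q`, where
`N = A - (β + iμ) 1`, and `π` is the functional on the whole module that picks out the coefficient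
of `q`. The basis is encoded by the properties of `N` on `G_i`: its `k`-th power vanishes, its
kernel is spanned by `N^{k-1} q ≠ 0`, and `N^{k-1} u = π(u) N^{k-1} q`. -/
structure Grading.Layer [CharZero F] (g : a.Grading) (i : ℕ) where
  /-- the dimension of `G_i` -/
  k : ℕ
  /-- the cyclic generator of `G_i` -/
  q : U
  /-- the left eigenvector of `A` on `G_i` -/
  π : U →ₗ[F] F
  k_pos : 0 < k
  q_mem : q ∈ g.G i
  N_pow : ∀ u ∈ g.G i, (a.N (g.wt i) ^ k) u = 0
  socle_ne_zero' : (a.N (g.wt i) ^ (k - 1)) q ≠ 0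
  exists_smul' : ∀ u ∈ g.G i, a.N (g.wt i) u = 0 → ∃ c : F, u = c • (a.N (g.wt i) ^ (k - 1)) q
  π_N : ∀ u, π (a.N (g.wt i) u) = 0
  π_of_ne : ∀ j, j ≠ i → ∀ u ∈ g.G j, π u = 0
  N_pow_pred' : ∀ u ∈ g.G i, (a.N (g.wt i) ^ (k - 1)) u = π u • (a.N (g.wt i) ^ (k - 1)) q

namespace Grading

variable [CharZero F] (g : a.Grading)

theorem isStable_iSup (i : ℕ) : a.IsStable (⨆ j, ⨆ _ : i < j, g.G j) := by
  constructor
  · have : (⨆ j, ⨆ _ : i < j, g.G j) ≤ (⨆ j, ⨆ _ : i < j, g.G j).comap a.A :=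
      iSup₂_le fun j hj u hu => Submodule.mem_iSup_of_mem j
        (Submodule.mem_iSup_of_mem hj (g.A_mem j u hu))
    exact fun u hu => this hu
  · intro v
    have : (⨆ j, ⨆ _ : i < j, g.G j) ≤ (⨆ j, ⨆ _ : i < j, g.G j).comap (a.ρ v) := by
      refine iSup₂_le fun j hj u hu => ?_
      have hle : (⨆ l, ⨆ _ : j < l, g.G l) ≤ ⨆ l, ⨆ _ : i < l, g.G l :=
        iSup₂_le fun l hl => le_iSup₂_of_le l (hj.trans hl) le_rfl
      exact hle (g.ρ_mem v j u hu)
    exact fun u hu => this hu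

theorem proj_eq_zero_of_mem_iSup {i : ℕ} {u : U} (hu : u ∈ ⨆ j, ⨆ _ : i < j, g.G j) :
    g.proj i u = 0 := by
  have : (⨆ j, ⨆ _ : i < j, g.G j) ≤ LinearMap.ker (g.proj i) :=
    iSup₂_le fun j hj u hu => g.proj_of_mem_ne hj.ne hu
  exact this hu

/-- The `A`-stable subspaces of `G_i` form a chain. -/
theorem chain_of_le (ha : a.IsChain) {i : ℕ} {P Q : Submodule F U} (hP : P ≤ g.G i)
    (hQ : Q ≤ g.G i) (hPA : ∀ u ∈ P, a.A u ∈ P) (hQA : ∀ u ∈ Q, a.A u ∈ Q) : P ≤ Q ∨ Q ≤ P := by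
  have hst : ∀ P, P ≤ g.G i → (∀ u ∈ P, a.A u ∈ P) →
      a.IsStable (P ⊔ ⨆ j, ⨆ _ : i < j, g.G j) := by
    intro P hP hPA
    refine ⟨fun u hu => ?_, fun v u hu => ?_⟩
    · obtain ⟨y, hy, z, hz, rfl⟩ := Submodule.mem_sup.mp hu
      rw [map_add]
      exact Submodule.add_mem_sup (hPA y hy) ((g.isStable_iSup i).1 z hz)
    · obtain ⟨y, hy, z, hz, rfl⟩ := Submodule.mem_sup.mp hu
      rw [map_add]
      exact Submodule.mem_sup_right (Submodule.add_mem _ (g.ρ_mem v i y (hP hy))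
        ((g.isStable_iSup i).2 v z hz))
  have hle : ∀ P Q, P ≤ g.G i → Q ≤ g.G i → P ⊔ (⨆ j, ⨆ _ : i < j, g.G j) ≤
      Q ⊔ (⨆ j, ⨆ _ : i < j, g.G j) → P ≤ Q := by
    intro P Q hP hQ h u hu
    obtain ⟨y, hy, z, hz, hyz⟩ := Submodule.mem_sup.mp (h (Submodule.mem_sup_left hu))
    have := congrArg (g.proj i) hyz
    rw [map_add, g.proj_of_mem (hQ hy), g.proj_eq_zero_of_mem_iSup hz, add_zero,
      g.proj_of_mem (hP hu)] at this
    rwa [← this]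
  rcases ha _ _ (hst P hP hPA) (hst Q hQ hQA) with h | h
  · exact Or.inl (hle P Q hP hQ h)
  · exact Or.inr (hle Q P hQ hP h)

/-- The `A`-stable subspaces of `G_i` form a chain, so `A` acts on `G_i` by a single Jordan
block. -/
theorem nonempty_layer [FiniteDimensional F U] (ha : a.IsChain) {i : ℕ} (hG : g.G i ≠ ⊥) :
    Nonempty (g.Layer i) := by
  classical
  set N := a.N (g.wt i) with hN
  have hNG : ∀ u ∈ g.G i, N u ∈ g.G i := fun u hu => a.N_mem (g.A_mem i) _ hu
  have hnil : ∃ k, ∀ u ∈ g.G i, (N ^ k) u = 0 := by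
    refine ⟨finrank F U, fun u hu => ?_⟩
    have := g.le_maxGenEigenspace i hu
    rw [Module.End.maxGenEigenspace_eq_genEigenspace_finrank] at this
    exact Module.End.mem_genEigenspace_nat.mp this
  set k := Nat.find hnil with hk
  have hk0 : ∀ u ∈ g.G i, (N ^ k) u = 0 := Nat.find_spec hnil
  have hkpos : 0 < k := by
    rw [Nat.pos_iff_ne_zero]
    intro h
    rw [h] at hk0
    exact hG ((Submodule.eq_bot_iff _).mpr hk0)
  -- any vector outside of the image of the nilpotent operator `N` is a cyclic generator
  obtain ⟨q, hq, hqN⟩ : ∃ q ∈ g.G i, q ∉ (g.G i).map N := by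
    by_contra! hcon
    have : ∀ r : ℕ, ∀ u ∈ g.G i, ∃ w ∈ g.G i, (N ^ r) w = u := by
      intro r
      induction r with
      | zero => exact fun u hu => ⟨u, hu, rfl⟩
      | succ r ih =>
        intro u hu
        obtain ⟨w, hw, rfl⟩ := ih u hu
        obtain ⟨w', hw', rfl⟩ := hcon w hw
        exact ⟨w', hw', by rw [pow_succ, Module.End.mul_apply]⟩
    refine hG ((Submodule.eq_bot_iff _).mpr fun u hu => ?_)
    obtain ⟨w, hw, rfl⟩ := this k u hu
    exact hk0 w hw
  -- the quotient of `G_i` by its image under `N` is one-dimensional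
  have hspan : ∀ u ∈ g.G i, ∃ c : F, ∃ w ∈ g.G i, u = c • q + N w := by
    intro u hu
    have hle : ∀ u ∈ g.G i, Submodule.span F {u} ⊔ (g.G i).map N ≤ g.G i := by
      intro u hu
      refine sup_le ((Submodule.span_singleton_le_iff_mem _ _).mpr hu) ?_
      rintro _ ⟨w, hw, rfl⟩
      exact hNG w hw
    have hA : ∀ u ∈ g.G i, ∀ y ∈ Submodule.span F {u} ⊔ (g.G i).map N,
        a.A y ∈ Submodule.span F {u} ⊔ (g.G i).map N := by
      intro u hu y hy
      rw [a.A_apply (g.wt i)]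
      refine Submodule.add_mem _ (Submodule.mem_sup_right ⟨y, hle u hu hy, rfl⟩)
        (Submodule.smul_mem _ _ hy)
    rcases g.chain_of_le ha (hle u hu) (hle q hq) (hA u hu) (hA q hq) with h | h
    · obtain ⟨y, hy, z, ⟨w, hw, rfl⟩, hyz⟩ := Submodule.mem_sup.mp
        (h (Submodule.mem_sup_left (Submodule.mem_span_singleton_self u)))
      obtain ⟨c, rfl⟩ := Submodule.mem_span_singleton.mp hy
      exact ⟨c, w, hw, hyz.symm⟩
    · obtain ⟨y, hy, z, ⟨w, hw, rfl⟩, hyz⟩ := Submodule.mem_sup.mp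
        (h (Submodule.mem_sup_left (Submodule.mem_span_singleton_self q)))
      obtain ⟨c, rfl⟩ := Submodule.mem_span_singleton.mp hy
      have hc : c ≠ 0 := by
        rintro rfl
        rw [zero_smul, zero_add] at hyz
        exact hqN ⟨w, hw, hyz⟩
      refine ⟨c⁻¹, -c⁻¹ • w, Submodule.smul_mem _ _ hw, ?_⟩
      rw [← hyz, map_smul, smul_add, inv_smul_smul₀ hc, neg_smul]
      abel
  have hqK : q ∉ LinearMap.range N ⊔ ⨆ j, ⨆ _ : j ≠ i, g.G j := by
    intro h
    obtain ⟨_, ⟨y, rfl⟩, z, hz, hyz⟩ := Submodule.mem_sup.mp h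
    have hz0 : g.proj i z = 0 := by
      have : (⨆ j, ⨆ _ : j ≠ i, g.G j) ≤ LinearMap.ker (g.proj i) :=
        iSup₂_le fun j hj u hu => g.proj_of_mem_ne hj.symm hu
      exact this hz
    have := congrArg (g.proj i) hyz
    rw [map_add, hz0, add_zero, g.proj_N, g.proj_of_mem hq] at this
    exact hqN ⟨_, g.proj_mem i y, this⟩
  obtain ⟨φ, hφq, hφ⟩ := Submodule.exists_le_ker_of_notMem hqK
  set π : U →ₗ[F] F := (φ q)⁻¹ • φ with hπ
  have hπq : π q = 1 := by
    rw [hπ, LinearMap.smul_apply, smul_eq_mul, inv_mul_cancel₀ hφq]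
  have hπN : ∀ u, π (N u) = 0 := by
    intro u
    have : φ (N u) = 0 := hφ (Submodule.mem_sup_left ⟨u, rfl⟩)
    rw [hπ, LinearMap.smul_apply, this, smul_zero]
  have hpow : ∀ u ∈ g.G i, (N ^ (k - 1)) u = π u • (N ^ (k - 1)) q := by
    intro u hu
    obtain ⟨c, w, hw, rfl⟩ := hspan u hu
    rw [map_add, map_add, map_smul, map_smul, hπN, hπq, ← Module.End.mul_apply, ← pow_succ,
      Nat.sub_add_cancel hkpos, hk0 w hw, add_zero, add_zero, smul_eq_mul, mul_one]
  have hs : (N ^ (k - 1)) q ≠ 0 := by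
    intro h
    refine Nat.find_min hnil (m := k - 1) (by omega) fun u hu => ?_
    rw [hpow u hu, h, smul_zero]
  have hsN : N ((N ^ (k - 1)) q) = 0 := by
    rw [← Module.End.mul_apply, ← pow_succ', Nat.sub_add_cancel hkpos, hk0 q hq]
  have hsG : (N ^ (k - 1)) q ∈ g.G i := a.N_pow_mem (g.A_mem i) _ _ hq
  refine ⟨{ k := k, q := q, π := π, k_pos := hkpos, q_mem := hq, N_pow := hk0,
            socle_ne_zero' := hs, exists_smul' := ?_, π_N := hπN, π_of_ne := ?_,
            N_pow_pred' := hpow }⟩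
  · -- lines in the kernel of `N` are `A`-stable, hence comparable, so that the kernel is a line
    intro u hu huN
    have hA : ∀ u, N u = 0 → ∀ y ∈ Submodule.span F {u}, a.A y ∈ Submodule.span F {u} := by
      intro u hu y hy
      obtain ⟨c, rfl⟩ := Submodule.mem_span_singleton.mp hy
      rw [map_smul, a.A_apply (g.wt i), ← hN, hu, zero_add]
      exact Submodule.smul_mem _ _ (Submodule.smul_mem _ _ (Submodule.mem_span_singleton_self u))
    rcases g.chain_of_le ha ((Submodule.span_singleton_le_iff_mem _ _).mpr hu)
      ((Submodule.span_singleton_le_iff_mem _ _).mpr hsG) (hA u huN) (hA _ hsN) with h | h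
    · obtain ⟨c, hc⟩ := Submodule.mem_span_singleton.mp (h (Submodule.mem_span_singleton_self u))
      exact ⟨c, hc.symm⟩
    · obtain ⟨c, hc⟩ := Submodule.mem_span_singleton.mp (h (Submodule.mem_span_singleton_self _))
      have hc0 : c ≠ 0 := by
        rintro rfl
        exact hs (by rw [← hc, zero_smul])
      exact ⟨c⁻¹, by rw [← hc, inv_smul_smul₀ hc0]⟩
  · intro j hj u hu
    have : φ u = 0 := hφ (Submodule.mem_sup_right
      (Submodule.mem_iSup_of_mem j (Submodule.mem_iSup_of_mem hj hu)))
    rw [hπ, LinearMap.smul_apply, this, smul_zero]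

namespace Layer

variable {g} {i : ℕ} (ℓ : g.Layer i)

/-- The operator `A - (β + iμ) 1`, of which `G_i` is the generalized kernel. -/
abbrev N (_ : g.Layer i) : End F U := a.N (g.wt i)

/-- The vector that spans the kernel of `N` in `G_i`. -/
def s : U := (ℓ.N ^ (ℓ.k - 1)) ℓ.q

theorem s_ne_zero : ℓ.s ≠ 0 := ℓ.socle_ne_zero'

theorem exists_smul {u : U} (hu : u ∈ g.G i) (h : ℓ.N u = 0) : ∃ c : F, u = c • ℓ.s :=
  ℓ.exists_smul' u hu h

theorem N_pow_pred {u : U} (hu : u ∈ g.G i) : (ℓ.N ^ (ℓ.k - 1)) u = ℓ.π u • ℓ.s :=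
  ℓ.N_pow_pred' u hu

theorem N_pow_mem (r : ℕ) {u : U} (hu : u ∈ g.G i) : (ℓ.N ^ r) u ∈ g.G i :=
  a.N_pow_mem (g.A_mem i) _ r hu

theorem s_mem : ℓ.s ∈ g.G i := ℓ.N_pow_mem _ ℓ.q_mem

theorem N_s : ℓ.N ℓ.s = 0 := by
  rw [s, ← Module.End.mul_apply, ← pow_succ', Nat.sub_add_cancel ℓ.k_pos, ℓ.N_pow _ ℓ.q_mem]

theorem A_s : a.A ℓ.s = g.wt i • ℓ.s := by
  rw [a.A_apply (g.wt i)]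
  change ℓ.N ℓ.s + _ = _
  rw [N_s, zero_add]

theorem π_q : ℓ.π ℓ.q = 1 := by
  have := ℓ.N_pow_pred ℓ.q_mem
  rw [← s] at this
  by_contra h
  have h' : (ℓ.π ℓ.q - 1) • ℓ.s = 0 := by rw [sub_smul, ← this, one_smul, sub_self]
  exact ℓ.s_ne_zero ((smul_eq_zero.mp h').resolve_left (sub_ne_zero.mpr h))

theorem π_A {u : U} : ℓ.π (a.A u) = g.wt i * ℓ.π u := by
  rw [a.A_apply (g.wt i), map_add, ℓ.π_N, zero_add, map_smul, smul_eq_mul]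

theorem π_proj (u : U) : ℓ.π (g.proj i u) = ℓ.π u := by
  refine g.induction (p := fun u => ℓ.π (g.proj i u) = ℓ.π u) (by simp)
    (fun u w hu hw => by simp only [map_add, hu, hw]) (fun j u hu => ?_) u
  by_cases h : i = j
  · subst h; rw [g.proj_of_mem hu]
  · rw [g.proj_of_mem_ne h hu, map_zero, ℓ.π_of_ne j (Ne.symm h) u hu]

/-- Any vector of `G_i` not in the kernel of `π` may serve as a cyclic generator. -/
def changeGenerator (e : U) (he : e ∈ g.G i) (hπ : ℓ.π e ≠ 0) : g.Layer i where
  k := ℓ.k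
  q := e
  π := (ℓ.π e)⁻¹ • ℓ.π
  k_pos := ℓ.k_pos
  q_mem := he
  N_pow := ℓ.N_pow
  socle_ne_zero' := by
    have := ℓ.N_pow_pred he
    rw [this]
    exact smul_ne_zero hπ ℓ.s_ne_zero
  exists_smul' := by
    intro u hu h
    obtain ⟨c, hc⟩ := ℓ.exists_smul hu h
    have h2 := ℓ.N_pow_pred he
    refine ⟨c * (ℓ.π e)⁻¹, ?_⟩
    rw [h2, smul_smul, mul_assoc, inv_mul_cancel₀ hπ, mul_one, hc]
  π_N u := by rw [LinearMap.smul_apply, ℓ.π_N, smul_zero]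
  π_of_ne j hj u hu := by rw [LinearMap.smul_apply, ℓ.π_of_ne j hj u hu, smul_zero]
  N_pow_pred' := by
    intro u hu
    have h1 := ℓ.N_pow_pred hu
    have h2 := ℓ.N_pow_pred he
    rw [h1, h2, LinearMap.smul_apply, smul_smul, smul_eq_mul, mul_right_comm,
      inv_mul_cancel₀ hπ, one_mul]

theorem linearIndependent : LinearIndependent F fun j : Fin ℓ.k => (ℓ.N ^ (j : ℕ)) ℓ.q :=
  linearIndependent_pow_apply _ (ℓ.N_pow _ ℓ.q_mem) ℓ.socle_ne_zero'

theorem span_eq : Submodule.span F (Set.range fun j : Fin ℓ.k => (ℓ.N ^ (j : ℕ)) ℓ.q) = g.G i := by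
  apply le_antisymm
  · rw [Submodule.span_le]
    rintro _ ⟨j, rfl⟩
    exact ℓ.N_pow_mem _ ℓ.q_mem
  · -- a vector `u` with `N^r u = 0` lies in the span of `q, N q, …`, by induction on `r`
    set C := Submodule.span F (Set.range fun j : Fin ℓ.k => (ℓ.N ^ (j : ℕ)) ℓ.q) with hC
    have key : ∀ r ≤ ℓ.k, ∀ u ∈ g.G i, (ℓ.N ^ r) u = 0 → u ∈ C := by
      intro r
      induction r with
      | zero => intro _ u _ h; rw [show u = 0 from h]; exact C.zero_mem
      | succ r ih =>
        intro hr u hu h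
        have h1 : ℓ.N ((ℓ.N ^ r) u) = 0 := by rw [← Module.End.mul_apply, ← pow_succ', h]
        obtain ⟨c, hc⟩ := ℓ.exists_smul (ℓ.N_pow_mem r hu) h1
        have h2 : u - c • (ℓ.N ^ (ℓ.k - 1 - r)) ℓ.q ∈ C := by
          apply ih (by omega) _ ((g.G i).sub_mem hu
            ((g.G i).smul_mem _ (ℓ.N_pow_mem _ ℓ.q_mem)))
          rw [map_sub, map_smul, ← Module.End.mul_apply, ← pow_add, hc,
            show r + (ℓ.k - 1 - r) = ℓ.k - 1 by omega, s, sub_self]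
        have h3 : c • (ℓ.N ^ (ℓ.k - 1 - r)) ℓ.q ∈ C :=
          C.smul_mem _ (Submodule.subset_span ⟨⟨ℓ.k - 1 - r, by omega⟩, rfl⟩)
        have := C.add_mem h2 h3
        rwa [sub_add_cancel] at this
    exact fun u hu => key ℓ.k le_rfl u hu (ℓ.N_pow u hu)

theorem finrank_eq : finrank F (g.G i) = ℓ.k := by
  rw [← ℓ.span_eq, finrank_span_eq_card ℓ.linearIndependent, Fintype.card_fin]

/-- Otherwise the vector `s` and the kernel of `π` on `G_{i+1}` would generate a submodule
incomparable with `G_{i+1} ⊕ G_{i+2} ⊕ ⋯`. -/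
theorem exists_π_ρ_ne_zero (ha : a.IsChain) (ℓ' : g.Layer (i + 1)) :
    ∃ v, ℓ'.π (a.ρ v ℓ.s) ≠ 0 := by
  by_contra! hcon
  set L := ⨆ j, ⨆ _ : i + 1 < j, g.G j with hL
  set K := g.G (i + 1) ⊓ LinearMap.ker ℓ'.π with hK
  have hLst := g.isStable_iSup (i + 1)
  have hKA : ∀ u ∈ K, a.A u ∈ K := by
    intro u hu
    refine ⟨g.A_mem _ u hu.1, ?_⟩
    change ℓ'.π (a.A u) = 0
    rw [ℓ'.π_A, show ℓ'.π u = 0 from hu.2, mul_zero]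
  have hs : ∀ v, a.ρ v ℓ.s ∈ K ⊔ L := by
    intro v
    refine g.mem_of_proj_mem fun l => ?_
    rcases Nat.lt_trichotomy l (i + 1) with h | h | h
    · rw [g.proj_ρ_of_le (by omega) v ℓ.s_mem]; exact Submodule.zero_mem _
    · subst h
      refine Submodule.mem_sup_left ⟨g.proj_mem _ _, ?_⟩
      change ℓ'.π (g.proj (i + 1) _) = 0
      rw [ℓ'.π_proj, hcon v]
    · exact Submodule.mem_sup_right (Submodule.mem_iSup_of_mem l
        (Submodule.mem_iSup_of_mem h (g.proj_mem l _)))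
  have hB : a.IsStable (Submodule.span F {ℓ.s} ⊔ (K ⊔ L)) := by
    refine ⟨fun u hu => ?_, fun v u hu => ?_⟩
    · obtain ⟨y, hy, z, hz, rfl⟩ := Submodule.mem_sup.mp hu
      obtain ⟨c, rfl⟩ := Submodule.mem_span_singleton.mp hy
      obtain ⟨z₁, hz₁, z₂, hz₂, rfl⟩ := Submodule.mem_sup.mp hz
      rw [map_add, map_add, map_smul, ℓ.A_s]
      exact Submodule.add_mem_sup (Submodule.smul_mem _ _ (Submodule.smul_mem _ _
        (Submodule.mem_span_singleton_self _)))
        (Submodule.add_mem_sup (hKA _ hz₁) (hLst.1 _ hz₂))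
    · obtain ⟨y, hy, z, hz, rfl⟩ := Submodule.mem_sup.mp hu
      obtain ⟨c, rfl⟩ := Submodule.mem_span_singleton.mp hy
      obtain ⟨z₁, hz₁, z₂, hz₂, rfl⟩ := Submodule.mem_sup.mp hz
      rw [map_add, map_add, map_smul]
      refine Submodule.mem_sup_right (Submodule.add_mem _ (Submodule.smul_mem _ _ (hs v))
        (Submodule.mem_sup_right (Submodule.add_mem _ (g.ρ_mem v _ _ hz₁.1) (hLst.2 v _ hz₂))))
  rcases ha _ _ hB (g.isStable_iSup i) with h | h
  · have h1 := g.proj_eq_zero_of_mem_iSup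
      (h (Submodule.mem_sup_left (Submodule.mem_span_singleton_self _)))
    rw [g.proj_of_mem ℓ.s_mem] at h1
    exact ℓ.s_ne_zero h1
  · have h1 : Submodule.span F {ℓ.s} ⊔ (K ⊔ L) ≤ LinearMap.ker ℓ'.π := by
      refine sup_le ?_ (sup_le inf_le_right ?_)
      · rw [Submodule.span_singleton_le_iff_mem, LinearMap.mem_ker]
        exact ℓ'.π_of_ne i (by omega) _ ℓ.s_mem
      · exact iSup₂_le fun j hj u hu => ℓ'.π_of_ne j (by omega) u hu
    have h2 : ℓ'.q ∈ ⨆ j, ⨆ _ : i < j, g.G j := Submodule.mem_iSup_of_mem (i + 1)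
      (Submodule.mem_iSup_of_mem (by omega) ℓ'.q_mem)
    have h3 : ℓ'.π ℓ'.q = 0 := h1 (h h2)
    rw [ℓ'.π_q] at h3
    exact one_ne_zero h3

/-- Only the vectors of weight `μ` contribute to the component of `ρ(v) s` in `G_{i+1}`. -/
theorem π_ρ_eq_zero_of_weight (ℓ' : g.Layer (i + 1)) {ν : F} (hν : ν ≠ g.μ) {v : V}
    (hv : v ∈ x.maxGenEigenspace ν) : ℓ'.π (a.ρ v ℓ.s) = 0 := by
  have h1 : a.ρ v ℓ.s ∈ a.A.maxGenEigenspace (g.wt i + ν) :=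
    a.ρ_mem_maxGenEigenspace rfl hv (g.le_maxGenEigenspace i ℓ.s_mem)
  rw [← ℓ'.π_proj, g.proj_eq_zero ?_ h1, map_zero]
  rw [g.wt_add, Nat.cast_one, one_mul]
  exact fun h => hν (add_left_cancel h)

theorem exists_weight_π_ρ_ne_zero [IsAlgClosed F] [FiniteDimensional F V] (ha : a.IsChain)
    (ℓ' : g.Layer (i + 1)) :
    ∃ v ∈ x.maxGenEigenspace g.μ, ℓ'.π (a.ρ v ℓ.s) ≠ 0 := by
  by_contra! hcon
  obtain ⟨v, hv⟩ := ℓ.exists_π_ρ_ne_zero ha ℓ'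
  apply hv
  have hv : v ∈ ⨆ ν, x.maxGenEigenspace ν := by
    rw [Module.End.iSup_maxGenEigenspace_eq_top]; trivial
  refine Submodule.iSup_induction _ (motive := fun v => ℓ'.π (a.ρ v ℓ.s) = 0) hv ?_ (by simp) ?_
  · intro ν v hv
    by_cases h : ν = g.μ
    · subst h; exact hcon v hv
    · exact ℓ.π_ρ_eq_zero_of_weight ℓ' h hv
  · intro v w hv hw
    rw [map_add, LinearMap.add_apply, map_add, hv, hw, add_zero]

end Layer
end Grading
end Action
end UniserialSolvable

namespace UniserialSolvable

variable {F : Type*} [Field F]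
variable {V U : Type*} [AddCommGroup V] [Module F V] [AddCommGroup U] [Module F U]

/-! ### The number of summands -/

namespace Action

variable {x : End F V} (a : Action x U) {β γ δ μ : F}

/-- On an eigenvector `s` of `A`, powers of `x - μ 1` become powers of `A - γ 1` applied to
`ρ(v) s`. -/
theorem ρ_pow_apply_of_N_eq_zero (h : γ = β + μ) (v : V) {s : U} (hs : a.N β s = 0) (j : ℕ) :
    a.ρ (((x - μ • (1 : End F V)) ^ j) v) s = (a.N γ ^ j) (a.ρ v s) := by
  induction j with
  | zero => rfl
  | succ j ih =>
    rw [pow_succ', pow_succ', Module.End.mul_apply, Module.End.mul_apply, ← ih, a.N_ρ h, hs,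
      map_zero, add_zero]

/-- Dually, under a left eigenvector `π` of `A`, powers of `x - μ 1` become powers of
`-(A - β 1)` applied before `ρ(v)`. -/
theorem apply_ρ_pow_of_comp_N_eq_zero (h : γ = β + μ) {π : U →ₗ[F] F} (hπ : ∀ u, π (a.N γ u) = 0)
    (v : V) (j : ℕ) (u : U) :
    π (a.ρ (((x - μ • (1 : End F V)) ^ j) v) u) = (-1) ^ j * π (a.ρ v ((a.N β ^ j) u)) := by
  induction j generalizing u with
  | zero => simp
  | succ j ih =>
    have h1 := congrArg π (a.N_ρ h (((x - μ • (1 : End F V)) ^ j) v) u)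
    rw [hπ, map_add, ih] at h1
    rw [pow_succ', Module.End.mul_apply, pow_succ (a.N β), Module.End.mul_apply, pow_succ]
    linear_combination -h1

/-- Moving a power of `A - γ` from one side of the commuting operators `ρ(v)` and `ρ(w)` to the
other produces a sign. -/
theorem apply_ρ_pow_ρ_swap (h : γ = β + μ) (h' : δ = γ + μ) {π : U →ₗ[F] F}
    (hπ : ∀ u, π (a.N δ u) = 0) {s : U} (hs : a.N β s = 0) (v w : V) (j : ℕ) :
    π (a.ρ w ((a.N γ ^ j) (a.ρ v s))) = (-1) ^ j * π (a.ρ v ((a.N γ ^ j) (a.ρ w s))) := by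
  rw [← a.ρ_pow_apply_of_N_eq_zero h v hs, a.comm, a.apply_ρ_pow_of_comp_N_eq_zero h' hπ]

/-- The formula of `apply_ρ_pow_of_comp_N_eq_zero` for a functional `r` one step above the left
eigenvector `π`. -/
theorem apply_ρ_pow_of_comp_N (h : γ = β + μ) {π r : U →ₗ[F] F} (hπ : ∀ u, π (a.N γ u) = 0)
    (hr : ∀ u, r (a.N γ u) = π u) (v : V) (j : ℕ) (u : U) :
    r (a.ρ (((x - μ • (1 : End F V)) ^ j) v) u) = (-1) ^ j *
      (r (a.ρ v ((a.N β ^ j) u)) - j * π (a.ρ v ((a.N β ^ (j - 1)) u))) := by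
  induction j generalizing u with
  | zero => simp
  | succ j ih =>
    have h1 := congrArg r (a.N_ρ h (((x - μ • (1 : End F V)) ^ j) v) u)
    rw [hr, map_add, ih, a.apply_ρ_pow_of_comp_N_eq_zero h hπ] at h1
    rw [pow_succ', Module.End.mul_apply, pow_succ (a.N β), Module.End.mul_apply, pow_succ,
      Nat.add_sub_cancel]
    rcases Nat.eq_zero_or_pos j with rfl | hj
    · simp only [Nat.cast_zero, zero_mul, sub_zero, pow_zero, Module.End.one_apply] at h1 ⊢
      push_cast
      linear_combination -h1
    · have h2 : (a.N β ^ (j - 1)) (a.N β u) = (a.N β ^ j) u := by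
        rw [← Module.End.mul_apply, ← pow_succ, Nat.sub_add_cancel hj]
      rw [h2] at h1
      push_cast
      linear_combination -h1

/-- The formula of `ρ_pow_apply_of_N_eq_zero` for a vector `s'` one step above the eigenvector
`s`. -/
theorem ρ_pow_apply_of_N_eq (h : γ = β + μ) (v : V) {s s' : U} (hs : a.N β s = 0)
    (hs' : a.N β s' = s) (j : ℕ) :
    a.ρ (((x - μ • (1 : End F V)) ^ j) v) s' =
      (a.N γ ^ j) (a.ρ v s') - (j : F) • (a.N γ ^ (j - 1)) (a.ρ v s) := by
  induction j with
  | zero => simp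
  | succ j ih =>
    have h1 := a.N_ρ h (((x - μ • (1 : End F V)) ^ j) v) s'
    rw [hs', ih, a.ρ_pow_apply_of_N_eq_zero h v hs, map_sub, map_smul, ← Module.End.mul_apply,
      ← pow_succ'] at h1
    rw [pow_succ', Module.End.mul_apply, Nat.add_sub_cancel, ← sub_eq_iff_eq_add.mpr h1]
    rcases Nat.eq_zero_or_pos j with rfl | hj
    · simp
    · have h2 : a.N γ ((a.N γ ^ (j - 1)) (a.ρ v s)) = (a.N γ ^ j) (a.ρ v s) := by
        rw [← Module.End.mul_apply, ← pow_succ', Nat.sub_add_cancel hj]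
      rw [h2]
      push_cast
      module

namespace Grading.Layer

variable {a} [CharZero F] {g : a.Grading} {i : ℕ}

theorem wt_succ (g : a.Grading) (i : ℕ) : g.wt (i + 1) = g.wt i + g.μ := by
  rw [g.wt_add, Nat.cast_one, one_mul]

theorem ρ_mem_succ {v : V} (hv : v ∈ x.maxGenEigenspace g.μ) {u : U} (hu : u ∈ g.G i) :
    a.ρ v u ∈ g.G (i + 1) := g.ρ_mem_of_weight hv hu (by rw [Nat.cast_one, one_mul])

section Three

variable (ℓ₀ : g.Layer i) (ℓ₁ : g.Layer (i + 1)) (ℓ₂ : g.Layer (i + 2))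

/-- The sign in `apply_ρ_pow_ρ_swap`, for the power of `A` that takes the generator of `G_{i+1}`
to its socle. -/
theorem π_ρ_mul_π_ρ {v w : V} (hv : v ∈ x.maxGenEigenspace g.μ)
    (hw : w ∈ x.maxGenEigenspace g.μ) :
    ℓ₁.π (a.ρ v ℓ₀.s) * ℓ₂.π (a.ρ w ℓ₁.s) =
      (-1) ^ (ℓ₁.k - 1) * (ℓ₁.π (a.ρ w ℓ₀.s) * ℓ₂.π (a.ρ v ℓ₁.s)) := by
  have h := a.apply_ρ_pow_ρ_swap (wt_succ g i) (wt_succ g (i + 1)) ℓ₂.π_N ℓ₀.N_s v w (ℓ₁.k - 1)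
  have h1 := ℓ₁.N_pow_pred (ρ_mem_succ hv ℓ₀.s_mem)
  have h2 := ℓ₁.N_pow_pred (ρ_mem_succ hw ℓ₀.s_mem)
  rw [h1, h2] at h
  simpa only [map_smul, smul_eq_mul] using h

theorem π_ρ_ne_zero_of_ne_zero {v w : V} (hv : v ∈ x.maxGenEigenspace g.μ)
    (hw : w ∈ x.maxGenEigenspace g.μ) (h1 : ℓ₁.π (a.ρ v ℓ₀.s) ≠ 0)
    (h2 : ℓ₂.π (a.ρ w ℓ₁.s) ≠ 0) : ℓ₂.π (a.ρ v ℓ₁.s) ≠ 0 := by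
  intro h
  have := π_ρ_mul_π_ρ ℓ₀ ℓ₁ ℓ₂ hv hw
  rw [h, mul_zero, mul_zero] at this
  exact mul_ne_zero h1 h2 this

/-- For even `k`, interchanging `v` with itself would change the sign of a nonzero number. -/
theorem odd_k {v : V} (hv : v ∈ x.maxGenEigenspace g.μ) (h1 : ℓ₁.π (a.ρ v ℓ₀.s) ≠ 0)
    (h2 : ℓ₂.π (a.ρ v ℓ₁.s) ≠ 0) : Odd ℓ₁.k := by
  by_contra hodd
  have ho : Odd (ℓ₁.k - 1) := by
    obtain ⟨r, hr⟩ := Nat.not_odd_iff_even.mp hodd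
    have := ℓ₁.k_pos
    exact ⟨r - 1, by omega⟩
  have h := π_ρ_mul_π_ρ ℓ₀ ℓ₁ ℓ₂ hv hv
  rw [ho.neg_one_pow] at h
  have h3 : (2 : F) * (ℓ₁.π (a.ρ v ℓ₀.s) * ℓ₂.π (a.ρ v ℓ₁.s)) = 0 := by linear_combination h
  exact mul_ne_zero two_ne_zero (mul_ne_zero h1 h2) h3

/-- If `k ≥ 2`, then `π` factors through `N`. -/
theorem exists_comp_N_eq_π [FiniteDimensional F U] {j : ℕ} (ℓ : g.Layer j) (hk : 2 ≤ ℓ.k) :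
    ∃ r : U →ₗ[F] F, ∀ u, r (ℓ.N u) = ℓ.π u := by
  have hmem : ℓ.π ∈ (LinearMap.ker ℓ.N).dualAnnihilator := by
    rw [Submodule.mem_dualAnnihilator]
    intro y hy
    have h1 : ℓ.N (g.proj j y) = 0 := by
      rw [← g.proj_N, show a.N (g.wt j) y = 0 from hy, map_zero]
    obtain ⟨c, hc⟩ := ℓ.exists_smul (g.proj_mem j y) h1
    have h2 : ℓ.s = ℓ.N ((ℓ.N ^ (ℓ.k - 2)) ℓ.q) := by
      rw [← Module.End.mul_apply, ← pow_succ', s]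
      congr 2; omega
    rw [← ℓ.π_proj, hc, h2, map_smul, ℓ.π_N, smul_zero]
  rw [← LinearMap.range_dualMap_eq_dualAnnihilator_ker] at hmem
  obtain ⟨r, hr⟩ := hmem
  exact ⟨r, fun u => LinearMap.congr_fun hr u⟩

/-- Otherwise `π` on `G_{i+2}` would factor through `N` by a functional `r`. The two ways of
evaluating `r(ρ((x - μ 1)^k v) ρ(v) s)`, with `k = dim G_{i+1}`, give `0` and a nonzero multiple
of `k`. -/
theorem k_eq_one_of_right [FiniteDimensional F U] {v : V} (hv : v ∈ x.maxGenEigenspace g.μ)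
    (h1 : ℓ₁.π (a.ρ v ℓ₀.s) ≠ 0) (h2 : ℓ₂.π (a.ρ v ℓ₁.s) ≠ 0) : ℓ₂.k = 1 := by
  by_contra hne
  obtain ⟨r, hr⟩ := ℓ₂.exists_comp_N_eq_π (by have := ℓ₂.k_pos; omega)
  have hm := ρ_mem_succ (g := g) hv ℓ₀.s_mem
  have h := a.apply_ρ_pow_of_comp_N (wt_succ g (i + 1)) ℓ₂.π_N hr v ℓ₁.k (a.ρ v ℓ₀.s)
  have e1 := ℓ₁.N_pow_pred hm
  have e2 := ℓ₁.N_pow _ hm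
  rw [a.comm, a.ρ_pow_apply_of_N_eq_zero (wt_succ g i) v ℓ₀.N_s, e2, e1, map_zero, map_zero,
    map_smul, map_smul, zero_sub, smul_eq_mul] at h
  have h3 := mul_ne_zero (pow_ne_zero ℓ₁.k (neg_ne_zero.mpr (one_ne_zero (α := F))))
    (neg_ne_zero.mpr (mul_ne_zero (Nat.cast_ne_zero.mpr ℓ₁.k_pos.ne') (mul_ne_zero h1 h2)))
  exact h3 h.symm

/-- The dual of `k_eq_one_of_right`, with a vector `s'` such that `N s' = s` in place of the
functional `r`. -/
theorem k_eq_one_of_left {v : V} (hv : v ∈ x.maxGenEigenspace g.μ)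
    (h1 : ℓ₁.π (a.ρ v ℓ₀.s) ≠ 0) (h2 : ℓ₂.π (a.ρ v ℓ₁.s) ≠ 0) : ℓ₀.k = 1 := by
  by_contra hne
  have hk := ℓ₀.k_pos
  set s' := (ℓ₀.N ^ (ℓ₀.k - 2)) ℓ₀.q with hs'
  have hs : ℓ₀.N s' = ℓ₀.s := by
    rw [hs', ← Module.End.mul_apply, ← pow_succ', s]
    congr 2; omega
  have hm' : s' ∈ g.G i := ℓ₀.N_pow_mem _ ℓ₀.q_mem
  have h := a.ρ_pow_apply_of_N_eq (wt_succ g i) v ℓ₀.N_s hs ℓ₁.k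
  have e1 := ℓ₁.N_pow_pred (ρ_mem_succ hv ℓ₀.s_mem)
  have e2 := ℓ₁.N_pow _ (ρ_mem_succ hv hm')
  rw [e1, e2, zero_sub] at h
  have h3 := congrArg (fun u => ℓ₂.π (a.ρ v u)) h
  rw [a.comm, a.apply_ρ_pow_of_comp_N_eq_zero (wt_succ g (i + 1)) ℓ₂.π_N, e2, map_zero, map_zero,
    mul_zero, map_neg, map_neg, map_smul, map_smul, map_smul, map_smul, smul_eq_mul,
    smul_eq_mul] at h3
  exact neg_ne_zero.mpr (mul_ne_zero (Nat.cast_ne_zero.mpr ℓ₁.k_pos.ne') (mul_ne_zero h1 h2))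
    h3.symm

/-- If three consecutive summands of the grading are nonzero, then the outer two are
one-dimensional and the middle one has odd dimension. -/
theorem three_layers [IsAlgClosed F] [FiniteDimensional F V] [FiniteDimensional F U]
    (ha : a.IsChain) : ℓ₀.k = 1 ∧ Odd ℓ₁.k ∧ ℓ₂.k = 1 := by
  obtain ⟨v, hv, h1⟩ := ℓ₀.exists_weight_π_ρ_ne_zero ha ℓ₁
  obtain ⟨w, hw, h2⟩ := ℓ₁.exists_weight_π_ρ_ne_zero ha ℓ₂
  have h3 := π_ρ_ne_zero_of_ne_zero ℓ₀ ℓ₁ ℓ₂ hv hw h1 h2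
  exact ⟨k_eq_one_of_left ℓ₀ ℓ₁ ℓ₂ hv h1 h3, odd_k ℓ₀ ℓ₁ ℓ₂ hv h1 h3,
    k_eq_one_of_right ℓ₀ ℓ₁ ℓ₂ hv h1 h3⟩

end Three

end Grading.Layer

namespace Grading

variable {a} [CharZero F] (g : a.Grading)

/-- If `A` is semisimple and the module is faithful, then `x` is semisimple. -/
theorem sub_apply_eq_zero_of_semisimple (hρ : Function.Injective a.ρ)
    (h : ∀ i, ∀ u ∈ g.G i, a.N (g.wt i) u = 0) {ν : F} {v : V}
    (hv : v ∈ x.maxGenEigenspace ν) : (x - ν • (1 : End F V)) v = 0 := by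
  apply hρ
  rw [map_zero]
  ext u
  refine g.induction (p := fun u => a.ρ ((x - ν • (1 : End F V)) v) u = 0) (map_zero _)
    (fun u w hu hw => by rw [map_add, hu, hw, add_zero]) (fun i u hu => ?_) u
  have h1 := a.N_ρ (γ := g.wt i + ν) rfl v u
  rw [h i u hu, map_zero, add_zero] at h1
  rw [← h1]
  have h2 : a.ρ v u ∈ a.A.maxGenEigenspace (g.wt i + ν) :=
    a.ρ_mem_maxGenEigenspace rfl hv (g.le_maxGenEigenspace i hu)
  refine (Submodule.mem_bot F).mp (g.mem_of_proj_mem fun l => ?_)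
  rw [Submodule.mem_bot, g.proj_N]
  by_cases hl : g.wt i + ν = g.wt l
  · rw [hl]; exact h l _ (g.proj_mem l _)
  · rw [g.proj_eq_zero hl h2, map_zero]

/-- If some weight vector of `V` is not an eigenvector of `x`, then the grading has two summands,
or three summands of dimensions `1`, `k` and `1`, where `k` is odd. -/
theorem two_or_three [IsAlgClosed F] [FiniteDimensional F V] [FiniteDimensional F U]
    (ha : a.IsChain) (hρ : Function.Injective a.ρ) {ν : F} {v : V}
    (hv : v ∈ x.maxGenEigenspace ν) (hne : (x - ν • (1 : End F V)) v ≠ 0) :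
    g.G 2 = ⊥ ∨ (g.G 3 = ⊥ ∧ g.G 2 ≠ ⊥ ∧ ∀ (ℓ₀ : g.Layer 0) (ℓ₁ : g.Layer 1) (ℓ₂ : g.Layer 2),
      ℓ₀.k = 1 ∧ Odd ℓ₁.k ∧ ℓ₂.k = 1) := by
  rcases eq_or_ne (g.G 2) ⊥ with h2 | h2
  · exact Or.inl h2
  · refine Or.inr ⟨?_, h2, fun ℓ₀ ℓ₁ ℓ₂ => Layer.three_layers ℓ₀ ℓ₁ ℓ₂ ha⟩
    by_contra h3
    apply hne
    -- with four summands, all of them are one-dimensional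
    have hk : ∀ i (ℓ : g.Layer i), ℓ.k = 1 := by
      intro i ℓ
      have hi : g.G i ≠ ⊥ := by
        intro h
        have := ℓ.q_mem
        rw [h, Submodule.mem_bot] at this
        exact ℓ.socle_ne_zero' (by rw [this, map_zero])
      rcases Nat.lt_or_ge i 2 with hi2 | hi2
      · obtain ⟨ℓ₁⟩ := g.nonempty_layer ha (g.ne_bot_of_le (by omega : i + 1 ≤ 3) h3)
        obtain ⟨ℓ₂⟩ := g.nonempty_layer ha (g.ne_bot_of_le (by omega : i + 2 ≤ 3) h3)
        exact (Layer.three_layers ℓ ℓ₁ ℓ₂ ha).1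
      · obtain ⟨i, rfl⟩ := Nat.exists_eq_add_of_le' hi2
        obtain ⟨ℓ₀⟩ := g.nonempty_layer ha (g.ne_bot_of_le (by omega : i ≤ i + 2) hi)
        obtain ⟨ℓ₁⟩ := g.nonempty_layer ha (g.ne_bot_of_le (by omega : i + 1 ≤ i + 2) hi)
        exact (Layer.three_layers ℓ₀ ℓ₁ ℓ ha).2.2
    refine g.sub_apply_eq_zero_of_semisimple hρ (fun i u hu => ?_) hv
    rcases eq_or_ne (g.G i) ⊥ with h | h
    · rw [h, Submodule.mem_bot] at hu
      rw [hu, map_zero]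
    · obtain ⟨ℓ⟩ := g.nonempty_layer ha h
      have := ℓ.N_pow u hu
      rwa [hk i ℓ, pow_one] at this

end Grading
end Action
end UniserialSolvable

namespace UniserialSolvable

variable {F : Type*} [Field F]

/-! ### Coordinates on the summands -/

theorem upperJordan_mulVec_apply {p : ℕ} (α : F) (w : Fin p → F) (i : Fin p) :
    (upperJordan p α).mulVec w i = α * w i + if h : (i : ℕ) + 1 < p then w ⟨i + 1, h⟩ else 0 := by
  have := upperJordan_mul_apply α (Matrix.of fun i (_ : Fin 1) => w i) i 0
  rw [Matrix.mul_apply] at this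
  exact this

section Actions

variable {V U : Type*} [AddCommGroup V] [Module F V] [AddCommGroup U] [Module F U]

namespace Action

variable {x : End F V} (a : Action x U)

/-- The binomial formula for `ρ((x - μ 1)^r v)`. -/
theorem ρ_pow_eq_sum {β γ μ : F} (h : γ = β + μ) (r : ℕ) (v : V) (u : U) :
    a.ρ (((x - μ • (1 : End F V)) ^ r) v) u = ∑ m ∈ Finset.range (r + 1),
      ((-1) ^ (r - m) * (r.choose m : F)) • (a.N γ ^ m) (a.ρ v ((a.N β ^ (r - m)) u)) := by
  have h1 : ∀ r : ℕ, a.ρ (((x - μ • (1 : End F V)) ^ r) v) =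
      ((LinearMap.mulLeft F (a.N γ) + (-1 : F) • LinearMap.mulRight F (a.N β)) ^ r) (a.ρ v) := by
    intro r
    induction r with
    | zero => rfl
    | succ r ih =>
      rw [pow_succ', pow_succ', Module.End.mul_apply, Module.End.mul_apply, ← ih]
      ext u
      have := a.N_ρ h (((x - μ • (1 : End F V)) ^ r) v) u
      rw [← sub_eq_iff_eq_add] at this
      rw [← this, sub_eq_add_neg, LinearMap.add_apply, LinearMap.smul_apply, neg_one_smul]
      rfl
  have hc : Commute (LinearMap.mulLeft F (a.N γ)) ((-1 : F) • LinearMap.mulRight F (a.N β)) :=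
    (LinearMap.commute_mulLeft_right _ _).smul_right _
  rw [h1, hc.add_pow, LinearMap.sum_apply, LinearMap.sum_apply]
  refine Finset.sum_congr rfl fun m _ => ?_
  rw [smul_pow, LinearMap.pow_mulLeft, LinearMap.pow_mulRight, Module.End.mul_apply,
    Module.End.natCast_apply, map_nsmul, Module.End.mul_apply, LinearMap.smul_apply,
    LinearMap.smul_apply, map_smul, LinearMap.smul_apply, mul_smul, Nat.cast_smul_eq_nsmul,
    smul_comm]
  rfl

namespace Grading

variable {a} [CharZero F] (g : a.Grading)

theorem sup_range_inf (m : ℕ) : (Finset.range m).sup g.G ⊓ g.G m = ⊥ := by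
  rw [Submodule.eq_bot_iff]
  rintro u ⟨h1, h2⟩
  have hle : (Finset.range m).sup g.G ≤ LinearMap.ker (g.proj m) := by
    refine Finset.sup_le fun j hj w hw => ?_
    exact g.proj_of_mem_ne (by have := Finset.mem_range.mp hj; omega) hw
  rw [← g.proj_of_mem h2]
  exact hle h1

theorem finrank_eq_sum [FiniteDimensional F U] {m : ℕ} (hm : g.G m = ⊥) :
    finrank F U = ∑ i ∈ Finset.range m, finrank F (g.G i) := by
  have h1 : ∀ m, finrank F ((Finset.range m).sup g.G : Submodule F U) =
      ∑ i ∈ Finset.range m, finrank F (g.G i) := by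
    intro m
    induction m with
    | zero => rw [Finset.range_zero, Finset.sup_empty, Finset.sum_empty, finrank_bot]
    | succ m ih =>
      rw [Finset.sum_range_succ, ← ih, Finset.range_add_one, Finset.sup_insert, sup_comm]
      have := Submodule.finrank_sup_add_finrank_inf_eq ((Finset.range m).sup g.G) (g.G m)
      rw [g.sup_range_inf, finrank_bot, add_zero] at this
      exact this
  have htop : (Finset.range m).sup g.G = ⊤ := by
    rw [eq_top_iff, ← g.iSup_eq_top]
    refine iSup_le fun i => ?_
    rcases Nat.lt_or_ge i m with h | h
    · exact Finset.le_sup (f := g.G) (Finset.mem_range.mpr h)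
    · rw [g.eq_bot_of_le h hm]; exact bot_le
  rw [← h1, htop, finrank_top]

namespace Layer

variable {g} {i : ℕ} (ℓ : g.Layer i)

theorem N_pow_of_le {r : ℕ} (hr : ℓ.k ≤ r) {u : U} (hu : u ∈ g.G i) : (ℓ.N ^ r) u = 0 := by
  rw [← Nat.sub_add_cancel hr, pow_add, Module.End.mul_apply, ℓ.N_pow u hu, map_zero]

/-- The last coordinate functional with respect to the basis `q, N q, …`. -/
theorem exists_functional : ∃ φ : U →ₗ[F] F,
    (∀ j, j < ℓ.k → φ ((ℓ.N ^ j) ℓ.q) = if j + 1 = ℓ.k then 1 else 0) ∧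
      ∀ u, φ (g.proj i u) = φ u := by
  obtain ⟨f, hf⟩ := LinearMap.exists_leftInverse_of_injective
    (Fintype.linearCombination F fun j : Fin ℓ.k => (ℓ.N ^ (j : ℕ)) ℓ.q)
    (LinearMap.ker_eq_bot.mpr ℓ.linearIndependent.fintypeLinearCombination_injective)
  have hk := ℓ.k_pos
  refine ⟨(LinearMap.proj ⟨ℓ.k - 1, by omega⟩ : (Fin ℓ.k → F) →ₗ[F] F) ∘ₗ f ∘ₗ g.proj i,
    fun j hj => ?_, fun u => ?_⟩
  · have h := LinearMap.congr_fun hf (Pi.single ⟨j, hj⟩ 1)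
    rw [LinearMap.comp_apply, Fintype.linearCombination_apply_single, one_smul] at h
    rw [LinearMap.comp_apply, LinearMap.comp_apply, g.proj_of_mem (ℓ.N_pow_mem j ℓ.q_mem)]
    simp only at h
    rw [h]
    simp only [LinearMap.id_apply, LinearMap.proj_apply, Pi.single_apply, Fin.mk.injEq]
    refine if_congr ?_ rfl rfl
    omega
  · simp only [LinearMap.comp_apply, g.proj_of_mem (g.proj_mem i u)]

theorem apply_N_pow_k {φ : U →ₗ[F] F} (hφ : ∀ u, φ (g.proj i u) = φ u) (u : U) :
    φ ((ℓ.N ^ ℓ.k) u) = 0 := by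
  have hpow : ∀ r u, g.proj i ((ℓ.N ^ r) u) = (ℓ.N ^ r) (g.proj i u) := by
    intro r
    induction r with
    | zero => exact fun u => rfl
    | succ r ih =>
      intro u
      rw [pow_succ', Module.End.mul_apply, Module.End.mul_apply, g.proj_N, ih]
  rw [← hφ, hpow, ℓ.N_pow _ (g.proj_mem i u), map_zero]

/-- The coordinates `φ(N^j u)` turn `A` into an upper triangular Jordan block. -/
theorem coordinates_A {φ : U →ₗ[F] F} (hφ : ∀ u, φ (g.proj i u) = φ u) {p : ℕ} (hp : p = ℓ.k)
    (u : U) : (fun j : Fin p => φ ((ℓ.N ^ (j : ℕ)) (a.A u))) =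
      (upperJordan p (g.wt i)).mulVec fun j : Fin p => φ ((ℓ.N ^ (j : ℕ)) u) := by
  funext j
  have hj := j.2
  rw [upperJordan_mulVec_apply, a.A_apply (g.wt i), map_add, map_smul, map_add, map_smul,
    smul_eq_mul, add_comm]
  congr 1
  change φ ((ℓ.N ^ (j : ℕ)) (ℓ.N u)) = _
  rw [← Module.End.mul_apply, ← pow_succ]
  by_cases h : (j : ℕ) + 1 < p
  · rw [dif_pos h]
  · rw [dif_neg h, show (j : ℕ) + 1 = ℓ.k by omega, ℓ.apply_N_pow_k hφ]

/-- A vector of `G_i` vanishes if a functional that is nonzero on the socle kills all its images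
under powers of `N`. -/
theorem eq_zero_of_coordinates {φ : U →ₗ[F] F} (hφ : φ ℓ.s ≠ 0) {u : U} (hu : u ∈ g.G i)
    (h : ∀ j, j < ℓ.k → φ ((ℓ.N ^ j) u) = 0) : u = 0 := by
  have key : ∀ r, r ≤ ℓ.k → (ℓ.N ^ (ℓ.k - r)) u = 0 := by
    intro r
    induction r with
    | zero => intro _; exact ℓ.N_pow u hu
    | succ r ih =>
      intro hr
      have h1 : ℓ.N ((ℓ.N ^ (ℓ.k - (r + 1))) u) = 0 := by
        rw [← Module.End.mul_apply, ← pow_succ', show ℓ.k - (r + 1) + 1 = ℓ.k - r by omega]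
        exact ih (by omega)
      obtain ⟨c, hc⟩ := ℓ.exists_smul (ℓ.N_pow_mem _ hu) h1
      have h2 := h (ℓ.k - (r + 1)) (by omega)
      rw [hc, map_smul, smul_eq_mul] at h2
      rw [hc, (mul_eq_zero.mp h2).resolve_right hφ, zero_smul]
  have := key ℓ.k le_rfl
  rwa [Nat.sub_self, pow_zero] at this

end Layer

/-! ### Two summands -/

section Two

/-- Only the operators from `G_0` to `G_1` are nonzero. -/
theorem ρ_eq_zero_of_pos (h2 : g.G 2 = ⊥) (v : V) {i : ℕ} (hi : 0 < i) {u : U} (hu : u ∈ g.G i) :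
    a.ρ v u = 0 := by
  refine (Submodule.mem_bot F).mp (g.mem_of_proj_mem fun l => ?_)
  rcases Nat.lt_or_ge i l with h | h
  · rw [← g.eq_bot_of_le (by omega : 2 ≤ l) h2]; exact g.proj_mem l _
  · rw [g.proj_ρ_of_le h v hu]; exact Submodule.zero_mem _

theorem ρ_mem_one (h2 : g.G 2 = ⊥) (v : V) {u : U} (hu : u ∈ g.G 0) : a.ρ v u ∈ g.G 1 := by
  refine g.mem_of_proj_mem fun l => ?_
  rcases Nat.lt_trichotomy l 1 with h | h | h
  · rw [g.proj_ρ_of_le (by omega) v hu]; exact Submodule.zero_mem _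
  · subst h; exact g.proj_mem _ _
  · have := g.proj_mem l (a.ρ v u)
    rw [g.eq_bot_of_le (by omega : 2 ≤ l) h2, Submodule.mem_bot] at this
    rw [this]; exact Submodule.zero_mem _

theorem ρ_eq_zero_of_zero (h2 : g.G 2 = ⊥) (v : V) (h : ∀ u ∈ g.G 0, a.ρ v u = 0) :
    a.ρ v = 0 := by
  ext u
  refine g.induction (p := fun u => a.ρ v u = 0) (map_zero _)
    (fun u w hu hw => by rw [map_add, hu, hw, add_zero]) (fun i u hu => ?_) u
  rcases Nat.eq_zero_or_pos i with rfl | hi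
  · exact h u hu
  · exact g.ρ_eq_zero_of_pos h2 v hi hu

variable (ℓ₀ : g.Layer 0) (ℓ₁ : g.Layer 1)

theorem wt_one : g.wt 1 = g.wt 0 + g.μ := Layer.wt_succ g 0

/-- The powers of `x - μ 1` vanish from the exponent `dim G_0 + dim G_1 - 1` on. -/
theorem ρ_pow_eq_zero (h2 : g.G 2 = ⊥) (v : V) {r : ℕ} (hr : ℓ₀.k + ℓ₁.k ≤ r + 1) :
    a.ρ (((x - g.μ • (1 : End F V)) ^ r) v) = 0 := by
  refine g.ρ_eq_zero_of_zero h2 _ fun u hu => ?_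
  rw [a.ρ_pow_eq_sum g.wt_one]
  refine Finset.sum_eq_zero fun m hm => ?_
  have hm' := Finset.mem_range.mp hm
  rcases Nat.lt_or_ge m ℓ₁.k with h | h
  · have := ℓ₀.N_pow_of_le (r := r - m) (by omega) hu
    rw [this, map_zero, map_zero, smul_zero]
  · have := ℓ₁.N_pow_of_le h (g.ρ_mem_one h2 v (ℓ₀.N_pow_mem (r - m) hu))
    rw [this, smul_zero]

/-- For `r = dim G_0 + dim G_1 - 2`, the vector `(x - μ 1)^r v` takes `G_0` to the socle of `G_1`:
a single term of the binomial formula survives, and its coefficient is nonzero in characteristic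
`0`. -/
theorem exists_ρ_pow_eq (h2 : g.G 2 = ⊥) : ∃ c : F, c ≠ 0 ∧ ∀ v, ∀ u ∈ g.G 0,
    a.ρ (((x - g.μ • (1 : End F V)) ^ (ℓ₀.k + ℓ₁.k - 2)) v) u =
      (c * ℓ₀.π u * ℓ₁.π (a.ρ v ℓ₀.s)) • ℓ₁.s := by
  have hk0 := ℓ₀.k_pos
  have hk1 := ℓ₁.k_pos
  refine ⟨(-1) ^ (ℓ₀.k - 1) * ((ℓ₀.k + ℓ₁.k - 2).choose (ℓ₁.k - 1) : F),
    mul_ne_zero (pow_ne_zero _ (neg_ne_zero.mpr one_ne_zero))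
      (Nat.cast_ne_zero.mpr (Nat.choose_pos (by omega)).ne'), fun v u hu => ?_⟩
  rw [a.ρ_pow_eq_sum g.wt_one, Finset.sum_eq_single (ℓ₁.k - 1)]
  · rw [show ℓ₀.k + ℓ₁.k - 2 - (ℓ₁.k - 1) = ℓ₀.k - 1 by omega]
    have h3 := ℓ₀.N_pow_pred hu
    have h4 := ℓ₁.N_pow_pred (g.ρ_mem_one h2 v ℓ₀.s_mem)
    rw [h3, map_smul, map_smul, h4, smul_smul, smul_smul]
  · intro m hm hne
    have hm' := Finset.mem_range.mp hm
    rcases Nat.lt_or_ge m ℓ₁.k with h | h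
    · have := ℓ₀.N_pow_of_le (r := ℓ₀.k + ℓ₁.k - 2 - m) (by omega) hu
      rw [this, map_zero, map_zero, smul_zero]
    · have := ℓ₁.N_pow_of_le h (g.ρ_mem_one h2 v (ℓ₀.N_pow_mem (ℓ₀.k + ℓ₁.k - 2 - m) hu))
      rw [this, smul_zero]
  · intro h
    exact absurd (Finset.mem_range.mpr (by omega)) h

end Two

end Grading
end Action
end Actions
end UniserialSolvable

namespace UniserialSolvable

variable {F : Type*} [Field F]

/-! ### Coordinates on a module with two summands -/

section Actions

variable {V U : Type*} [AddCommGroup V] [Module F V] [AddCommGroup U] [Module F U]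
variable {x : End F V} {e : ℕ}

theorem JordanDecomposition.mem_maxGenEigenspace (D : JordanDecomposition x e) (i : Fin e) {v : V}
    (hv : v ∈ D.block i) : v ∈ x.maxGenEigenspace (D.eigenvalue i) :=
  (Module.End.mem_maxGenEigenspace _ _ _).mpr ⟨D.size i, D.sub_pow_of_mem i hv le_rfl⟩

variable [NeZero e]

namespace Action

variable {a : Action x U} [IsAlgClosed F] [CharZero F] [FiniteDimensional F V]
  [FiniteDimensional F U]

namespace Grading

variable (g : a.Grading)

section Two

variable (D : JordanDecomposition x e) (hρ : Function.Injective a.ρ) (h2 : g.G 2 = ⊥)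

include hρ h2

/-- Vectors of a weight other than `μ` would act as zero. -/
theorem eigenvalue_eq_of_two (i : Fin e) : D.eigenvalue i = g.μ := by
  by_contra hne
  apply D.basis_ne_zero i ⟨0, D.size_pos i⟩
  apply hρ
  rw [map_zero]
  refine g.ρ_eq_zero_of_zero h2 _ fun u hu => ?_
  refine g.ρ_eq_zero_of_weight (D.mem_maxGenEigenspace i (Subtype.mem _)) hu ?_
  intro j hj hG h
  rcases Nat.lt_or_ge j 2 with hj2 | hj2
  · obtain rfl : j = 1 := by omega
    rw [Nat.cast_one, one_mul] at h
    exact hne h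
  · exact hG (g.eq_bot_of_le (by omega) h2)

variable (ℓ₀ : g.Layer 0) (ℓ₁ : g.Layer 1)

/-- The size of the largest Jordan block of `x` is one less than the dimension of the module, and
the generator of the first block does not annihilate the socle of `G_0`. -/
theorem size_add_one_and_π_ρ_ne_zero_of_two (ha : a.IsChain) :
    D.size 0 + 1 = ℓ₀.k + ℓ₁.k ∧
      ℓ₁.π (a.ρ (D.basis 0 ⟨0, D.size_pos 0⟩ : V) ℓ₀.s) ≠ 0 := by
  have hD := g.eigenvalue_eq_of_two D hρ h2
  have hD' : ∀ i, D.eigenvalue i = D.eigenvalue 0 := fun i => (hD i).trans (hD 0).symm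
  have hk0 := ℓ₀.k_pos
  have hk1 := ℓ₁.k_pos
  have hn := D.size_pos 0
  obtain ⟨c, hc, hcv⟩ := g.exists_ρ_pow_eq ℓ₀ ℓ₁ h2
  have hle : ℓ₀.k + ℓ₁.k - 2 < D.size 0 := by
    by_contra hlt
    obtain ⟨v, hv⟩ := ℓ₀.exists_π_ρ_ne_zero ha ℓ₁
    have h1 := hcv v ℓ₀.q ℓ₀.q_mem
    have h3 : (x - g.μ • (1 : End F V)) ^ (ℓ₀.k + ℓ₁.k - 2) = 0 := by
      rw [← hD 0, ← Nat.sub_add_cancel (not_lt.mp hlt), pow_add, D.sub_pow_eq_zero hD', mul_zero]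
    rw [h3, LinearMap.zero_apply, map_zero, LinearMap.zero_apply, ℓ₀.π_q, mul_one] at h1
    exact smul_ne_zero (mul_ne_zero hc hv) ℓ₁.s_ne_zero h1.symm
  have hlast : a.ρ (((x - g.μ • (1 : End F V)) ^ (D.size 0 - 1))
      (D.basis 0 ⟨0, D.size_pos 0⟩ : V)) ≠ 0 := by
    rw [← hD 0, D.sub_pow_basis, dif_pos (by simp only; omega)]
    intro h
    exact D.basis_ne_zero 0 _ (hρ (h.trans (map_zero _).symm))
  have hge : D.size 0 + 1 ≤ ℓ₀.k + ℓ₁.k := by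
    by_contra hlt
    exact hlast (g.ρ_pow_eq_zero ℓ₀ ℓ₁ h2 _ (by omega))
  refine ⟨by omega, fun h => hlast (g.ρ_eq_zero_of_zero h2 _ fun u hu => ?_)⟩
  rw [show D.size 0 - 1 = ℓ₀.k + ℓ₁.k - 2 by omega, hcv _ u hu, h, mul_zero, zero_smul]

/-- Coordinates in which `A` is `J^k(α) ⊕ J^{n+1-k}(α-λ)` and the upper right block of `ρ(v_0)` has
the last row and first column of `(0, X), (1, 0)`. -/
theorem exists_coordinates_of_two (ha : a.IsChain) {k : ℕ} (hk : k = ℓ₁.k) :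
    1 ≤ k ∧ k ≤ D.size 0 ∧ ∃ T : U ≃ₗ[F] (Fin k ⊕ Fin (D.size 0 + 1 - k) → F),
      (∀ u, T (a.A u) = (twoBlocks k (D.size 0 + 1 - k) (g.wt 1) g.μ).mulVec (T u)) ∧
      (∀ u (i : Fin k) (j : Fin (D.size 0 + 1 - k)), (i : ℕ) + 1 = k → (j : ℕ) = 0 →
        T (a.ρ (D.basis 0 ⟨0, D.size_pos 0⟩ : V) u) (Sum.inl i) = T u (Sum.inr j)) ∧
      ∃ s : U, (∀ i, T s (Sum.inl i) = 0) ∧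
        (∀ j, T s (Sum.inr j) = if (j : ℕ) = 0 then 1 else 0) ∧
        ∀ i : Fin k, T (a.ρ (D.basis 0 ⟨0, D.size_pos 0⟩ : V) s) (Sum.inl i) =
          if (i : ℕ) + 1 = k then 1 else 0 := by
  obtain ⟨ℓ₀⟩ := g.nonempty_layer ha (g.ne_bot_of_le zero_le_one g.one_ne_bot)
  obtain ⟨hsize, hπ⟩ := g.size_add_one_and_π_ρ_ne_zero_of_two D hρ h2 ℓ₀ ℓ₁ ha
  set v₀ := (D.basis 0 ⟨0, D.size_pos 0⟩ : V) with hv₀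
  have hk0 := ℓ₀.k_pos
  have hk1 := ℓ₁.k_pos
  refine ⟨by omega, by omega, ?_⟩
  have hem := g.ρ_mem_one h2 v₀ ℓ₀.s_mem
  -- the image of the socle of `G_0` under `v₀` becomes the generator of `G_1`, and the last
  -- coordinate `φ` on `G_1` is pulled back along `v₀` to a coordinate `ψ` on `G_0`
  set ℓ := ℓ₁.changeGenerator (a.ρ v₀ ℓ₀.s) hem hπ with hℓ
  have hkℓ : ℓ.k = k := hk.symm
  obtain ⟨φ, hφ, hφp⟩ := ℓ.exists_functional
  have hφs : φ ℓ.s = 1 := by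
    rw [Layer.s, hφ _ (by omega), if_pos (by omega)]
  set ψ : U →ₗ[F] F := φ ∘ₗ (ℓ.N ^ (k - 1)) ∘ₗ a.ρ v₀ with hψ
  have hψ_pos : ∀ i, 0 < i → ∀ u ∈ g.G i, ψ u = 0 := by
    intro i hi u hu
    rw [hψ, LinearMap.comp_apply, LinearMap.comp_apply, g.ρ_eq_zero_of_pos h2 v₀ hi hu, map_zero,
      map_zero]
  have hψp : ∀ u, ψ (g.proj 0 u) = ψ u := by
    refine g.induction (p := fun u => ψ (g.proj 0 u) = ψ u) (by simp)
      (fun u w hu hw => by simp only [map_add, hu, hw]) (fun i u hu => ?_)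
    rcases Nat.eq_zero_or_pos i with rfl | hi
    · rw [g.proj_of_mem hu]
    · rw [hψ_pos i hi u hu, g.proj_of_mem_ne hi.ne hu, map_zero]
  have hφ0 : ∀ u ∈ g.G 0, ∀ j, φ ((ℓ.N ^ j) u) = 0 := by
    intro u hu j
    rw [← hφp, g.proj_of_mem_ne one_ne_zero (a.N_pow_mem (g.A_mem 0) _ j hu), map_zero]
  have hψs : ψ ℓ₀.s = 1 := by
    rw [hψ, LinearMap.comp_apply, LinearMap.comp_apply, ← hkℓ]
    exact hφs
  set q := D.size 0 + 1 - k with hq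
  have hqk : q = ℓ₀.k := by omega
  set T₀ : U →ₗ[F] (Fin k ⊕ Fin q → F) := LinearMap.pi (Sum.elim
    (fun j : Fin k => φ ∘ₗ ℓ.N ^ (j : ℕ)) (fun j : Fin q => ψ ∘ₗ ℓ₀.N ^ (j : ℕ))) with hT₀
  have hTl : ∀ u (j : Fin k), T₀ u (Sum.inl j) = φ ((ℓ.N ^ (j : ℕ)) u) := fun u j => rfl
  have hTr : ∀ u (j : Fin q), T₀ u (Sum.inr j) = ψ ((ℓ₀.N ^ (j : ℕ)) u) := fun u j => rfl
  have hproj : ∀ (γ : F) (i r : ℕ) u, g.proj i ((a.N γ ^ r) u) = (a.N γ ^ r) (g.proj i u) := by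
    intro γ i r
    induction r with
    | zero => exact fun u => rfl
    | succ r ih =>
      intro u
      rw [pow_succ', Module.End.mul_apply, Module.End.mul_apply, g.proj_N, ih]
  have hinj : Function.Injective T₀ := by
    rw [← LinearMap.ker_eq_bot, LinearMap.ker_eq_bot']
    intro u hu
    have h1 : g.proj 1 u = 0 := by
      refine ℓ.eq_zero_of_coordinates (φ := φ) (by rw [hφs]; exact one_ne_zero) (g.proj_mem 1 u)
        fun j hj => ?_
      rw [← hproj, hφp, ← hTl u ⟨j, by omega⟩, hu]; rfl
    have h0 : g.proj 0 u = 0 := by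
      refine ℓ₀.eq_zero_of_coordinates (φ := ψ) (by rw [hψs]; exact one_ne_zero) (g.proj_mem 0 u)
        fun j hj => ?_
      rw [← hproj, hψp, ← hTr u ⟨j, by omega⟩, hu]; rfl
    refine (Submodule.mem_bot F).mp (g.mem_of_proj_mem fun i => ?_)
    rcases Nat.lt_or_ge i 2 with hi | hi
    · interval_cases i
      · rw [h0]; exact Submodule.zero_mem _
      · rw [h1]; exact Submodule.zero_mem _
    · rw [← g.eq_bot_of_le hi h2]; exact g.proj_mem i u
  have hdim : finrank F U = finrank F (Fin k ⊕ Fin q → F) := by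
    rw [g.finrank_eq_sum h2, Finset.sum_range_succ, Finset.sum_range_one, ℓ₀.finrank_eq,
      ℓ₁.finrank_eq, Module.finrank_pi, Fintype.card_sum, Fintype.card_fin, Fintype.card_fin]
    omega
  refine ⟨LinearMap.linearEquivOfInjective T₀ hinj hdim, ?_, ?_, ℓ₀.s, ?_, ?_, ?_⟩
  · intro u
    change T₀ (a.A u) = (twoBlocks k q (g.wt 1) g.μ).mulVec (T₀ u)
    rw [twoBlocks, Matrix.fromBlocks_mulVec, Matrix.zero_mulVec, Matrix.zero_mulVec, add_zero,
      zero_add]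
    have e0 := ℓ₀.coordinates_A hψp hqk u
    have e1 := ℓ.coordinates_A hφp hkℓ.symm u
    rw [show g.wt 1 - g.μ = g.wt 0 by rw [g.wt_one, add_sub_cancel_right]]
    funext s
    rcases s with j | j
    · exact congrFun e1 j
    · exact congrFun e0 j
  · intro u i j hi hj
    change T₀ _ _ = T₀ _ _
    rw [hTl, hTr, hj, pow_zero, show (i : ℕ) = k - 1 by omega]
    rfl
  · intro i
    exact hφ0 _ ℓ₀.s_mem _
  · intro j
    change T₀ _ _ = _
    rw [hTr]
    split_ifs with h
    · rw [h, pow_zero]; exact hψs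
    · rw [← Nat.sub_add_cancel (Nat.pos_of_ne_zero h), pow_succ, Module.End.mul_apply, ℓ₀.N_s,
        map_zero, map_zero]
  · intro i
    change T₀ _ _ = _
    rw [hTl]
    have := hφ i (by omega)
    rwa [hkℓ] at this

end Two

end Grading
end Action
end Actions
end UniserialSolvable

namespace UniserialSolvable

variable {F : Type*} [Field F]

/-! ### Coordinates on a module with three summands -/

theorem rowColumn_mulVec {n : ℕ} (a : Fin n → F) (w : Idx n → F) :
    (rowColumn a).mulVec w = Sum.elim (fun _ => ∑ j, a j * w (Sum.inr (Sum.inl j)))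
      (Sum.elim (fun i : Fin n => if (i : ℕ) + 1 = n then w (Sum.inr (Sum.inr 0)) else 0)
        fun _ => 0) := by
  funext s
  rcases s with i | i | i <;>
    simp [rowColumn, Matrix.mulVec, dotProduct, Fintype.sum_sum_type, Matrix.fromCols,
      Matrix.fromBlocks]

theorem upperJordan_one_mulVec (α : F) (w : Fin 1 → F) :
    (upperJordan 1 α).mulVec w = fun _ => α * w 0 := by
  funext i
  rw [upperJordan_mulVec_apply, dif_neg (by omega), add_zero, Subsingleton.elim i 0]

theorem threeBlocks_mulVec {n : ℕ} (α lam : F) (w : Idx n → F) :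
    (threeBlocks n α lam).mulVec w = Sum.elim (fun _ => α * w (Sum.inl 0))
      (Sum.elim ((upperJordan n (α - lam)).mulVec fun j => w (Sum.inr (Sum.inl j)))
        fun _ => (α - 2 * lam) * w (Sum.inr (Sum.inr 0))) := by
  rw [threeBlocks, Matrix.fromBlocks_mulVec, Matrix.fromBlocks_mulVec, upperJordan_one_mulVec,
    upperJordan_one_mulVec]
  simp only [Matrix.zero_mulVec, add_zero, zero_add]
  rfl

section Actions

variable {V U : Type*} [AddCommGroup V] [Module F V] [AddCommGroup U] [Module F U]
variable {x : End F V} {e : ℕ}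

namespace Action

variable {a : Action x U} [IsAlgClosed F] [CharZero F] [FiniteDimensional F V]
  [FiniteDimensional F U]

namespace Grading

variable (g : a.Grading)

section Three

variable (ha : a.IsChain) (hρ : Function.Injective a.ρ) (h3 : g.G 3 = ⊥)
variable (ℓ₀ : g.Layer 0) (ℓ₁ : g.Layer 1) (ℓ₂ : g.Layer 2)

theorem Layer.exists_smul_of_k_eq_one {g : a.Grading} {i : ℕ} (ℓ : g.Layer i) (hk : ℓ.k = 1) {u : U}
    (hu : u ∈ g.G i) : ∃ c : F, u = c • ℓ.s :=
  ℓ.exists_smul hu (by have := ℓ.N_pow u hu; rwa [hk, pow_one] at this)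

theorem ρ_eq_zero_of_forall {v : V} (h : ∀ i, ∀ u ∈ g.G i, a.ρ v u = 0) : a.ρ v = 0 := by
  ext u
  exact g.induction (p := fun u => a.ρ v u = 0) (map_zero _)
    (fun u w hu hw => by rw [map_add, hu, hw, add_zero]) h u

include hρ h3 in
/-- Vectors of any other weight would act as zero. -/
theorem eigenvalue_eq_or_of_three (D : JordanDecomposition x e) (i : Fin e) :
    D.eigenvalue i = g.μ ∨ D.eigenvalue i = 2 * g.μ := by
  by_contra! hne
  apply D.basis_ne_zero i ⟨0, D.size_pos i⟩
  apply hρ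
  rw [map_zero]
  refine g.ρ_eq_zero_of_forall fun l u hu => ?_
  refine g.ρ_eq_zero_of_weight (D.mem_maxGenEigenspace i (Subtype.mem _)) hu ?_
  intro j hj hG h
  have hj3 : j < 3 := by
    by_contra h'
    exact hG (g.eq_bot_of_le (by omega) h3)
  interval_cases j
  · rw [Nat.cast_one, one_mul] at h
    exact hne.1 h
  · exact hne.2 (by exact_mod_cast h)

include h3 in
/-- A vector of weight `2μ` acts as zero if it annihilates `G_0`. -/
theorem ρ_eq_zero_of_weight_two (hk0 : ℓ₀.k = 1) {w : V}
    (hw : w ∈ x.maxGenEigenspace (2 * g.μ)) (h : a.ρ w ℓ₀.s = 0) : a.ρ w = 0 := by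
  refine g.ρ_eq_zero_of_forall fun i u hu => ?_
  rcases Nat.eq_zero_or_pos i with rfl | hi
  · obtain ⟨c, rfl⟩ := ℓ₀.exists_smul_of_k_eq_one hk0 hu
    rw [map_smul, h, smul_zero]
  · refine g.ρ_eq_zero_of_weight hw hu fun j hj hG h' => ?_
    have hj2 : j < 2 := by
      by_contra h''
      exact hG (g.eq_bot_of_le (by omega) h3)
    obtain rfl : j = 1 := by omega
    have : g.μ = 0 := by rw [Nat.cast_one] at h'; linear_combination h'
    exact g.μ_ne_zero this

include ha h3 ℓ₁ in
/-- A vector of weight `μ` acts as zero if it annihilates `G_0`, because `G_1` is generated by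
`G_0` under the operators that come from `V`. -/
theorem ρ_eq_zero_of_weight_one (hk0 : ℓ₀.k = 1) {v : V}
    (hv : v ∈ x.maxGenEigenspace g.μ) (h : a.ρ v ℓ₀.s = 0) : a.ρ v = 0 := by
  obtain ⟨v₁, hv₁, hπ⟩ := ℓ₀.exists_weight_π_ρ_ne_zero ha ℓ₁
  refine g.ρ_eq_zero_of_forall fun i u hu => ?_
  rcases Nat.lt_trichotomy i 1 with hi | rfl | hi
  · obtain rfl : i = 0 := by omega
    obtain ⟨c, rfl⟩ := ℓ₀.exists_smul_of_k_eq_one hk0 hu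
    rw [map_smul, h, smul_zero]
  · set ℓ := ℓ₁.changeGenerator _ (Layer.ρ_mem_succ hv₁ ℓ₀.s_mem) hπ with hℓ
    rw [← ℓ.span_eq] at hu
    induction hu using Submodule.span_induction with
    | mem _ h' =>
      obtain ⟨j, rfl⟩ := h'
      change a.ρ v ((a.N (g.wt 1) ^ (j : ℕ)) (a.ρ v₁ ℓ₀.s)) = 0
      rw [← a.ρ_pow_apply_of_N_eq_zero (Layer.wt_succ g 0) v₁ ℓ₀.N_s, a.comm, h, map_zero]
    | zero => exact map_zero _
    | add _ _ _ _ h1 h2 => rw [map_add, h1, h2, add_zero]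
    | smul c _ _ h1 => rw [map_smul, h1, smul_zero]
  · have := Layer.ρ_mem_succ hv hu
    rwa [g.eq_bot_of_le (by omega) h3, Submodule.mem_bot] at this

include h3 hρ ℓ₂ in
/-- The vectors of weight `2μ` form a space of dimension at most one, since they are determined by
their values `ρ(v) s ∈ G_2` and `G_2` is a line. -/
theorem exists_smul_of_weight_two (hk0 : ℓ₀.k = 1) (hk2 : ℓ₂.k = 1) {v w : V}
    (hv : v ∈ x.maxGenEigenspace (2 * g.μ)) (hw : w ∈ x.maxGenEigenspace (2 * g.μ)) (hw0 : w ≠ 0) :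
    ∃ c : F, v = c • w := by
  have hmem : ∀ v ∈ x.maxGenEigenspace (2 * g.μ), ∃ c : F, a.ρ v ℓ₀.s = c • ℓ₂.s := fun v hv =>
    ℓ₂.exists_smul_of_k_eq_one hk2 (g.ρ_mem_of_weight hv ℓ₀.s_mem (j := 2) (by norm_cast))
  obtain ⟨b, hb⟩ := hmem v hv
  obtain ⟨c, hc⟩ := hmem w hw
  have hc0 : c ≠ 0 := by
    rintro rfl
    rw [zero_smul] at hc
    exact hw0 (hρ ((g.ρ_eq_zero_of_weight_two h3 ℓ₀ hk0 hw hc).trans (map_zero _).symm))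
  refine ⟨b / c, sub_eq_zero.mp (hρ ?_)⟩
  rw [map_zero]
  refine g.ρ_eq_zero_of_weight_two h3 ℓ₀ hk0
    (Submodule.sub_mem _ hv (Submodule.smul_mem _ _ hw)) ?_
  rw [map_sub, map_smul, LinearMap.sub_apply, LinearMap.smul_apply, hb, hc, smul_smul,
    div_mul_cancel₀ _ hc0, sub_self]

include ha h3 hρ ℓ₁ in
/-- The eigenspace of `x` for `μ` has dimension at most one, since its vectors take `G_0` to the
socle of `G_1`. -/
theorem exists_smul_of_weight_one (hk0 : ℓ₀.k = 1) {v w : V}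
    (hv : (x - g.μ • (1 : End F V)) v = 0) (hw : (x - g.μ • (1 : End F V)) w = 0) (hw0 : w ≠ 0) :
    ∃ c : F, v = c • w := by
  have hgen : ∀ v, (x - g.μ • (1 : End F V)) v = 0 → v ∈ x.maxGenEigenspace g.μ := fun v hv =>
    (Module.End.mem_maxGenEigenspace _ _ _).mpr ⟨1, by rwa [pow_one]⟩
  have hmem : ∀ v, (x - g.μ • (1 : End F V)) v = 0 → ∃ c : F, a.ρ v ℓ₀.s = c • ℓ₁.s := by
    intro v hv
    refine ℓ₁.exists_smul (Layer.ρ_mem_succ (hgen v hv) ℓ₀.s_mem) ?_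
    have := a.ρ_pow_apply_of_N_eq_zero (Layer.wt_succ g 0) v ℓ₀.N_s 1
    rw [pow_one, pow_one, hv, map_zero, LinearMap.zero_apply] at this
    exact this.symm
  obtain ⟨b, hb⟩ := hmem v hv
  obtain ⟨c, hc⟩ := hmem w hw
  have hc0 : c ≠ 0 := by
    rintro rfl
    rw [zero_smul] at hc
    exact hw0 (hρ ((g.ρ_eq_zero_of_weight_one ha h3 ℓ₀ ℓ₁ hk0 (hgen w hw) hc).trans
      (map_zero _).symm))
  refine ⟨b / c, sub_eq_zero.mp (hρ ?_)⟩
  rw [map_zero]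
  refine g.ρ_eq_zero_of_weight_one ha h3 ℓ₀ ℓ₁ hk0
    (Submodule.sub_mem _ (hgen v hv) (Submodule.smul_mem _ _ (hgen w hw))) ?_
  rw [map_sub, map_smul, LinearMap.sub_apply, LinearMap.smul_apply, hb, hc, smul_smul,
    div_mul_cancel₀ _ hc0, sub_self]

/-- Basis vectors that are proportional are equal. -/
theorem _root_.UniserialSolvable.JordanDecomposition.eq_of_basis_eq_smul
    (D : JordanDecomposition x e) {i j : Fin e} {k : Fin (D.size i)} {l : Fin (D.size j)} {c : F}
    (h : (D.basis i k : V) = c • (D.basis j l : V)) :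
    (⟨i, k⟩ : Σ i, Fin (D.size i)) = ⟨j, l⟩ := by
  by_contra hne
  have h1 := D.fullBasis.repr_self ⟨i, k⟩
  rw [D.fullBasis_apply] at h1
  have h2 := D.fullBasis.repr_self ⟨j, l⟩
  rw [D.fullBasis_apply] at h2
  simp only at h1 h2
  rw [h, map_smul, h2] at h1
  have h4 := DFunLike.congr_fun h1 ⟨i, k⟩
  rw [Finsupp.single_eq_same, Finsupp.smul_apply, Finsupp.single_apply,
    if_neg (Ne.symm hne), smul_zero] at h4
  exact zero_ne_one h4

variable [NeZero e] (D : JordanDecomposition x e)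

include ha hρ h3 ℓ₀ ℓ₁ ℓ₂ in
/-- There is one block with eigenvalue `μ` and at most one block, of size one, with eigenvalue
`2μ`. -/
theorem eigenvalue_eq_of_three (hk0 : ℓ₀.k = 1) (hk2 : ℓ₂.k = 1) (hn : 2 ≤ D.size 0) :
    D.eigenvalue 0 = g.μ ∧ ∀ i, i ≠ 0 → D.size i = 1 ∧ D.eigenvalue i = 2 * g.μ := by
  have h := g.eigenvalue_eq_or_of_three hρ h3 D
  have hlast : ∀ i, (x - D.eigenvalue i • (1 : End F V))
      (D.basis i ⟨D.size i - 1, by have := D.size_pos i; omega⟩ : V) = 0 := by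
    intro i
    have := D.size_pos i
    have h' := D.sub_pow_basis i ⟨D.size i - 1, by omega⟩ 1
    rwa [pow_one, dif_neg (by simp only; omega)] at h'
  have htwo : ∀ i, D.eigenvalue i = 2 * g.μ → D.size i = 1 := by
    intro i hi
    by_contra hne
    have hs := D.size_pos i
    have hm : ∀ l, (D.basis i l : V) ∈ x.maxGenEigenspace (2 * g.μ) := fun l =>
      hi ▸ D.mem_maxGenEigenspace i (Subtype.mem _)
    obtain ⟨c, hc⟩ := g.exists_smul_of_weight_two hρ h3 ℓ₀ ℓ₂ hk0 hk2
      (hm ⟨0, by omega⟩) (hm ⟨1, by omega⟩) (D.basis_ne_zero _ _)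
    have := D.eq_of_basis_eq_smul hc
    simp at this
  have h0 : D.eigenvalue 0 = g.μ := by
    refine (h 0).resolve_right fun h' => ?_
    have := htwo 0 h'
    omega
  refine ⟨h0, fun i hi => ?_⟩
  have h' : D.eigenvalue i = 2 * g.μ := by
    refine (h i).resolve_left fun h' => hi ?_
    have e1 := hlast i
    have e2 := hlast 0
    rw [h'] at e1
    rw [h0] at e2
    obtain ⟨c, hc⟩ := g.exists_smul_of_weight_one ha hρ h3 ℓ₀ ℓ₁ hk0 e1 e2 (D.basis_ne_zero _ _)
    exact congrArg Sigma.fst (D.eq_of_basis_eq_smul hc)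
  exact ⟨htwo i h', h'⟩

include ha hρ h3 ℓ₀ ℓ₁ ℓ₂ in
theorem le_two_of_three (hk0 : ℓ₀.k = 1) (hk2 : ℓ₂.k = 1) (hn : 2 ≤ D.size 0) : e ≤ 2 := by
  by_contra he
  have h := (g.eigenvalue_eq_of_three ha hρ h3 ℓ₀ ℓ₁ ℓ₂ D hk0 hk2 hn).2
  have hne : ∀ i : Fin e, 0 < (i : ℕ) → i ≠ 0 := by
    rintro i hi rfl
    simp at hi
  have hm : ∀ i : Fin e, i ≠ 0 → ∀ l, (D.basis i l : V) ∈ x.maxGenEigenspace (2 * g.μ) :=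
    fun i hi l => (h i hi).2 ▸ D.mem_maxGenEigenspace i (Subtype.mem _)
  obtain ⟨c, hc⟩ := g.exists_smul_of_weight_two hρ h3 ℓ₀ ℓ₂ hk0 hk2
    (hm ⟨1, by omega⟩ (hne _ Nat.one_pos) ⟨0, D.size_pos _⟩)
    (hm ⟨2, by omega⟩ (hne _ Nat.two_pos) ⟨0, D.size_pos _⟩) (D.basis_ne_zero _ _)
  have := congrArg Sigma.fst (D.eq_of_basis_eq_smul hc)
  simp at this

include ha in
/-- Some vector of `V` takes the socle of `G_0` out of the kernel of `π`, and only `v_0` can be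
responsible for this. -/
theorem π_ρ_ne_zero_of_three (h0 : D.eigenvalue 0 = g.μ)
    (h1 : ∀ i, i ≠ 0 → D.eigenvalue i ≠ g.μ) :
    ℓ₁.π (a.ρ (D.basis 0 ⟨0, D.size_pos 0⟩ : V) ℓ₀.s) ≠ 0 := by
  intro h
  obtain ⟨v, hv⟩ := ℓ₀.exists_π_ρ_ne_zero ha ℓ₁
  apply hv
  refine D.induction_block (p := fun v => ℓ₁.π (a.ρ v ℓ₀.s) = 0) (by simp) ?_ ?_ v
  · intro u w hu hw
    rw [map_add, LinearMap.add_apply, map_add, hu, hw, add_zero]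
  · intro i w hw
    by_cases hi : i = 0
    · subst hi
      have hb : ∀ l, ℓ₁.π (a.ρ (D.basis 0 l : V) ℓ₀.s) = 0 := by
        intro l
        rw [D.basis_eq_pow, h0, a.ρ_pow_apply_of_N_eq_zero (Layer.wt_succ g 0) _ ℓ₀.N_s]
        rcases Nat.eq_zero_or_pos (l : ℕ) with hl | hl
        · rw [hl, pow_zero]; exact h
        · rw [← Nat.sub_add_cancel hl, pow_succ', Module.End.mul_apply, ℓ₁.π_N]
      have hsum := congrArg (D.block 0).subtype ((D.basis 0).sum_repr ⟨w, hw⟩)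
      rw [map_sum] at hsum
      have hsum' : w = ∑ j, (D.basis 0).repr ⟨w, hw⟩ j • (D.basis 0 j : V) := hsum.symm
      rw [hsum', map_sum, LinearMap.sum_apply, map_sum]
      refine Finset.sum_eq_zero fun l _ => ?_
      rw [map_smul, LinearMap.smul_apply, map_smul, hb, smul_zero]
    · exact ℓ₀.π_ρ_eq_zero_of_weight ℓ₁ (h1 i hi) (D.mem_maxGenEigenspace i hw)

include ha hρ h3 in
/-- Coordinates in which `A` and `ρ(v_0)` are the values of `R_{α,b}` on `x` and `v_0`. -/
theorem exists_coordinates_of_three (hk0 : ℓ₀.k = 1) (hodd : Odd ℓ₁.k) (hk2 : ℓ₂.k = 1)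
    (h0 : D.eigenvalue 0 = g.μ) (h1 : ∀ i, i ≠ 0 → D.eigenvalue i ≠ g.μ) :
    Odd (D.size 0) ∧ ∃ (b : Fin (D.size 0) → F) (T : U ≃ₗ[F] (Idx (D.size 0) → F)),
      IsAdmissible b ∧
      (∀ u, T (a.A u) = (threeBlocks (D.size 0) (g.wt 2) g.μ).mulVec (T u)) ∧
      ∀ u, T (a.ρ (D.basis 0 ⟨0, D.size_pos 0⟩ : V) u) = (rowColumn b).mulVec (T u) := by
  have hπ := g.π_ρ_ne_zero_of_three ha ℓ₀ ℓ₁ D h0 h1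
  set v₀ := (D.basis 0 ⟨0, D.size_pos 0⟩ : V) with hv₀
  have hvm : v₀ ∈ x.maxGenEigenspace g.μ := h0 ▸ D.mem_maxGenEigenspace 0 (Subtype.mem _)
  have hem := Layer.ρ_mem_succ hvm ℓ₀.s_mem
  set ℓ := ℓ₁.changeGenerator (a.ρ v₀ ℓ₀.s) hem hπ with hℓ
  have hq : ℓ.q = a.ρ v₀ ℓ₀.s := rfl
  have hpow : ∀ j, (ℓ.N ^ j) ℓ.q = a.ρ (((x - g.μ • (1 : End F V)) ^ j) v₀) ℓ₀.s := fun j =>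
    (a.ρ_pow_apply_of_N_eq_zero (Layer.wt_succ g 0) v₀ ℓ₀.N_s j).symm
  have hn := D.size_pos 0
  have hkn : ℓ.k = D.size 0 := by
    have hk := ℓ.k_pos
    apply le_antisymm
    · by_contra hlt
      apply ℓ.s_ne_zero
      rw [Layer.s, hpow, ← h0, hv₀, D.sub_pow_basis, dif_neg (by simp only; omega), map_zero,
        LinearMap.zero_apply]
    · by_contra hlt
      have h2 := ℓ.N_pow_of_le (r := D.size 0 - 1) (by omega) ℓ.q_mem
      have hm : ((x - g.μ • (1 : End F V)) ^ (D.size 0 - 1)) v₀ ∈ x.maxGenEigenspace g.μ :=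
        h0 ▸ D.mem_maxGenEigenspace 0 (by
          rw [hv₀, D.sub_pow_basis]
          split_ifs
          · exact Subtype.mem _
          · exact Submodule.zero_mem _)
      rw [hpow] at h2
      have h4 := hρ ((g.ρ_eq_zero_of_weight_one ha h3 ℓ₀ ℓ₁ hk0 hm h2).trans (map_zero _).symm)
      rw [← h0, hv₀, D.sub_pow_basis, dif_pos (by simp only; omega)] at h4
      exact D.basis_ne_zero _ _ h4
  have hodd' : Odd (D.size 0) := by rw [← hkn]; exact hodd
  set n := D.size 0 with hn'
  obtain ⟨w, hw, hw2⟩ := ℓ.exists_weight_π_ρ_ne_zero ha ℓ₂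
  have hπ2 : ℓ₂.π (a.ρ v₀ ℓ.s) ≠ 0 := Layer.π_ρ_ne_zero_of_ne_zero ℓ₀ ℓ ℓ₂ hvm hw
    (by rw [← hq, ℓ.π_q]; exact one_ne_zero) hw2
  obtain ⟨φ, hφ, hφp⟩ := ℓ.exists_functional
  have hφs : φ ℓ.s = 1 := by
    have := ℓ.k_pos
    rw [Layer.s, hφ _ (by omega), if_pos (by omega)]
  -- the coordinate on the line `G_2` is scaled so that the first entry of `b` is `1`
  set ζ : U →ₗ[F] F := (ℓ₂.π (a.ρ v₀ ℓ.s))⁻¹ • ℓ₂.π with hζ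
  have hζN : ∀ u, ζ (a.N (g.wt 2) u) = 0 := fun u => by
    rw [hζ, LinearMap.smul_apply, ℓ₂.π_N, smul_zero]
  have hζp : ∀ u, ζ (g.proj 2 u) = ζ u := fun u => by
    rw [hζ, LinearMap.smul_apply, LinearMap.smul_apply, ℓ₂.π_proj]
  have hζne : ∀ j, j ≠ 2 → ∀ u ∈ g.G j, ζ u = 0 := fun j hj u hu => by
    rw [hζ, LinearMap.smul_apply, ℓ₂.π_of_ne j hj u hu, smul_zero]
  have hs0 : ℓ₀.π ℓ₀.s = 1 := by
    have : ℓ₀.s = ℓ₀.q := by rw [Layer.s, hk0]; rfl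
    rw [this, ℓ₀.π_q]
  have hs2 : ζ ℓ₂.s ≠ 0 := by
    have : ℓ₂.s = ℓ₂.q := by rw [Layer.s, hk2]; rfl
    rw [this, hζ, LinearMap.smul_apply, ℓ₂.π_q, smul_eq_mul, mul_one]
    exact inv_ne_zero hπ2
  have hφne : ∀ i, i ≠ 1 → ∀ u ∈ g.G i, ∀ j, φ ((ℓ.N ^ j) u) = 0 := by
    intro i hi u hu j
    rw [← hφp, g.proj_of_mem_ne hi.symm (a.N_pow_mem (g.A_mem i) _ j hu), map_zero]
  set T₀ : U →ₗ[F] (Idx n → F) := LinearMap.pi (Sum.elim (fun _ => ζ)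
    (Sum.elim (fun j : Fin n => φ ∘ₗ ℓ.N ^ (j : ℕ)) fun _ => ℓ₀.π)) with hT₀
  have hT : ∀ u, T₀ u = Sum.elim (fun _ => ζ u)
      (Sum.elim (fun j : Fin n => φ ((ℓ.N ^ (j : ℕ)) u)) fun _ => ℓ₀.π u) := by
    intro u
    funext s
    rcases s with j | j | j <;> rfl
  have hproj : ∀ (γ : F) (i r : ℕ) u, g.proj i ((a.N γ ^ r) u) = (a.N γ ^ r) (g.proj i u) := by
    intro γ i r
    induction r with
    | zero => exact fun u => rfl
    | succ r ih =>
      intro u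
      rw [pow_succ', Module.End.mul_apply, Module.End.mul_apply, g.proj_N, ih]
  have hinj : Function.Injective T₀ := by
    rw [← LinearMap.ker_eq_bot, LinearMap.ker_eq_bot']
    intro u hu
    rw [hT] at hu
    have p0 : g.proj 0 u = 0 := by
      refine ℓ₀.eq_zero_of_coordinates (φ := ℓ₀.π) (by rw [hs0]; exact one_ne_zero)
        (g.proj_mem 0 u) fun j hj => ?_
      obtain rfl : j = 0 := by omega
      rw [pow_zero, Module.End.one_apply, ℓ₀.π_proj]
      exact congrFun hu (Sum.inr (Sum.inr 0))
    have p1 : g.proj 1 u = 0 := by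
      refine ℓ.eq_zero_of_coordinates (φ := φ) (by rw [hφs]; exact one_ne_zero) (g.proj_mem 1 u)
        fun j hj => ?_
      rw [← hproj, hφp]
      exact congrFun hu (Sum.inr (Sum.inl ⟨j, by omega⟩))
    have p2 : g.proj 2 u = 0 := by
      refine ℓ₂.eq_zero_of_coordinates (φ := ζ) hs2 (g.proj_mem 2 u) fun j hj => ?_
      obtain rfl : j = 0 := by omega
      rw [pow_zero, Module.End.one_apply, hζp]
      exact congrFun hu (Sum.inl 0)
    refine (Submodule.mem_bot F).mp (g.mem_of_proj_mem fun i => ?_)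
    rcases Nat.lt_or_ge i 3 with hi | hi
    · interval_cases i
      · rw [p0]; exact Submodule.zero_mem _
      · rw [p1]; exact Submodule.zero_mem _
      · rw [p2]; exact Submodule.zero_mem _
    · rw [← g.eq_bot_of_le hi h3]; exact g.proj_mem i u
  have hdim : finrank F U = finrank F (Idx n → F) := by
    rw [g.finrank_eq_sum h3, Finset.sum_range_succ, Finset.sum_range_succ, Finset.sum_range_one,
      ℓ₀.finrank_eq, ℓ.finrank_eq, ℓ₂.finrank_eq, Module.finrank_pi, Fintype.card_sum,
      Fintype.card_sum, Fintype.card_fin, Fintype.card_fin]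
    omega
  refine ⟨hodd', fun j => ζ (a.ρ v₀ ((ℓ.N ^ (n - 1 - (j : ℕ))) ℓ.q)),
    LinearMap.linearEquivOfInjective T₀ hinj hdim, ⟨?_, ?_⟩, ?_, ?_⟩
  · intro i hi
    simp only
    rw [show n - 1 - (i : ℕ) = ℓ.k - 1 by omega]
    change ζ (a.ρ v₀ ℓ.s) = 1
    rw [hζ, LinearMap.smul_apply, smul_eq_mul, inv_mul_cancel₀ hπ2]
  · -- moving an odd power of `N` across the two factors `ρ(v₀)` changes the sign
    intro i hi
    have ho : Odd (n - 1 - (i : ℕ)) := by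
      obtain ⟨r, hr⟩ := hodd'
      obtain ⟨t, ht⟩ := hi
      have := i.2
      exact ⟨r - t, by omega⟩
    have h := a.apply_ρ_pow_ρ_swap (Layer.wt_succ g 0) (Layer.wt_succ g 1) hζN ℓ₀.N_s v₀ v₀
      (n - 1 - (i : ℕ))
    rw [ho.neg_one_pow] at h
    change ζ (a.ρ v₀ ((a.N (g.wt (0 + 1)) ^ (n - 1 - (i : ℕ))) (a.ρ v₀ ℓ₀.s))) = 0
    have h2 :
        (2 : F) * ζ (a.ρ v₀ ((a.N (g.wt (0 + 1)) ^ (n - 1 - (i : ℕ))) (a.ρ v₀ ℓ₀.s))) = 0 := by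
      linear_combination h
    exact (mul_eq_zero.mp h2).resolve_left two_ne_zero
  · intro u
    change T₀ (a.A u) = (threeBlocks n (g.wt 2) g.μ).mulVec (T₀ u)
    have e1 := ℓ.coordinates_A hφp hkn.symm u
    rw [threeBlocks_mulVec, hT, hT, show g.wt 2 - g.μ = g.wt 1 by simp only [wt]; push_cast; ring,
      show g.wt 2 - 2 * g.μ = g.wt 0 by simp only [wt]; push_cast; ring]
    funext s
    rcases s with j | j | j
    · change ζ (a.A u) = g.wt 2 * ζ u
      rw [a.A_apply (g.wt 2), map_add, hζN, zero_add, map_smul, smul_eq_mul]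
    · exact congrFun e1 j
    · exact ℓ₀.π_A
  · intro u
    change T₀ (a.ρ v₀ u) = (rowColumn _).mulVec (T₀ u)
    refine g.induction (p := fun u => T₀ (a.ρ v₀ u) = (rowColumn _).mulVec (T₀ u)) ?_ ?_ ?_ u
    · simp only [map_zero, Matrix.mulVec_zero]
    · intro u w hu hw
      simp only [map_add, Matrix.mulVec_add, hu, hw]
    · intro i u hu
      rcases Nat.eq_zero_or_pos i with rfl | hi
      · obtain ⟨c, rfl⟩ := ℓ₀.exists_smul_of_k_eq_one hk0 hu
        rw [map_smul, map_smul, map_smul, Matrix.mulVec_smul]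
        congr 1
        rw [rowColumn_mulVec, hT, hT]
        funext s
        rcases s with j | j | j
        · simp only [Sum.elim_inl, Sum.elim_inr]
          rw [hζne 1 (by omega) _ hem, Finset.sum_eq_zero]
          intro j _
          rw [hφne 0 (by omega) _ ℓ₀.s_mem, mul_zero]
        · simp only [Sum.elim_inl, Sum.elim_inr]
          rw [hs0, ← hq, hφ _ (by omega), hkn]
        · exact ℓ₀.π_of_ne 1 (by omega) _ hem
      · rcases Nat.lt_or_ge i 2 with hi2 | hi2
        · obtain rfl : i = 1 := by omega
          rw [← ℓ.span_eq] at hu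
          induction hu using Submodule.span_induction with
          | mem _ h' =>
            obtain ⟨r, rfl⟩ := h'
            have hr := r.2
            have hm := ℓ.N_pow_mem r ℓ.q_mem
            have hm2 := Layer.ρ_mem_succ hvm hm
            simp only
            rw [rowColumn_mulVec, hT, hT]
            funext s
            rcases s with j | j | j
            · simp only [Sum.elim_inl, Sum.elim_inr]
              rw [Finset.sum_eq_single ⟨n - 1 - r, by omega⟩]
              · rw [← Module.End.mul_apply (ℓ.N ^ _) (ℓ.N ^ _), ← pow_add,
                  hφ _ (by simp only; omega), if_pos (by simp only; omega), mul_one]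
                congr 4
                simp only; omega
              · intro i _ hi
                rw [← Module.End.mul_apply (ℓ.N ^ (i : ℕ)), ← pow_add]
                rcases Nat.lt_or_ge (i + r : ℕ) ℓ.k with h | h
                · rw [hφ _ h, if_neg, mul_zero]
                  intro h'
                  exact hi (Fin.ext (by simp only; omega))
                · have := ℓ.N_pow_of_le h ℓ.q_mem
                  rw [this, map_zero, mul_zero]
              · intro h
                exact absurd (Finset.mem_univ _) h
            · simp only [Sum.elim_inl, Sum.elim_inr]
              rw [hφne 2 (by omega) _ hm2, ℓ₀.π_of_ne 1 (by omega) _ hm, ite_self]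
            · exact ℓ₀.π_of_ne 2 (by omega) _ hm2
          | zero => simp only [map_zero, Matrix.mulVec_zero]
          | add u w _ _ hu hw => simp only [map_add, Matrix.mulVec_add, hu, hw]
          | smul c u _ hu => simp only [map_smul, Matrix.mulVec_smul, hu]
        · have hz : a.ρ v₀ u = 0 := by
            have := Layer.ρ_mem_succ hvm hu
            rwa [g.eq_bot_of_le (by omega) h3, Submodule.mem_bot] at this
          rw [hz, map_zero, rowColumn_mulVec, hT]
          funext s
          rcases s with j | j | j
          · simp only [Sum.elim_inl, Sum.elim_inr, Pi.zero_apply]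
            rw [Finset.sum_eq_zero]
            intro j _
            rw [hφne i (by omega) u hu, mul_zero]
          · simp only [Sum.elim_inl, Sum.elim_inr, Pi.zero_apply]
            rw [ℓ₀.π_of_ne i (by omega) u hu, ite_self]
          · rfl

end Three

end Grading
end Action
end Actions
end UniserialSolvable

namespace UniserialSolvable

variable {F : Type*} [Field F]

/-! ### Conjugate representations -/

section Conjugation

variable {L : Type*} [LieRing L] [LieAlgebra F L]
variable {ι κ : Type*} [Fintype ι] [DecidableEq ι] [Fintype κ] [DecidableEq κ]

/-- The representation on another column space obtained by transport along a linear isomorphism. -/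
noncomputable def conjRep (T : (ι → F) ≃ₗ[F] (κ → F)) (R : L →ₗ⁅F⁆ Matrix ι ι F) :
    L →ₗ⁅F⁆ Matrix κ κ F :=
  lieEquivMatrix'.toLieHom.comp
    (T.lieConj.toLieHom.comp ((lieEquivMatrix' (R := F) (n := ι)).symm.toLieHom.comp R))

theorem conjRep_mulVec (T : (ι → F) ≃ₗ[F] (κ → F)) (R : L →ₗ⁅F⁆ Matrix ι ι F) (y : L)
    (v : ι → F) : (conjRep T R y).mulVec (T v) = T ((R y).mulVec v) := by
  change (LinearMap.toMatrix' (T.conj (Matrix.toLin' (R y)))).mulVec (T v) = _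
  rw [LinearMap.toMatrix'_mulVec, LinearEquiv.conj_apply_apply, LinearEquiv.symm_apply_apply,
    Matrix.toLin'_apply]

theorem conjRep_eq (T : (ι → F) ≃ₗ[F] (κ → F)) (R : L →ₗ⁅F⁆ Matrix ι ι F) {y : L}
    {B : Matrix κ κ F} (h : ∀ v, T ((R y).mulVec v) = B.mulVec (T v)) : conjRep T R y = B := by
  apply Matrix.toLin'.injective
  refine LinearMap.ext fun w => ?_
  obtain ⟨v, rfl⟩ := T.surjective w
  rw [Matrix.toLin'_apply, Matrix.toLin'_apply, conjRep_mulVec, h]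

theorem IsFaithful.conjRep (T : (ι → F) ≃ₗ[F] (κ → F)) {R : L →ₗ⁅F⁆ Matrix ι ι F}
    (h : IsFaithful R) : IsFaithful (conjRep T R) :=
  lieEquivMatrix'.injective.comp
    (T.lieConj.injective.comp ((lieEquivMatrix' (R := F) (n := ι)).symm.injective.comp h))

theorem IsUniserial.conjRep (T : (ι → F) ≃ₗ[F] (κ → F)) {R : L →ₗ⁅F⁆ Matrix ι ι F}
    (h : IsUniserial R) : IsUniserial (conjRep T R) := by
  have := h.1
  refine ⟨T.symm.toEquiv.nontrivial, fun P Q hP hQ => ?_⟩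
  have key : ∀ P, IsSubmodule (UniserialSolvable.conjRep T R) P →
      IsSubmodule R (P.comap (T : (ι → F) →ₗ[F] (κ → F))) := by
    intro P hP y v hv
    have := hP y (T v) hv
    rwa [conjRep_mulVec] at this
  have hle := fun P Q => Submodule.comap_le_comap_iff_of_surjective
    (f := (T : (ι → F) →ₗ[F] (κ → F))) T.surjective (p := P) (q := Q)
  rcases h.2 _ _ (key P hP) (key Q hQ) with h | h
  · exact Or.inl ((hle P Q).mp h)
  · exact Or.inr ((hle Q P).mp h)

end Conjugation

/-! ### The shape of faithful uniserial representations -/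

section Operators

variable {V : Type*} [LieRing V] [LieAlgebra F V] [IsLieAbelian V]
variable {x : End F V} {e : ℕ} [NeZero e]
variable {ι : Type*} [Fintype ι] [DecidableEq ι]

/-- The operators on column space that are given by a matrix representation. -/
noncomputable def actionOf (R : Alg x →ₗ⁅F⁆ Matrix ι ι F) : Action x (ι → F) where
  A := Matrix.toLin' (R (gen x))
  ρ := (Matrix.toLin' : Matrix ι ι F ≃ₗ[F] _).toLinearMap ∘ₗ
    repV (R : Alg x →ₗ[F] Matrix ι ι F)
  lie v u := by
    change Matrix.toLin' (R (gen x)) (Matrix.toLin' (R (ofV x v)) u) =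
      Matrix.toLin' (R (ofV x (x v))) u + Matrix.toLin' (R (ofV x v)) (Matrix.toLin' (R (gen x)) u)
    simp only [Matrix.toLin'_apply, Matrix.mulVec_mulVec]
    rw [← Matrix.add_mulVec, ← rep_lie_gen, sub_add_cancel]
  comm v w u := by
    change Matrix.toLin' (R (ofV x v)) (Matrix.toLin' (R (ofV x w)) u) =
      Matrix.toLin' (R (ofV x w)) (Matrix.toLin' (R (ofV x v)) u)
    simp only [Matrix.toLin'_apply, Matrix.mulVec_mulVec]
    rw [rep_comm]

theorem actionOf_A (R : Alg x →ₗ⁅F⁆ Matrix ι ι F) (u : ι → F) :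
    (actionOf R).A u = (R (gen x)).mulVec u := Matrix.toLin'_apply _ _

theorem actionOf_ρ (R : Alg x →ₗ⁅F⁆ Matrix ι ι F) (v : V) (u : ι → F) :
    (actionOf R).ρ v u = (R (ofV x v)).mulVec u := Matrix.toLin'_apply _ _

theorem IsUniserial.isChain {R : Alg x →ₗ⁅F⁆ Matrix ι ι F} (h : IsUniserial R) :
    (actionOf R).IsChain := by
  have key : ∀ P, (actionOf R).IsStable P → IsSubmodule R P := by
    intro P hP y v hv
    have h1 := rep_eq (R : Alg x →ₗ[F] Matrix ι ι F) y
    simp only [LieHom.coe_toLinearMap] at h1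
    rw [h1, Matrix.add_mulVec, Matrix.smul_mulVec]
    refine P.add_mem (P.smul_mem _ ?_) ?_
    · rw [← actionOf_A]; exact hP.1 v hv
    · rw [← actionOf_ρ]; exact hP.2 _ v hv
  exact fun P Q hP hQ => h.2 P Q (key P hP) (key Q hQ)

theorem IsFaithful.actionOf_ρ_injective {R : Alg x →ₗ⁅F⁆ Matrix ι ι F} (h : IsFaithful R) :
    Function.Injective (actionOf R).ρ := by
  intro v w hvw
  have h1 : R (ofV x v) = R (ofV x w) := Matrix.toLin'.injective hvw
  exact congrArg LieAlgebra.SemiDirectSum.left (h h1)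

variable [IsAlgClosed F] [CharZero F] [FiniteDimensional F V]

/-- The structure of a faithful uniserial representation: it has the shape of `R_{α,k,X}` or of
`R_{α,a}` on `𝔤_1`. -/
theorem exists_shape_of_isUniserial (hx : IsUnit x) (hnd : ¬ IsDiagonalizable x) (he : 1 < e)
    (D : JordanDecomposition x e) (R : Alg x →ₗ⁅F⁆ Matrix ι ι F) (hf : IsFaithful R)
    (hR : IsUniserial R) :
    (D.IsTypeOne ∧ ∃ (α : F) (k : ℕ) (X : Matrix (Fin (k - 1)) (Fin (D.n - k)) F)
      (T : (ι → F) ≃ₗ[F] (Fin k ⊕ Fin (D.n + 1 - k) → F)),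
      1 < k ∧ k < D.n ∧ e ≤ min k (D.n + 1 - k) ∧
      (∀ v, T ((R (gen x)).mulVec v) = (twoBlocks k (D.n + 1 - k) α D.lam).mulVec (T v)) ∧
      ∀ v, T ((R (ofV x D.v₀)).mulVec v) = (cornerHat X).1.mulVec (T v)) ∨
    (D.IsTypeTwo ∧ Odd D.n ∧ ∃ (α : F) (a : Fin D.n → F) (T : (ι → F) ≃ₗ[F] (Idx D.n → F)),
      IsAdmissible a ∧
      (∀ v, T ((R (gen x)).mulVec v) = (threeBlocks D.n α D.lam).mulVec (T v)) ∧
      ∀ v, T ((R (ofV x D.v₀)).mulVec v) = (rowColumn a).mulVec (T v)) := by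
  have hn := D.two_le_n hnd
  have hρ := hf.actionOf_ρ_injective
  have ha := hR.isChain
  have hρ0 : (actionOf R).ρ ≠ 0 := by
    intro h
    apply D.basis_ne_zero 0 ⟨0, D.size_pos 0⟩
    apply hρ
    rw [h, LinearMap.zero_apply, LinearMap.zero_apply]
  obtain ⟨g⟩ := ha.nonempty_grading hx hρ0
  have hne : (x - D.eigenvalue 0 • (1 : End F V)) (D.basis 0 ⟨0, D.size_pos 0⟩ : V) ≠ 0 := by
    have := D.sub_pow_basis 0 ⟨0, D.size_pos 0⟩ 1
    rw [pow_one, dif_pos (by simp only; omega)] at this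
    rw [this]
    exact D.basis_ne_zero _ _
  rcases g.two_or_three ha hρ (D.mem_maxGenEigenspace 0 (Subtype.mem _)) hne with
    h2 | ⟨h3, h2, hk⟩
  · -- two summands
    left
    have hD := g.eigenvalue_eq_of_two D hρ h2
    obtain ⟨ℓ₁⟩ := g.nonempty_layer ha g.one_ne_bot
    obtain ⟨k, hk⟩ : ∃ k, k = ℓ₁.k := ⟨_, rfl⟩
    obtain ⟨hk1, hkn, T, hTA, hrow, s, hs0, hs1, hcol⟩ :=
      g.exists_coordinates_of_two D hρ h2 ℓ₁ ha hk
    have hD' : ∀ i, D.eigenvalue i = D.lam := fun i => (hD i).trans (hD 0).symm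
    have hlam := D.eigenvalue_ne_zero hx 0
    simp only [actionOf_A, ← hD 0] at hTA
    have hA := conjRep_eq T R hTA
    obtain ⟨N, hN⟩ := rep_mem_hat D hlam two_ne_zero hD' (conjRep T R) hA D.v₀
    have hv : ∀ u i, T ((actionOf R).ρ (D.basis 0 ⟨0, D.size_pos 0⟩ : V) u) (Sum.inl i) =
        ∑ j, N i j * T u (Sum.inr j) := by
      intro u i
      have h := conjRep_mulVec T R (ofV x D.v₀) u
      rw [hN] at h
      rw [actionOf_ρ]
      refine (congrFun h (Sum.inl i)).symm.trans ?_
      simp [Matrix.mulVec, dotProduct, Fintype.sum_sum_type]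
    obtain ⟨X, rfl⟩ := exists_eq_cornerMatrix N (by
        intro i j hj
        have h := hcol i
        rw [hv, Finset.sum_eq_single j] at h
        · rwa [hs1, if_pos hj, mul_one] at h
        · intro b _ hb
          rw [hs1, if_neg fun h' => hb (Fin.ext (h'.trans hj.symm)), mul_zero]
        · exact fun h' => absurd (Finset.mem_univ _) h') (by
        intro i j hi
        obtain ⟨u, hu⟩ := T.surjective (Pi.single (Sum.inr j) 1)
        have h := hrow u i ⟨0, by omega⟩ hi rfl
        rw [hv, hu, Finset.sum_eq_single j] at h
        · rw [Pi.single_eq_same, mul_one] at h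
          rw [h, Pi.single_apply]
          refine if_congr ?_ rfl rfl
          rw [Sum.inr.injEq, Fin.ext_iff]
          exact eq_comm
        · intro b _ hb
          rw [Pi.single_eq_of_ne (fun h' => hb (Sum.inr.inj h')), mul_zero]
        · exact fun h' => absurd (Finset.mem_univ _) h')
    -- faithfulness makes `V → M_{k,n+1-k}` a monomorphism, which bounds the block sizes
    obtain ⟨h1, hek⟩ := D.isTypeOne_of_mono hD' hk1 hkn
      (D.monoOfRep (X := X) hlam two_ne_zero hD' (conjRep T R) (hf.conjRep T) hA hN)
    have hek' := le_min_iff.mp hek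
    refine ⟨h1, g.wt 1, k, X, T, by omega, by omega, hek, hTA, fun v => ?_⟩
    rw [← conjRep_mulVec, hN]
    rfl
  · -- three summands
    right
    obtain ⟨ℓ₀⟩ := g.nonempty_layer ha (g.ne_bot_of_le (Nat.zero_le 2) h2)
    obtain ⟨ℓ₁⟩ := g.nonempty_layer ha g.one_ne_bot
    obtain ⟨ℓ₂⟩ := g.nonempty_layer ha h2
    obtain ⟨hk0, hodd, hk2⟩ := hk ℓ₀ ℓ₁ ℓ₂
    obtain ⟨h0, hi⟩ := g.eigenvalue_eq_of_three ha hρ h3 ℓ₀ ℓ₁ ℓ₂ D hk0 hk2 hn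
    have he2 := g.le_two_of_three ha hρ h3 ℓ₀ ℓ₁ ℓ₂ D hk0 hk2 hn
    obtain ⟨hn', b, T, hb, hA, hE⟩ := g.exists_coordinates_of_three ha hρ h3 ℓ₀ ℓ₁ ℓ₂ D hk0 hodd
      hk2 h0 fun i hi' h => by
        rw [(hi i hi').2] at h
        exact g.μ_ne_zero (by linear_combination h)
    refine ⟨⟨by omega, fun i hi' => ⟨(hi i hi').1, ?_⟩⟩, hn', g.wt 2, b, T, hb, ?_, ?_⟩
    · rw [(hi i hi').2, JordanDecomposition.lam, h0]
    · intro v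
      rw [JordanDecomposition.lam, h0, ← hA, actionOf_A]
    · intro v
      rw [← hE, actionOf_ρ]
      rfl

end Operators
end UniserialSolvable

namespace UniserialSolvable

/-! ### Existence of extensions and the classification -/

section Existence

variable {F : Type*} [Field F] [CharZero F]
variable {V : Type*} [LieRing V] [LieAlgebra F V] [IsLieAbelian V]
variable {x : End F V} {e : ℕ} [NeZero e]

namespace JordanDecomposition

variable (D : JordanDecomposition x e) {k : ℕ}

theorem exists_polyM_equiv (hk : 1 ≤ k) (hkn : k ≤ D.n) (α : F)
    (X : Matrix (Fin (k - 1)) (Fin (D.n - k)) F) :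
    ∃ Q : D.polyM α k ≃ₗ[Polynomial F]
        Torsion F (fun i : Fin (min k (D.n + 1 - k)) => D.n - 2 * (i : ℕ)),
      Q (AEval'.of _ (cornerHat X)) = inFirst _ 1 :=
  exists_hatMatrices_equiv (N := D.n) (p := k) (q := D.n + 1 - k) (by omega) (by omega) (by omega)
    α D.lam (cornerHat X) (by
      change cornerMatrix X _ _ ≠ 0
      rw [cornerMatrix_first _ _ _ rfl, if_pos (by simp only; omega)]
      exact one_ne_zero)

theorem exists_abstract_equiv (hlam : D.lam ≠ 0) (hD : ∀ i, D.eigenvalue i = D.lam) (hk : 1 < k)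
    (hkn : k < D.n) (α : F) (X : Matrix (Fin (k - 1)) (Fin (D.n - k)) F) :
    ∃ (P : D.polyV ≃ₗ[Polynomial F] Torsion F D.size)
      (Q : D.polyM α k ≃ₗ[Polynomial F]
        Torsion F (fun i : Fin (min k (D.n + 1 - k)) => D.n - 2 * (i : ℕ))),
      P (Module.AEval'.of _ D.v₀) = inFirst _ 1 ∧
      Q (Module.AEval'.of _ (cornerHat X)) = inFirst _ 1 ∧
      ∃ Ψ : D.Extension (D.repX α k X) ≃ AbstractMono F D.size
          (fun i : Fin (min k (D.n + 1 - k)) => D.n - 2 * (i : ℕ)),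
        ∀ (R : D.Extension (D.repX α k X)) (v : V),
          ((Module.AEval'.of _).symm
            (Q.symm ((Ψ R).1 (P (Module.AEval'.of _ v)))) : hatMatrices F k (D.n + 1 - k)).1 =
            R.1 (ofV x v) := by
  obtain ⟨P, hP⟩ := D.exists_polyV_equiv hD
  obtain ⟨Q, hQ⟩ := D.exists_polyM_equiv hk.le hkn.le α X
  refine ⟨P, Q, hP, hQ, (D.extensionEquivMono hlam two_ne_zero hD hk hkn).trans
    (D.monoEquivAbstract P Q hP hQ), fun R v => ?_⟩
  change ((Module.AEval'.of _).symm (Q.symm (Q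
    ((D.extensionEquivMono hlam two_ne_zero hD hk hkn R).1 (P.symm
      (P (Module.AEval'.of _ v)))))) : hatMatrices F k (D.n + 1 - k)).1 = _
  rw [LinearEquiv.symm_apply_apply, LinearEquiv.symm_apply_apply]
  rfl

theorem nonempty_extension_repX (hlam : D.lam ≠ 0) (hD : D.IsTypeOne) (hk : 1 < k) (hkn : k < D.n)
    (hek : e ≤ min k (D.n + 1 - k)) (α : F) (X : Matrix (Fin (k - 1)) (Fin (D.n - k)) F) :
    Nonempty (D.Extension (D.repX α k X)) := by
  obtain ⟨P, Q, -, -, Ψ, -⟩ := D.exists_abstract_equiv hlam hD.1 hk hkn α X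
  obtain ⟨f⟩ := nonempty_abstractMono (F := F) (Nat.pos_of_ne_zero (NeZero.ne e)) hek D.size
    (fun i : Fin (min k (D.n + 1 - k)) => D.n - 2 * (i : ℕ)) (by simp [n]) (fun i => by
      have := hD.2 i
      simp only [Fin.val_castLE]
      omega)
  exact ⟨Ψ.symm f⟩

theorem exists_faithful_uniserial_of_typeOne (hlam : D.lam ≠ 0) (he : 1 < e) (hD : D.IsTypeOne) :
    ∃ (d : ℕ) (R : Alg x →ₗ⁅F⁆ Matrix (Fin d) (Fin d) F), IsFaithful R ∧ IsUniserial R := by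
  have h1 := hD.2 ⟨e - 1, by omega⟩
  have h2 := D.size_pos ⟨e - 1, by omega⟩
  simp only at h1
  -- `k = e` is admissible: the last block gives `1 ≤ n - 2(e - 1)`, whence `e ≤ n + 1 - e`
  obtain ⟨R⟩ := D.nonempty_extension_repX (k := e) hlam hD he (by omega)
    (le_min le_rfl (by omega)) 0 0
  let T := LinearEquiv.funCongrLeft F F (Fintype.equivFin (Fin e ⊕ Fin (D.n + 1 - e))).symm
  exact ⟨_, conjRep T R.1, R.2.1.conjRep T, R.2.2.1.conjRep T⟩

theorem exists_faithful_uniserial_of_typeTwo (hn : 2 ≤ D.n) (hD : D.IsTypeTwo) (hodd : Odd D.n) :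
    ∃ (d : ℕ) (R : Alg x →ₗ⁅F⁆ Matrix (Fin d) (Fin d) F), IsFaithful R ∧ IsUniserial R := by
  obtain ⟨R, -⟩ := D.exists_extension_repA (α := 0)
    (a := fun i : Fin D.n => if (i : ℕ) + 1 = 1 then 1 else 0) hD hodd hn
    ⟨fun i hi => if_pos hi, fun i hi => if_neg fun h => by
      rw [h] at hi; exact Nat.not_even_one hi⟩ (one_ne_zero (α := F))
  let T := LinearEquiv.funCongrLeft F F (Fintype.equivFin (Idx D.n)).symm
  exact ⟨_, conjRep T R.1, R.2.1.conjRep T, R.2.2.1.conjRep T⟩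

end JordanDecomposition
end Existence

end UniserialSolvable

open UniserialSolvable in
theorem theorem4p1 {F : Type*} [Field F] [IsAlgClosed F] [CharZero F]
    {V : Type*} [LieRing V] [LieAlgebra F V] [IsLieAbelian V] [FiniteDimensional F V]
    (x : Module.End F V) (hx : IsUnit x) (hnd : ¬ IsDiagonalizable x)
    (e : ℕ) [NeZero e] (he : 1 < e) (D : JordanDecomposition x e) :
    -- (1) the faithful uniserial representations of `𝔤` and their restrictions to `𝔤_1`
    (∀ (d : ℕ) (R : Alg x →ₗ⁅F⁆ Matrix (Fin d) (Fin d) F), IsFaithful R → IsUniserial R →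
      IsUniserial (D.restrict R) ∧
      (d = D.n + 1 ∨ d = D.n + 2) ∧
      (d = D.n + 1 →
        D.IsTypeOne ∧
        ∃ (α : F) (k : ℕ) (X : Matrix (Fin (k - 1)) (Fin (D.n - k)) F),
          1 < k ∧ k < D.n ∧ e ≤ min k (D.n + 1 - k) ∧
          IsIsomorphic (D.restrict R : D.g₁ →ₗ[F] Matrix (Fin d) (Fin d) F) (D.repX α k X) ∧
          ∀ (β : F) (l : ℕ) (Y : Matrix (Fin (l - 1)) (Fin (D.n - l)) F), 1 ≤ l → l ≤ D.n →
            IsIsomorphic (D.restrict R : D.g₁ →ₗ[F] Matrix (Fin d) (Fin d) F) (D.repX β l Y) →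
            β = α ∧ l = k ∧ HEq Y X) ∧
      (d = D.n + 2 →
        D.IsTypeTwo ∧ Odd D.n ∧
        ∃! p : F × (Fin D.n → F), IsAdmissible p.2 ∧
          IsIsomorphic (D.restrict R : D.g₁ →ₗ[F] Matrix (Fin d) (Fin d) F)
            (D.repA p.1 p.2))) ∧
    -- (2) the extensions of `R_{α,k,X}` to `𝔤`
    (D.IsTypeOne → ∀ (α : F) (k : ℕ) (X : Matrix (Fin (k - 1)) (Fin (D.n - k)) F),
      1 < k → k < D.n → e ≤ min k (D.n + 1 - k) →
      Nonempty (D.Extension (D.repX α k X)) ∧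
      (∃ Φ : D.Extension (D.repX α k X) ≃ D.Mono α k X,
        ∀ (R : D.Extension (D.repX α k X)) (v : V), (Φ R).matrix v = R.1 (ofV x v)) ∧
      (∃ (P : D.polyV ≃ₗ[Polynomial F] Torsion F D.size)
        (Q : D.polyM α k ≃ₗ[Polynomial F]
          Torsion F (fun i : Fin (min k (D.n + 1 - k)) => D.n - 2 * (i : ℕ))),
        P (Module.AEval'.of _ D.v₀) = inFirst _ 1 ∧
        Q (Module.AEval'.of _ (cornerHat X)) = inFirst _ 1 ∧
        ∃ Ψ : D.Extension (D.repX α k X) ≃ AbstractMono F D.size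
            (fun i : Fin (min k (D.n + 1 - k)) => D.n - 2 * (i : ℕ)),
          ∀ (R : D.Extension (D.repX α k X)) (v : V),
            ((Module.AEval'.of _).symm
              (Q.symm ((Ψ R).1 (P (Module.AEval'.of _ v)))) : hatMatrices F k (D.n + 1 - k)).1 =
              R.1 (ofV x v)) ∧
      (∀ R S : D.Extension (D.repX α k X),
        IsIsomorphic
          (R.1 : Alg x →ₗ[F] Matrix (Fin k ⊕ Fin (D.n + 1 - k)) (Fin k ⊕ Fin (D.n + 1 - k)) F)
          (S.1 : Alg x →ₗ[F] Matrix (Fin k ⊕ Fin (D.n + 1 - k)) (Fin k ⊕ Fin (D.n + 1 - k)) F) ↔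
          R = S)) ∧
    -- (3) the extensions of `R_{α,a}` to `𝔤`
    (D.IsTypeTwo → Odd D.n → ∀ (α : F) (a : Fin D.n → F), IsAdmissible a →
      Nonempty (D.Extension (D.repA α a)) ∧
      (∀ i : Fin e, i ≠ 0 → ∀ w₀ ∈ D.block i, w₀ ≠ 0 →
        ∃ Φ : D.Extension (D.repA α a) ≃ {β : F // β ≠ 0},
          ∀ R : D.Extension (D.repA α a), R.1 (ofV x w₀) =
            (Φ R).1 • Matrix.single (Sum.inl 0) (Sum.inr (Sum.inr 0)) 1) ∧
      (∀ R S : D.Extension (D.repA α a),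
        IsIsomorphic (R.1 : Alg x →ₗ[F] Matrix (Idx D.n) (Idx D.n) F)
          (S.1 : Alg x →ₗ[F] Matrix (Idx D.n) (Idx D.n) F) ↔ R = S)) ∧
    -- (4) existence of a faithful uniserial representation
    ((∃ (d : ℕ) (R : Alg x →ₗ⁅F⁆ Matrix (Fin d) (Fin d) F), IsFaithful R ∧ IsUniserial R) ↔
      D.IsTypeOne ∨ (D.IsTypeTwo ∧ Odd D.n)) := by

  have hlam := D.eigenvalue_ne_zero hx 0
  have hn := D.two_le_n hnd
  refine ⟨fun d R hf hR => ?_, fun hD α k X hk hkn hek => ⟨?_, ?_, ?_, ?_⟩,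
    fun hD hodd α a ha => ⟨?_, ?_, ?_⟩, ?_, ?_⟩
  · rcases exists_shape_of_isUniserial hx hnd he D R hf hR with
      ⟨hD, α, k, X, T, hk, hkn, hek, hA, hE⟩ | ⟨hD, hodd, α, a, T, ha, hA, hE⟩
    · have hd : d = D.n + 1 := by
        have := T.finrank_eq
        rw [Module.finrank_pi, Module.finrank_pi, Fintype.card_fin, Fintype.card_sum,
          Fintype.card_fin, Fintype.card_fin] at this
        omega
      have : Nonempty (Fin d) := ⟨⟨0, by omega⟩⟩
      have hiso := D.isIsomorphic_linearRep R _ _ T hA hE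
      refine ⟨isUniserial_of_twoBlocks hk.le hkn.le X (D.restrict R) T D.gen₁
        (D.ofV₁ (D.basis 0 ⟨0, D.size_pos 0⟩)) hA hE, Or.inl hd, fun _ => ⟨hD, α, k, X, hk, hkn,
        hek, hiso, fun β l Y hl hln h => ?_⟩, fun h => by omega⟩
      exact D.repX_unique hlam two_ne_zero hk.le hkn.le hl (hiso.symm'.trans' h)
    · have hd : d = D.n + 2 := by
        have := T.finrank_eq
        rw [Module.finrank_pi, Module.finrank_pi, Fintype.card_fin, Fintype.card_sum,
          Fintype.card_sum, Fintype.card_fin, Fintype.card_fin] at this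
        omega
      have : Nonempty (Fin d) := ⟨⟨0, by omega⟩⟩
      have hiso := D.isIsomorphic_linearRep R _ _ T hA hE
      refine ⟨isUniserial_of_threeBlocks (D.size_pos 0) ha (D.restrict R) T D.gen₁
        (D.ofV₁ (D.basis 0 ⟨0, D.size_pos 0⟩)) hA hE, Or.inr hd, fun h => by omega,
        fun _ => ⟨hD, hodd, (α, a), ⟨ha, hiso⟩, ?_⟩⟩
      rintro ⟨β, b⟩ ⟨hb, h⟩
      obtain ⟨rfl, rfl⟩ := D.repA_unique hlam ha hb (hiso.symm'.trans' h)
      rfl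
  · exact D.nonempty_extension_repX hlam hD hk hkn hek α X
  · exact ⟨D.extensionEquivMono hlam two_ne_zero hD.1 hk hkn, fun R v => rfl⟩
  · exact D.exists_abstract_equiv hlam hD.1 hk hkn α X
  · exact D.extension_repX_iso_iff hlam hk hkn
  · obtain ⟨R, -⟩ := D.exists_extension_repA (α := α) hD hodd hn ha (one_ne_zero (α := F))
    exact ⟨R⟩
  · intro i hi w hw hw0
    exact D.exists_extension_repA_equiv hlam two_ne_zero three_ne_zero hD hodd hn ha hi hw hw0
  · exact D.extension_repA_iso_iff hlam two_ne_zero ha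
  · rintro ⟨d, R, hf, hR⟩
    rcases exists_shape_of_isUniserial hx hnd he D R hf hR with ⟨hD, -⟩ | ⟨hD, hodd, -⟩
    · exact Or.inl hD
    · exact Or.inr ⟨hD, hodd⟩
  · rintro (hD | ⟨hD, hodd⟩)
    · exact D.exists_faithful_uniserial_of_typeOne hlam he hD
    · exact D.exists_faithful_uniserial_of_typeTwo hn hD hodd
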